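/- **Setting.** Let $D_K$ be a diagram, with at least one crossing, of an oriented knot $K\subset S^3$; let $a_0$ be its unbounded face and $a_1,\dots,a_m$ the other faces, so that there are $m-1$ crossings. Let $\pi=\pi_1(S^3-K)$ be the knot group, given by its Dehn presentation: one generator $A_j$ for each face $a_j$ with $j\ge 1$, $A_0=1$, and for each crossing $c$ one relation. If the crossing is turned such that its over-strand runs from the lower left to the upper right, and $a_{top},a_{left},a_{right},a_{bot}$ are the faces at its four corners, the relation $r_c$ is $A_{bot}A_{left}^{-1}=A_{right}A_{top}^{-1}$; the element $x_c=A_{bot}A_{left}^{-1}\in\pi$ is the Wirtinger generator of the over-strand. Let $\psi:\pi\to\langle t\rangle$ be the abelianization that takes the meridians that link $K$ positively to $t$. Let $R$ be an integral domain and $\rho:\pi\to GL_n(R)$ a representation. Let $\phi:\mathbb Z[F_m]\to\mathbb Z[\pi]$ be the projection from the group ring of the free group on $A_1,\dots,A_m$, let $\Phi=(\rho\otimes\psi)\circ\phi:\mathbb Z[F_m]\to M_n(R[t^{\pm1}])$, and let $M_{K,\rho}$ be the block matrix with blocks $\Phi(\partial r_c/\partial A_j)$ (free derivatives). Choose a face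 $f_1$ adjacent to the unbounded face, and let $M'_{K,\rho}$ be the square matrix that is left when the block column of $f_1$ is deleted. The twisted Alexander polynomial is $\Delta_{K,\rho}(t)=\det M'_{K,\rho}$. Write $f\doteq g$ if $f=\pm t^kg$ for some $k\in\mathbb Z$. **The twisted dimer model.** All graphs are finite and bipartite, with vertex classes $V_1,V_2$ and edge weights in $R[t^{\pm1}]$; parallel edges are allowed. 1. *Twisted Alexander graph $\Gamma'$.* Disregard the unbounded face and $f_1$. Let $V_1$ have $n$ vertices for each crossing and $V_2$ have $n$ vertices for each remaining face. For each corner of the diagram, at a crossing $c$ and a remaining face $f$, insert a copy of $K_{n,n}$ in which the edge between the $i$-th vertex of $c$ and the $j$-th vertex of $f$ has as weight the $(i,j)$ entry of $tX$, $X=\rho(x_c)$, if the corner is to the left of the over-strand, and of $\mathrm{Id}$ if it is to the right. Edges of weight $0$ may be kept or left out. 2. *Tripling.* Tripling an edge $uv$ ($u\in V_1$, $v\in V_2$) of weight $a$ replaces it by a path $u,w_2,w_1,v$ with new vertices $w_2\in V_2$, $w_1\in V_1$ and edge weights $1,-1,a$. Triple edges repeatedly, and draw the resulting graph $\Gamma''$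 generically in the plane in such a way that every edge takes part in at most one crossing. (Equivalently: draw $\Gamma'$ in the plane, for instance with the least possible number of crossings, and triple its edges until this holds.) 3. *Butterflies.* Let an edge $r_1c_1$ of weight $a$ cross an edge $r_0c_0$ of weight $b$ ($r_i\in V_1$, $c_i\in V_2$), where, seen from the crossing point, the ends $r_0,r_1,c_0,c_1$ follow each other counterclockwise. Replace the two edges, near where they were drawn, by two new vertices $p\in V_1$, $q\in V_2$ and seven edges: $pq$ and $pc_0$ of weight $-1$, $r_1c_0$ and $r_1q$ of weight $1$, $pc_1$ of weight $a$, $r_0q$ of weight $-b$, and $r_0c_1$ of weight $ab$. Doing this at all crossing points gives a graph $\Gamma'''$ with weights $\alpha_{\rho,b}$. 4. *Kasteleyn weighting.* A Kasteleyn weighting of a plane bipartite graph assigns to each edge a sign $\pm1$ such that every bounded face with $0 \bmod 4$ edges has an odd number of assignments $-1$, and every bounded face with $2\bmod 4$ edges an even number. Edges are counted along the boundary walk, and if the graph is disconnected the condition is imposed on each component separately, as a plane graph with its own unbounded face. 5. The partition function of a graph with weights $\mu$ is $Z(\Gamma_\mu)=\sum_m\prod_{e\in m}\mu(e)$, where $m$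 runs over the dimer coverings (perfect matchings) of $\Gamma$. **Theorem.** For every $D_K$, $\rho$ and $f_1$, and for all choices made in steps 1 and 2, the graph $\Gamma'''$ is a plane graph, it has a Kasteleyn weighting, and for every Kasteleyn weighting $\varepsilon$ of $\Gamma'''$ $$Z(\Gamma'''_{\varepsilon\cdot\alpha_{\rho,b}})\ \doteq\ \Delta_{K,\rho}(t).$$ -/

import Mathlib

open scoped LaurentPolynomial

namespace TwistedDimer

/-! ## Combinatorial maps

A graph embedded in an oriented closed surface is recorded by permutations of a finite set:
the cycles of `s` are the rotations (counterclockwise) around vertices, those of `a` are the edges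
(or, for a bipartite graph, `s` and `a` are the rotations around the vertices of the two
colours), and the cycles of the product are the faces. The surface is a union of spheres exactly
if Euler's formula `V - E + F = 2 * (number of components)` holds. -/

/-- The number of cycles of a permutation, fixed points included. -/
noncomputable def cycleCount {D : Type} (f : Equiv.Perm D) : ℕ :=
  Nat.card (Quotient (Equiv.Perm.SameCycle.setoid f))

/-- The set of connected components of the map given by two permutations. -/
abbrev Component {D : Type} (s a : Equiv.Perm D) : Type :=
  MulAction.orbitRel.Quotient (Subgroup.closure {s, a}) D

/-- Every component of the map `(s, a)` has genus zero (is drawn on a sphere, that is, in the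
plane). If `a` is a fixed-point-free involution, then it has `card D / 2` cycles, and this reads
`V - E + F = 2 * components` with `E = card D / 2`. If `s`, `a` are the rotations around the
vertices of the two colours of a bipartite graph with edge set `D`, then it is the same formula
with `V = cycleCount s + cycleCount a` and `E = card D`. -/
def IsSpherical {D : Type} (s a : Equiv.Perm D) : Prop :=
  cycleCount s + cycleCount a + cycleCount (s * a) = Nat.card D + 2 * Nat.card (Component s a)

/-! ## Weighted bipartite graphs, dimer coverings and the partition function -/

universe u

/-- A finite weighted bipartite (multi-)graph with weights in `A`. -/
structure BipGraph (A : Type u) where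
  V₁ : Type
  V₂ : Type
  E : Type
  [fintypeV₁ : Fintype V₁]
  [fintypeV₂ : Fintype V₂]
  [fintypeE : Fintype E]
  [decV₁ : DecidableEq V₁]
  [decV₂ : DecidableEq V₂]
  [decE : DecidableEq E]
  src : E → V₁
  tgt : E → V₂
  wt : E → A

attribute [instance] BipGraph.fintypeV₁ BipGraph.fintypeV₂ BipGraph.fintypeE
  BipGraph.decV₁ BipGraph.decV₂ BipGraph.decE

namespace BipGraph

variable {A : Type u} [CommRing A]

/-- A dimer covering: every vertex is an endpoint of exactly one edge in `m`. -/
def IsDimerCovering (G : BipGraph A) (m : Finset G.E) : Prop :=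
  (∀ v : G.V₁, ∃! e, e ∈ m ∧ G.src e = v) ∧ (∀ v : G.V₂, ∃! e, e ∈ m ∧ G.tgt e = v)

open Classical in
/-- The partition function: the sum over all dimer coverings of the product of the weights. -/
noncomputable def partitionFunction (G : BipGraph A) : A :=
  ∑ m : Finset G.E with G.IsDimerCovering m, ∏ e ∈ m, G.wt e

/-- The graph with the weighting `ε · wt`, for a choice of signs `ε`. -/
def withSigns (G : BipGraph A) (ε : G.E → ℤˣ) : BipGraph A :=
  { G with wt := fun e => ((ε e : ℤ) : A) * G.wt e }

/-- Edge tripling: the edge `e = uv` (with `u ∈ V₁`, `v ∈ V₂`) of weight `a` is replaced by a path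
`u - w₂ - w₁ - v` through two new vertices `w₂ ∈ V₂`, `w₁ ∈ V₁`, whose three edges have the weights
`1`, `-1`, `a`. The edge `u w₂` keeps the name of `e`; the edges `w₁ w₂` and `w₁ v` are
`inr 0` and `inr 1`. -/
def triple (G : BipGraph A) (e : G.E) : BipGraph A where
  V₁ := G.V₁ ⊕ Unit
  V₂ := G.V₂ ⊕ Unit
  E := G.E ⊕ Fin 2
  src := Sum.elim (fun g => Sum.inl (G.src g)) (fun _ => Sum.inr ())
  tgt := Sum.elim (fun g => if g = e then Sum.inr () else Sum.inl (G.tgt g))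
    ![Sum.inr (), Sum.inl (G.tgt e)]
  wt := Sum.elim (fun g => if g = e then 1 else G.wt g) ![-1, G.wt e]

end BipGraph

/-- `IsTripling G H`: the graph `H` arises from `G` by tripling edges finitely often. -/
inductive IsTripling {A : Type u} [CommRing A] : BipGraph A → BipGraph A → Prop
  | refl (G : BipGraph A) : IsTripling G G
  | step {G H : BipGraph A} (e : H.E) : IsTripling G H → IsTripling G (H.triple e)

/-! ## Plane graphs and Kasteleyn weightings -/

section Plane

variable {A : Type u} [CommRing A]

/-- `ρ₁ e` and `ρ₂ e` are the edges that follow `e` counterclockwise around its endpoint in `V₁` and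
in `V₂`. They describe an embedding of `G` in the plane if their cycles are the stars of the
vertices and every component has genus zero. -/
structure IsPlaneEmbedding (G : BipGraph A) (ρ₁ ρ₂ : Equiv.Perm G.E) : Prop where
  star₁ : ∀ e e', ρ₁.SameCycle e e' ↔ G.src e = G.src e'
  star₂ : ∀ e e', ρ₂.SameCycle e e' ↔ G.tgt e = G.tgt e'
  spherical : IsSpherical ρ₁ ρ₂

/-- The faces of the components of a plane bipartite graph: the cycles of `ρ₂ * ρ₁`. If
`(e₁, …, e_k)` is such a cycle, then the closed boundary walk of the face runs through the `2k` edges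
`e₁, ρ₁ e₁, e₂, ρ₁ e₂, …, e_k, ρ₁ e_k`. -/
abbrev Face {E : Type} (ρ₁ ρ₂ : Equiv.Perm E) : Type :=
  Quotient (Equiv.Perm.SameCycle.setoid (ρ₂ * ρ₁))

/-- The face that has the corner between `e` and `ρ₁ e` at the `V₁`-endpoint of `e`. -/
abbrev faceOf {E : Type} (ρ₁ ρ₂ : Equiv.Perm E) (e : E) : Face ρ₁ ρ₂ := Quotient.mk _ e

/-- `U` is a choice of unbounded faces: it contains exactly one face of each component. -/
def IsUnbounded {E : Type} (ρ₁ ρ₂ : Equiv.Perm E) (U : Set (Face ρ₁ ρ₂)) : Prop :=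
  ∀ c : Component ρ₁ ρ₂, ∃! f : Face ρ₁ ρ₂, f ∈ U ∧
    ∃ e : E, faceOf ρ₁ ρ₂ e = f ∧ (Quotient.mk _ e : Component ρ₁ ρ₂) = c

open Classical in
/-- The number of edges of a face, counted along its boundary walk (an edge with the face on both
sides counts twice). -/
noncomputable def faceLength {E : Type} [Fintype E] (ρ₁ ρ₂ : Equiv.Perm E) (f : Face ρ₁ ρ₂) : ℕ :=
  2 * (Finset.univ.filter (fun e : E => faceOf ρ₁ ρ₂ e = f)).card

open Classical in
/-- The number of assignments `-1` along the boundary walk of a face. -/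
noncomputable def negCount {E : Type} [Fintype E] (ρ₁ ρ₂ : Equiv.Perm E) (ε : E → ℤˣ)
    (f : Face ρ₁ ρ₂) : ℕ :=
  (Finset.univ.filter (fun e : E => faceOf ρ₁ ρ₂ e = f ∧ ε e = -1)).card +
    (Finset.univ.filter (fun e : E => faceOf ρ₁ ρ₂ e = f ∧ ε (ρ₁ e) = -1)).card

/-- A Kasteleyn weighting: a bounded face with `0 mod 4` edges has an odd number of assignments
`-1`, one with `2 mod 4` edges an even number. -/
def IsKasteleyn {E : Type} [Fintype E] (ρ₁ ρ₂ : Equiv.Perm E) (U : Set (Face ρ₁ ρ₂))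
    (ε : E → ℤˣ) : Prop :=
  ∀ f : Face ρ₁ ρ₂, f ∉ U →
    (faceLength ρ₁ ρ₂ f % 4 = 0 → Odd (negCount ρ₁ ρ₂ ε f)) ∧
    (faceLength ρ₁ ρ₂ f % 4 = 2 → Even (negCount ρ₁ ρ₂ ε f))

end Plane

/-! ## Drawings with crossings, and butterflies -/

section Drawing

/-- The counterclockwise rotation in the planarization of a drawing. `F` is the set of edges of the
graph; a half-edge is the `V₁`-end (`inl (inl e)`) or the `V₂`-end (`inl (inr e)`) of an edge, or one
of the four half-edges `inr (x, 0), …, inr (x, 3)` (counterclockwise) at a crossing point `x`. -/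
def planarRotation {F : Type} (X : Type) (ρ₁ ρ₂ : Equiv.Perm F) :
    Equiv.Perm ((F ⊕ F) ⊕ X × Fin 4) :=
  Equiv.sumCongr (Equiv.sumCongr ρ₁ ρ₂) (Equiv.prodCongr (Equiv.refl X) (Equiv.addRight 1))

/-- The other half of the segment on which a half-edge of the planarization lies. The edges in `U`
are not crossed. At the crossing point `x` the edges `(x, 0)` and `(x, 1)` cross: the half-edges at
`x` lead, counterclockwise, to the `V₁`-ends of `(x, 0)` and `(x, 1)` and to the `V₂`-ends of `(x, 0)`
and `(x, 1)`. -/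
def segmentFun (U X : Type) :
    ((U ⊕ X × Fin 2) ⊕ (U ⊕ X × Fin 2)) ⊕ X × Fin 4 →
      ((U ⊕ X × Fin 2) ⊕ (U ⊕ X × Fin 2)) ⊕ X × Fin 4
  | .inl (.inl (.inl u)) => .inl (.inr (.inl u))
  | .inl (.inr (.inl u)) => .inl (.inl (.inl u))
  | .inl (.inl (.inr (x, 0))) => .inr (x, 0)
  | .inl (.inl (.inr (x, 1))) => .inr (x, 1)
  | .inl (.inr (.inr (x, 0))) => .inr (x, 2)
  | .inl (.inr (.inr (x, 1))) => .inr (x, 3)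
  | .inr (x, 0) => .inl (.inl (.inr (x, 0)))
  | .inr (x, 1) => .inl (.inl (.inr (x, 1)))
  | .inr (x, 2) => .inl (.inr (.inr (x, 0)))
  | .inr (x, 3) => .inl (.inr (.inr (x, 1)))

theorem segmentFun_involutive (U X : Type) : Function.Involutive (segmentFun U X) := by
  rintro (((u | ⟨x, i⟩) | (u | ⟨x, i⟩)) | ⟨x, i⟩) <;> first | rfl | (fin_cases i <;> rfl)

/-- The segments of the planarization, as a permutation of its half-edges. -/
def segments (U X : Type) : Equiv.Perm (((U ⊕ X × Fin 2) ⊕ (U ⊕ X × Fin 2)) ⊕ X × Fin 4) :=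
  (segmentFun_involutive U X).toPerm

/-- A generic drawing of a bipartite graph in the plane in which every edge takes part in at most
one crossing. `X` is the set of crossing points, and the edges are named by
`U ⊕ X × Fin 2`: those in `U` are not crossed, and `(x, 0)` crosses `(x, 1)` at `x`; the names are
chosen such that the directions from `x` to the `V₁`-ends of `(x, 0)` and `(x, 1)` and to the `V₂`-ends
of `(x, 0)` and `(x, 1)` follow each other counterclockwise in this order. The drawing lies in the
plane if its planarization (the crossing points are taken as further vertices) does. -/
structure Drawing {A : Type u} [CommRing A] (G : BipGraph A) where
  U : Type
  X : Type
  [fintypeU : Fintype U]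
  [fintypeX : Fintype X]
  [decU : DecidableEq U]
  [decX : DecidableEq X]
  edge : U ⊕ X × Fin 2 ≃ G.E
  rot₁ : Equiv.Perm (U ⊕ X × Fin 2)
  rot₂ : Equiv.Perm (U ⊕ X × Fin 2)
  star₁ : ∀ e e', rot₁.SameCycle e e' ↔ G.src (edge e) = G.src (edge e')
  star₂ : ∀ e e', rot₂.SameCycle e e' ↔ G.tgt (edge e) = G.tgt (edge e')
  spherical : IsSpherical (planarRotation X rot₁ rot₂) (segments U X)

attribute [instance] Drawing.fintypeU Drawing.fintypeX Drawing.decU Drawing.decX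

/-- The seven edges of a butterfly. Its two new vertices are `p ∈ V₁` and `q ∈ V₂`. If the edge
`r₀ c₀` of weight `b` is crossed by the edge `r₁ c₁` of weight `a` (`rᵢ ∈ V₁`, `cᵢ ∈ V₂`, and `r₀`, `r₁`,
`c₀`, `c₁` counterclockwise), then the two edges are replaced by
```
          c₀ ---- 1 ---- r₁              c₀ --- top --- r₁
          |              |               |              |
         -1              1             pc₀             qr₁
          |              |               |              |
          p ---- -1 ---- q               p --- mid ---- q
          |              |               |              |
          a             -b             pc₁             qr₀
          |              |               |              |
          c₁ ---- ab --- r₀              c₁ --- bot --- r₀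
``` -/
inductive Wing : Type
  | top | mid | bot | pc₀ | pc₁ | qr₀ | qr₁
  deriving DecidableEq

instance : Fintype Wing :=
  Fintype.ofList [.top, .mid, .bot, .pc₀, .pc₁, .qr₀, .qr₁] (by intro w; cases w <;> simp)

variable {A : Type u} [CommRing A] {G : BipGraph A}

/-- Replace every crossing pair of edges by a butterfly. -/
def Drawing.butterfly (P : Drawing G) : BipGraph A where
  V₁ := G.V₁ ⊕ P.X
  V₂ := G.V₂ ⊕ P.X
  E := P.U ⊕ P.X × Wing
  src
    | .inl u => .inl (G.src (P.edge (.inl u)))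
    | .inr (x, .top) => .inl (G.src (P.edge (.inr (x, 1))))
    | .inr (x, .mid) => .inr x
    | .inr (x, .bot) => .inl (G.src (P.edge (.inr (x, 0))))
    | .inr (x, .pc₀) => .inr x
    | .inr (x, .pc₁) => .inr x
    | .inr (x, .qr₀) => .inl (G.src (P.edge (.inr (x, 0))))
    | .inr (x, .qr₁) => .inl (G.src (P.edge (.inr (x, 1))))
  tgt
    | .inl u => .inl (G.tgt (P.edge (.inl u)))
    | .inr (x, .top) => .inl (G.tgt (P.edge (.inr (x, 0))))
    | .inr (x, .mid) => .inr x
    | .inr (x, .bot) => .inl (G.tgt (P.edge (.inr (x, 1))))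
    | .inr (x, .pc₀) => .inl (G.tgt (P.edge (.inr (x, 0))))
    | .inr (x, .pc₁) => .inl (G.tgt (P.edge (.inr (x, 1))))
    | .inr (x, .qr₀) => .inr x
    | .inr (x, .qr₁) => .inr x
  wt
    | .inl u => G.wt (P.edge (.inl u))
    | .inr (_, .top) => 1
    | .inr (_, .mid) => -1
    | .inr (x, .bot) => G.wt (P.edge (.inr (x, 1))) * G.wt (P.edge (.inr (x, 0)))
    | .inr (_, .pc₀) => -1
    | .inr (x, .pc₁) => G.wt (P.edge (.inr (x, 1)))
    | .inr (x, .qr₀) => -G.wt (P.edge (.inr (x, 0)))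
    | .inr (_, .qr₁) => 1

/-! The rotations of the plane graph that the insertion of the butterflies produces. Around an old
vertex a crossed edge gives way to two edges: `qr₀, bot` at `r₀`, `top, qr₁` at `r₁`,
`pc₀, top` at `c₀`, `bot, pc₁` at `c₁` (counterclockwise). Around `p` the rotation is
`mid, pc₀, pc₁`, and around `q` it is `qr₁, mid, qr₀`. -/

/-- The first edge in place of an edge, at its `V₁`-end. -/
def first₁ {U X : Type} : U ⊕ X × Fin 2 → U ⊕ X × Wing
  | .inl u => .inl u
  | .inr (x, 0) => .inr (x, .qr₀)
  | .inr (x, 1) => .inr (x, .top)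

/-- The last edge in place of an edge, at its `V₁`-end. -/
def last₁ {U X : Type} : U ⊕ X × Fin 2 → U ⊕ X × Wing
  | .inl u => .inl u
  | .inr (x, 0) => .inr (x, .bot)
  | .inr (x, 1) => .inr (x, .qr₁)

/-- The first edge in place of an edge, at its `V₂`-end. -/
def first₂ {U X : Type} : U ⊕ X × Fin 2 → U ⊕ X × Wing
  | .inl u => .inl u
  | .inr (x, 0) => .inr (x, .pc₀)
  | .inr (x, 1) => .inr (x, .bot)

/-- The last edge in place of an edge, at its `V₂`-end. -/
def last₂ {U X : Type} : U ⊕ X × Fin 2 → U ⊕ X × Wing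
  | .inl u => .inl u
  | .inr (x, 0) => .inr (x, .top)
  | .inr (x, 1) => .inr (x, .pc₁)

/-- The next edge counterclockwise around the `V₁`-endpoint. -/
def next₁ {U X : Type} (ρ : U ⊕ X × Fin 2 → U ⊕ X × Fin 2) : U ⊕ X × Wing → U ⊕ X × Wing
  | .inl u => first₁ (ρ (.inl u))
  | .inr (x, .qr₀) => .inr (x, .bot)
  | .inr (x, .bot) => first₁ (ρ (.inr (x, 0)))
  | .inr (x, .top) => .inr (x, .qr₁)
  | .inr (x, .qr₁) => first₁ (ρ (.inr (x, 1)))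
  | .inr (x, .mid) => .inr (x, .pc₀)
  | .inr (x, .pc₀) => .inr (x, .pc₁)
  | .inr (x, .pc₁) => .inr (x, .mid)

/-- The previous edge counterclockwise around the `V₁`-endpoint; `ρ` is the inverse rotation. -/
def prev₁ {U X : Type} (ρ : U ⊕ X × Fin 2 → U ⊕ X × Fin 2) : U ⊕ X × Wing → U ⊕ X × Wing
  | .inl u => last₁ (ρ (.inl u))
  | .inr (x, .qr₀) => last₁ (ρ (.inr (x, 0)))
  | .inr (x, .bot) => .inr (x, .qr₀)
  | .inr (x, .top) => last₁ (ρ (.inr (x, 1)))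
  | .inr (x, .qr₁) => .inr (x, .top)
  | .inr (x, .mid) => .inr (x, .pc₁)
  | .inr (x, .pc₀) => .inr (x, .mid)
  | .inr (x, .pc₁) => .inr (x, .pc₀)

/-- The next edge counterclockwise around the `V₂`-endpoint. -/
def next₂ {U X : Type} (ρ : U ⊕ X × Fin 2 → U ⊕ X × Fin 2) : U ⊕ X × Wing → U ⊕ X × Wing
  | .inl u => first₂ (ρ (.inl u))
  | .inr (x, .pc₀) => .inr (x, .top)
  | .inr (x, .top) => first₂ (ρ (.inr (x, 0)))
  | .inr (x, .bot) => .inr (x, .pc₁)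
  | .inr (x, .pc₁) => first₂ (ρ (.inr (x, 1)))
  | .inr (x, .qr₁) => .inr (x, .mid)
  | .inr (x, .mid) => .inr (x, .qr₀)
  | .inr (x, .qr₀) => .inr (x, .qr₁)

/-- The previous edge counterclockwise around the `V₂`-endpoint; `ρ` is the inverse rotation. -/
def prev₂ {U X : Type} (ρ : U ⊕ X × Fin 2 → U ⊕ X × Fin 2) : U ⊕ X × Wing → U ⊕ X × Wing
  | .inl u => last₂ (ρ (.inl u))
  | .inr (x, .pc₀) => last₂ (ρ (.inr (x, 0)))
  | .inr (x, .top) => .inr (x, .pc₀)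
  | .inr (x, .bot) => last₂ (ρ (.inr (x, 1)))
  | .inr (x, .pc₁) => .inr (x, .bot)
  | .inr (x, .qr₁) => .inr (x, .qr₀)
  | .inr (x, .mid) => .inr (x, .qr₁)
  | .inr (x, .qr₀) => .inr (x, .mid)

theorem prev₁_first₁ {U X : Type} (ρ : U ⊕ X × Fin 2 → U ⊕ X × Fin 2) (e : U ⊕ X × Fin 2) :
    prev₁ ρ (first₁ e) = last₁ (ρ e) := by
  rcases e with u | ⟨x, i⟩ <;> first | rfl | (fin_cases i <;> rfl)

theorem next₁_last₁ {U X : Type} (ρ : U ⊕ X × Fin 2 → U ⊕ X × Fin 2) (e : U ⊕ X × Fin 2) :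
    next₁ ρ (last₁ e) = first₁ (ρ e) := by
  rcases e with u | ⟨x, i⟩ <;> first | rfl | (fin_cases i <;> rfl)

theorem prev₂_first₂ {U X : Type} (ρ : U ⊕ X × Fin 2 → U ⊕ X × Fin 2) (e : U ⊕ X × Fin 2) :
    prev₂ ρ (first₂ e) = last₂ (ρ e) := by
  rcases e with u | ⟨x, i⟩ <;> first | rfl | (fin_cases i <;> rfl)

theorem next₂_last₂ {U X : Type} (ρ : U ⊕ X × Fin 2 → U ⊕ X × Fin 2) (e : U ⊕ X × Fin 2) :
    next₂ ρ (last₂ e) = first₂ (ρ e) := by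
  rcases e with u | ⟨x, i⟩ <;> first | rfl | (fin_cases i <;> rfl)

/-- The rotation around the vertices in `V₁` after the insertion of the butterflies. -/
def Drawing.butterflyRot₁ (P : Drawing G) : Equiv.Perm P.butterfly.E where
  toFun := next₁ P.rot₁
  invFun := prev₁ P.rot₁.symm
  left_inv := by
    rintro (u | ⟨x, _ | _⟩) <;> first | rfl | (simp [next₁, prev₁_first₁, last₁]; rfl)
  right_inv := by
    rintro (u | ⟨x, _ | _⟩) <;> first | rfl | (simp [prev₁, next₁_last₁, first₁]; rfl)

/-- The rotation around the vertices in `V₂` after the insertion of the butterflies. -/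
def Drawing.butterflyRot₂ (P : Drawing G) : Equiv.Perm P.butterfly.E where
  toFun := next₂ P.rot₂
  invFun := prev₂ P.rot₂.symm
  left_inv := by
    rintro (u | ⟨x, _ | _⟩) <;> first | rfl | (simp [next₂, prev₂_first₂, last₂]; rfl)
  right_inv := by
    rintro (u | ⟨x, _ | _⟩) <;> first | rfl | (simp [prev₂, next₂_last₂, first₂]; rfl)

end Drawing

/-! ## The free (Fox) derivative -/

section Fox

variable {ι : Type} [DecidableEq ι]

/-- The free derivative of a word; `(j, true)` is the letter `A_j`, `(j, false)` is `A_j⁻¹`. -/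
noncomputable def foxWord (i : ι) : List (ι × Bool) → MonoidAlgebra ℤ (FreeGroup ι)
  | [] => 0
  | (j, b) :: L =>
    (if j = i then (if b then 1 else -MonoidAlgebra.of ℤ _ (FreeGroup.of j)⁻¹) else 0) +
      MonoidAlgebra.of ℤ _ (FreeGroup.mk [(j, b)]) * foxWord i L

theorem foxWord_append (i : ι) (L M : List (ι × Bool)) :
    foxWord i (L ++ M) = foxWord i L + MonoidAlgebra.of ℤ _ (FreeGroup.mk L) * foxWord i M := by
  induction L with
  | nil =>
    have : FreeGroup.mk ([] : List (ι × Bool)) = 1 := rfl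
    simp only [List.nil_append, foxWord, this, map_one, zero_add, one_mul]
  | cons p L ih =>
    obtain ⟨j, b⟩ := p
    have : FreeGroup.mk ((j, b) :: L) = FreeGroup.mk [(j, b)] * FreeGroup.mk L := by
      rw [FreeGroup.mul_mk]; rfl
    rw [List.cons_append, foxWord, foxWord, ih, this, map_mul, mul_add, mul_assoc, add_assoc]

theorem foxWord_cancel (i j : ι) (b : Bool) : foxWord i [(j, b), (j, !b)] = 0 := by
  have h1 : FreeGroup.mk [(j, true)] = FreeGroup.of j := rfl
  have h2 : FreeGroup.mk [(j, false)] = (FreeGroup.of j)⁻¹ := rfl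
  by_cases h : j = i
  · cases b
    · simp [foxWord, h]
      rw [← h, h2]
      simp
    · simp only [foxWord, h, if_true, Bool.not_true, mul_zero, add_zero]
      rw [← h, h1, if_neg Bool.false_ne_true, mul_neg, ← map_mul, mul_inv_cancel, map_one]
      simp
  · simp [foxWord, h]

/-- The free derivative `∂/∂A_i : F → ℤ[F]` on the free group. -/
noncomputable def fox (i : ι) : FreeGroup ι → MonoidAlgebra ℤ (FreeGroup ι) :=
  Quot.lift (foxWord i) (by
    rintro _ _ ⟨⟩
    rename_i L M j b
    have h : FreeGroup.mk [(j, b), (j, !b)] = 1 :=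
      Quot.sound (FreeGroup.Red.Step.not (L₁ := []) (L₂ := []))
    have e : L ++ (j, b) :: (j, !b) :: M = L ++ ([(j, b), (j, !b)] ++ M) := rfl
    rw [e, foxWord_append, foxWord_append i _ M, foxWord_append, foxWord_cancel, h, map_one,
      one_mul, zero_add])

theorem fox_one (i : ι) : fox i 1 = 0 := rfl

theorem fox_of (i j : ι) : fox i (FreeGroup.of j) = if j = i then 1 else 0 := by
  change foxWord i [(j, true)] = _
  simp [foxWord]

theorem fox_of_inv (i j : ι) :
    fox i (FreeGroup.of j)⁻¹ =
      if j = i then -MonoidAlgebra.of ℤ _ (FreeGroup.of j)⁻¹ else 0 := by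
  change foxWord i [(j, false)] = _
  simp [foxWord]

theorem fox_mul (i : ι) (v w : FreeGroup ι) :
    fox i (v * w) = fox i v + MonoidAlgebra.of ℤ _ v * fox i w := by
  induction v using Quot.inductionOn
  induction w using Quot.inductionOn
  exact foxWord_append i _ _

end Fox

/-! ## Knot diagrams

At every crossing turn the picture such that the over-strand runs from the lower left to the upper
right. The half-edges `0, 1, 2, 3` at the crossing are those to the upper right (the over-strand
leaves), the upper left, the lower left (the over-strand enters) and the lower right. The corner `i`
is the one between the half-edges `i` and `i + 1` counterclockwise: `0` is the top, `1` the left, `2`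
the bottom and `3` the right corner. Thus the corners `0` and `1` lie to the left of the over-strand
and the corners `2` and `3` to its right. -/

/-- The half-edge `h` is directed away from its crossing. The under-strand leaves a positive crossing
through the half-edge `1` and a negative crossing through the half-edge `3`. -/
def IsOutgoing {C : Type} (positive : C → Bool) (h : C × Fin 4) : Prop :=
  h.2 = 0 ∨ h.2 = (if positive h.1 then 1 else 3)

/-- The half-edge on the same strand on the other side of the crossing. -/
def opposite (C : Type) : Equiv.Perm (C × Fin 4) :=
  Equiv.prodCongr (Equiv.refl C) (Equiv.addRight 2)

/-- The clockwise rotation of the half-edges (or corners) at the crossings. -/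
def clockwise (C : Type) : Equiv.Perm (C × Fin 4) :=
  Equiv.prodCongr (Equiv.refl C) (Equiv.subRight 1)

/-- An oriented knot diagram in the plane, with at least one crossing (the last two fields exclude
the empty diagram). -/
structure KnotDiagram where
  Crossing : Type
  [fintypeCrossing : Fintype Crossing]
  [decCrossing : DecidableEq Crossing]
  /-- The other half of the edge on which a half-edge lies. -/
  glue : Equiv.Perm (Crossing × Fin 4)
  glue_glue : ∀ h, glue (glue h) = h
  positive : Crossing → Bool
  oriented : ∀ h, IsOutgoing positive (glue h) ↔ ¬ IsOutgoing positive h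
  /-- There is one component: travelling along the strand one meets every half-edge. -/
  one_component : ∀ h h', IsOutgoing positive h → IsOutgoing positive h' →
    (opposite Crossing * glue).SameCycle h h'
  /-- The diagram lies on the sphere: `V - E + F = 2`, where `E = 2V`. The permutation sends a corner
  to the next corner of the same face. -/
  euler : cycleCount (clockwise Crossing * glue) = Fintype.card Crossing + 2
  /-- The unbounded face. -/
  outer : Quotient (Equiv.Perm.SameCycle.setoid (clockwise Crossing * glue))

attribute [instance] KnotDiagram.fintypeCrossing KnotDiagram.decCrossing

namespace KnotDiagram

variable (D : KnotDiagram)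

/-- The half-edges of the diagram; also the names of its corners. -/
abbrev HalfEdge : Type := D.Crossing × Fin 4

/-- The faces of the diagram: a face is a cycle of corners. -/
abbrev Face : Type := Quotient (Equiv.Perm.SameCycle.setoid (clockwise D.Crossing * D.glue))

/-- The face at a corner. -/
def face (h : D.HalfEdge) : D.Face := Quotient.mk _ h

noncomputable instance : DecidableEq D.Face := Classical.decEq _

noncomputable instance : Fintype D.Face := Fintype.ofFinite _

/-- The face to the left of an edge that leaves a crossing through `h`. -/
def left (h : D.HalfEdge) : D.Face := D.face h

/-- The face to the right of an edge that leaves a crossing through `h`. -/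
def right (h : D.HalfEdge) : D.Face := D.face (clockwise D.Crossing h)

/-- Two different faces that share an edge. -/
def Adjacent (f g : D.Face) : Prop := f ≠ g ∧ ∃ h, D.left h = f ∧ D.right h = g

/-- The free group on the generators `A_f`, for the faces `f` other than the unbounded one. -/
abbrev Free : Type := FreeGroup {f : D.Face // f ≠ D.outer}

/-- The generator of a face, which is `1` for the unbounded face. -/
noncomputable def gen (f : D.Face) : D.Free :=
  if h : f ≠ D.outer then FreeGroup.of ⟨f, h⟩ else 1

/-- The Dehn relator of a crossing. If `a₁`, `a₂`, `a₃`, `a₄` are the top, left, right and bottom face,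
then the relation is `A₄ A₂⁻¹ = A₃ A₁⁻¹`. -/
noncomputable def relator (c : D.Crossing) : D.Free :=
  D.gen (D.face (c, 2)) * (D.gen (D.face (c, 1)))⁻¹ *
    (D.gen (D.face (c, 3)) * (D.gen (D.face (c, 0)))⁻¹)⁻¹

/-- The knot group, given by its Dehn presentation: the loop `A_f` runs from a base point above the
plane down through the face `f` and back through the unbounded face. -/
abbrev KnotGroup : Type := PresentedGroup (Set.range D.relator)

/-- The canonical map `φ` from the free group to the knot group. -/
def toKnotGroup : D.Free →* D.KnotGroup := PresentedGroup.mk _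

/-- The Wirtinger generator of the edge that leaves a crossing through `h`: the meridian that goes
down to the right of the edge and comes back to the left of it. -/
noncomputable def meridian (h : D.HalfEdge) : D.KnotGroup :=
  D.toKnotGroup (D.gen (D.right h) * (D.gen (D.left h))⁻¹)

/-- The Wirtinger generator `x = A₄ A₂⁻¹` of the over-strand at a crossing. -/
noncomputable def overMeridian (c : D.Crossing) : D.KnotGroup :=
  D.toKnotGroup (D.gen (D.face (c, 2)) * (D.gen (D.face (c, 1)))⁻¹)

/-! ### The abelianization map -/

theorem left_glue (h : D.HalfEdge) : D.left (D.glue h) = D.right h := by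
  refine Quotient.sound ⟨1, ?_⟩
  simp [D.glue_glue]

theorem right_glue (h : D.HalfEdge) : D.right (D.glue h) = D.left h := by
  have := D.left_glue (D.glue h)
  rw [D.glue_glue] at this
  exact this.symm

theorem const_of_invariant {α : Type} (v : D.HalfEdge → α) (hg : ∀ h, v (D.glue h) = v h)
    (ho : ∀ h, v (opposite D.Crossing h) = v h) (h h' : D.HalfEdge) : v h = v h' := by
  have key : ∀ h h', IsOutgoing D.positive h → IsOutgoing D.positive h' → v h = v h' := by
    intro h h' hh hh'
    obtain ⟨k, hk⟩ := (D.one_component h h' hh hh').exists_nat_pow_eq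
    rw [← hk]
    clear hk
    induction k with
    | zero => rfl
    | succ k ih => rw [pow_succ', Equiv.Perm.mul_apply, Equiv.Perm.mul_apply, ho, hg, ih]
  have out : ∀ h, ∃ g, IsOutgoing D.positive g ∧ v g = v h := by
    intro h
    by_cases hh : IsOutgoing D.positive h
    · exact ⟨h, hh, rfl⟩
    · exact ⟨D.glue h, (D.oriented h).2 hh, hg h⟩
  obtain ⟨g, hg1, hg2⟩ := out h
  obtain ⟨g', hg1', hg2'⟩ := out h'
  rw [← hg2, ← hg2', key g g' hg1 hg1']

/-- The outgoing half-edges: the over-strand (`false`) and the under-strand (`true`). -/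
def out (e : D.Crossing × Bool) : D.HalfEdge :=
  (e.1, if e.2 then (if D.positive e.1 then 1 else 3) else 0)

theorem isOutgoing_out (e : D.Crossing × Bool) : IsOutgoing D.positive (D.out e) := by
  rcases e with ⟨c, _ | _⟩ <;> simp [out, IsOutgoing]

theorem exists_out (h : D.HalfEdge) (hh : IsOutgoing D.positive h) : ∃ e, D.out e = h := by
  obtain ⟨c, i⟩ := h
  rcases hh with hh | hh
  · exact ⟨(c, false), by simp [out] at hh ⊢; exact hh.symm⟩
  · exact ⟨(c, true), by simp [out] at hh ⊢; exact hh.symm⟩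

theorem out_injective : Function.Injective D.out := by
  rintro ⟨c, b⟩ ⟨c', b'⟩ h
  simp only [out, Prod.mk.injEq] at h
  obtain ⟨rfl, h⟩ := h
  cases b <;> cases b' <;> cases hp : D.positive c <;> simp [hp] at h ⊢

theorem sum_halfEdge (k : D.HalfEdge → ℚ) :
    ∑ h, k h = ∑ e, (k (D.out e) + k (D.glue (D.out e))) := by
  have hbij : Function.Bijective
      (Sum.elim D.out (fun e => D.glue (D.out e)) :
        (D.Crossing × Bool) ⊕ (D.Crossing × Bool) → D.HalfEdge) := by
    constructor
    · rintro (e | e) (e' | e') h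
      · exact congrArg _ (D.out_injective h)
      · exact absurd (D.isOutgoing_out e) (by
          simp only [Sum.elim_inl, Sum.elim_inr] at h
          rw [h, D.oriented]; exact not_not.2 (D.isOutgoing_out e'))
      · exact absurd (D.isOutgoing_out e') (by
          simp only [Sum.elim_inl, Sum.elim_inr] at h
          rw [← h, D.oriented]; exact not_not.2 (D.isOutgoing_out e))
      · exact congrArg _ (D.out_injective (D.glue.injective h))
    · intro h
      by_cases hh : IsOutgoing D.positive h
      · obtain ⟨e, he⟩ := D.exists_out h hh
        exact ⟨.inl e, he⟩
      · obtain ⟨e, he⟩ := D.exists_out (D.glue h) ((D.oriented h).2 hh)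
        exact ⟨.inr e, by simp [he, D.glue_glue]⟩
  rw [← Function.Bijective.sum_comp hbij, Fintype.sum_sum_type, Finset.sum_add_distrib]
  rfl

/-- The difference of a function on faces across the edges. -/
noncomputable def faceDiff : (D.Face → ℚ) →ₗ[ℚ] (D.Crossing × Bool → ℚ) where
  toFun w e := w (D.right (D.out e)) - w (D.left (D.out e))
  map_add' v w := by ext e; simp; ring
  map_smul' r w := by ext e; simp; ring

/-- The difference of a function on crossings along the edges. -/
noncomputable def crossingDiff : (D.Crossing → ℚ) →ₗ[ℚ] (D.Crossing × Bool → ℚ) where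
  toFun x e := x (D.out e).1 - x (D.glue (D.out e)).1
  map_add' v w := by ext e; simp; ring
  map_smul' r w := by ext e; simp; ring

theorem crossingDiff_dot_faceDiff (x : D.Crossing → ℚ) (w : D.Face → ℚ) :
    ∑ e, D.crossingDiff x e * D.faceDiff w e = 0 := by
  have h1 := D.sum_halfEdge (fun h => x h.1 * (w (D.right h) - w (D.left h)))
  have h2 : ∑ h : D.HalfEdge, x h.1 * (w (D.right h) - w (D.left h)) = 0 := by
    rw [Fintype.sum_prod_type]
    refine Finset.sum_eq_zero fun c _ => ?_
    have e0 : clockwise D.Crossing (c, 0) = (c, 3) := rfl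
    have e1 : clockwise D.Crossing (c, 1) = (c, 0) := rfl
    have e2 : clockwise D.Crossing (c, 2) = (c, 1) := rfl
    have e3 : clockwise D.Crossing (c, 3) = (c, 2) := rfl
    simp only [Fin.sum_univ_four, left, right, e0, e1, e2, e3]
    ring
  rw [h2] at h1
  rw [h1]
  refine Finset.sum_congr rfl fun e _ => ?_
  simp only [crossingDiff, faceDiff, LinearMap.coe_mk, AddHom.coe_mk, D.left_glue, D.right_glue]
  ring

theorem crossingDiff_sum (x : D.Crossing → ℚ) : ∑ e, D.crossingDiff x e = 0 := by
  have hb : ∀ h : D.HalfEdge, IsOutgoing D.positive (opposite _ h) ↔ ¬ IsOutgoing D.positive h := by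
    rintro ⟨c, i⟩
    simp only [opposite, IsOutgoing, Equiv.prodCongr_apply, Prod.map, Equiv.refl_apply,
      Equiv.coe_addRight]
    cases D.positive c <;> fin_cases i <;> decide
  -- the half-edges that enter a crossing are opposite to those that leave it
  have h1 := D.sum_halfEdge (fun h => by
    classical exact (if IsOutgoing D.positive h then x h.1 else -x h.1))
  have h2 : (∑ h : D.HalfEdge, by
      classical exact (if IsOutgoing D.positive h then x h.1 else -x h.1)) = (0 : ℚ) := by
    classical
    have := Equiv.sum_comp (opposite D.Crossing)
      (fun h => (if IsOutgoing D.positive h then x h.1 else -x h.1))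
    have h3 : ∀ h : D.HalfEdge,
        (if IsOutgoing D.positive (opposite _ h) then x (opposite _ h).1
          else -x (opposite _ h).1) =
        -(if IsOutgoing D.positive h then x h.1 else -x h.1) := by
      intro h
      have : (opposite D.Crossing h).1 = h.1 := rfl
      by_cases hh : IsOutgoing D.positive h <;> simp [hb, hh, this]
    simp only [h3, Finset.sum_neg_distrib] at this
    linarith
  rw [h2] at h1
  rw [h1]
  refine Finset.sum_congr rfl fun e _ => ?_
  have h4 : ¬ IsOutgoing D.positive (D.glue (D.out e)) := by
    rw [D.oriented]; exact not_not.2 (D.isOutgoing_out e)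
  simp only [D.isOutgoing_out e, h4, if_true, if_false]
  simp [crossingDiff, sub_eq_add_neg]

theorem opposite_of_clockwise {α : Type} (v : D.HalfEdge → α)
    (h : ∀ h, v (clockwise _ h) = v h) (g : D.HalfEdge) : v (opposite _ g) = v g := by
  have : clockwise D.Crossing (clockwise D.Crossing g) = opposite D.Crossing g := by
    obtain ⟨c, i⟩ := g
    simp only [clockwise, opposite, Equiv.prodCongr_apply, Prod.map, Equiv.refl_apply,
      Equiv.coe_addRight, Equiv.subRight_apply]
    fin_cases i <;> rfl
  rw [← this, h, h]

theorem finrank_ker_faceDiff : Module.finrank ℚ (LinearMap.ker D.faceDiff) ≤ 1 := by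
  refine (Submodule.finrank_mono (t := Submodule.span ℚ {fun _ => 1}) ?_).trans
    ((finrank_span_le_card _).trans (by simp))
  intro w hw
  have hr : ∀ h : D.HalfEdge, w (D.right h) = w (D.left h) := by
    have ho : ∀ h, IsOutgoing D.positive h → w (D.right h) = w (D.left h) := by
      intro h hh
      obtain ⟨e, rfl⟩ := D.exists_out h hh
      have := congrFun (LinearMap.mem_ker.1 hw) e
      simpa [faceDiff, sub_eq_zero] using this
    intro h
    by_cases hh : IsOutgoing D.positive h
    · exact ho h hh
    · have := ho _ ((D.oriented h).2 hh)
      rw [D.left_glue, D.right_glue] at this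
      exact this.symm
  have hc := D.const_of_invariant (fun h => w (D.left h))
    (fun h => by rw [D.left_glue, hr]) (D.opposite_of_clockwise (fun h => w (D.left h)) (fun h => hr h))
  obtain ⟨h0, hh0⟩ := Quotient.exists_rep D.outer
  rw [Submodule.mem_span_singleton]
  refine ⟨w D.outer, ?_⟩
  ext f
  obtain ⟨h, rfl⟩ := Quotient.exists_rep f
  simp only [Pi.smul_apply, smul_eq_mul, mul_one]
  rw [← hh0]
  exact hc h0 h

theorem finrank_ker_crossingDiff : Module.finrank ℚ (LinearMap.ker D.crossingDiff) ≤ 1 := by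
  refine (Submodule.finrank_mono (t := Submodule.span ℚ {fun _ => 1}) ?_).trans
    ((finrank_span_le_card _).trans (by simp))
  intro x hx
  have hg : ∀ h : D.HalfEdge, x (D.glue h).1 = x h.1 := by
    have ho : ∀ h, IsOutgoing D.positive h → x (D.glue h).1 = x h.1 := by
      intro h hh
      obtain ⟨e, rfl⟩ := D.exists_out h hh
      have := congrFun (LinearMap.mem_ker.1 hx) e
      simp [crossingDiff, sub_eq_zero] at this
      exact this.symm
    intro h
    by_cases hh : IsOutgoing D.positive h
    · exact ho h hh
    · have := ho _ ((D.oriented h).2 hh)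
      rw [D.glue_glue] at this
      exact this.symm
  have hc := D.const_of_invariant (fun h => x h.1) hg (fun h => rfl)
  obtain ⟨h0, -⟩ := Quotient.exists_rep D.outer
  rw [Submodule.mem_span_singleton]
  refine ⟨x h0.1, ?_⟩
  ext c
  simp only [Pi.smul_apply, smul_eq_mul, mul_one]
  exact hc h0 (c, 0)

theorem card_face : Fintype.card D.Face = Fintype.card D.Crossing + 2 := by
  rw [← D.euler, cycleCount, ← Nat.card_eq_fintype_card]

theorem exists_rat_numbering :
    ∃ w : D.Face → ℚ, ∀ e, w (D.right (D.out e)) - w (D.left (D.out e)) = 1 := by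
  have hS := D.faceDiff.finrank_range_add_finrank_ker
  have hT := D.crossingDiff.finrank_range_add_finrank_ker
  have h1 := D.finrank_ker_faceDiff
  have h2 := D.finrank_ker_crossingDiff
  have hdot : ∀ s ∈ LinearMap.range D.faceDiff, ∀ t ∈ LinearMap.range D.crossingDiff,
      ∑ e, t e * s e = 0 := by
    rintro _ ⟨w, rfl⟩ _ ⟨x, rfl⟩
    exact D.crossingDiff_dot_faceDiff x w
  have hself : ∀ t : D.Crossing × Bool → ℚ, ∑ e, t e * t e = 0 → t = 0 := by
    intro t ht
    ext e
    have := (Finset.sum_eq_zero_iff_of_nonneg (fun e _ => mul_self_nonneg (t e))).1 ht e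
      (Finset.mem_univ e)
    exact mul_self_eq_zero.1 this
  have hinf : LinearMap.range D.faceDiff ⊓ LinearMap.range D.crossingDiff = ⊥ := by
    rw [eq_bot_iff]
    rintro t ⟨ht1, ht2⟩
    exact hself t (hdot t ht1 t ht2)
  have hsum := Submodule.finrank_sup_add_finrank_inf_eq
    (LinearMap.range D.faceDiff) (LinearMap.range D.crossingDiff)
  rw [hinf, finrank_bot] at hsum
  simp only [Module.finrank_fintype_fun_eq_card, D.card_face] at hS hT
  have htop : LinearMap.range D.faceDiff ⊔ LinearMap.range D.crossingDiff = ⊤ := by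
    refine Submodule.eq_top_of_finrank_eq (le_antisymm (Submodule.finrank_le _) ?_)
    simp only [Module.finrank_fintype_fun_eq_card, Fintype.card_prod, Fintype.card_bool]
    omega
  have hone : (fun _ => 1 : D.Crossing × Bool → ℚ) ∈
      LinearMap.range D.faceDiff ⊔ LinearMap.range D.crossingDiff := by
    rw [htop]; trivial
  obtain ⟨s, hs, t, ht, hst⟩ := Submodule.mem_sup.1 hone
  have ht0 : t = 0 := by
    apply hself
    have h3 := hdot s hs t ht
    obtain ⟨x, rfl⟩ := ht
    have h4 := D.crossingDiff_sum x
    have h5 : ∀ e, D.crossingDiff x e * D.crossingDiff x e =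
        D.crossingDiff x e - D.crossingDiff x e * s e := by
      intro e
      have : s e + D.crossingDiff x e = 1 := congrFun hst e
      have h6 : s e = 1 - D.crossingDiff x e := by linarith
      rw [h6]; ring
    simp only [h5, Finset.sum_sub_distrib, h3, h4, sub_zero]
  obtain ⟨w, rfl⟩ := hs
  refine ⟨w, fun e => ?_⟩
  have := congrFun hst e
  simpa [ht0, faceDiff] using this

/-- The Alexander numbering of the faces. -/
theorem exists_numbering :
    ∃ w : D.Face → ℤ, w D.outer = 0 ∧
      ∀ h, IsOutgoing D.positive h → w (D.right h) - w (D.left h) = 1 := by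
  obtain ⟨w, hw⟩ := D.exists_rat_numbering
  have hw' : ∀ h, IsOutgoing D.positive h → w (D.right h) = w (D.left h) + 1 := by
    intro h hh
    obtain ⟨e, rfl⟩ := D.exists_out h hh
    linarith [hw e]
  have hr : ∀ h : D.HalfEdge, Int.fract (w (D.right h) - w D.outer) =
      Int.fract (w (D.left h) - w D.outer) := by
    have ho : ∀ h, IsOutgoing D.positive h → Int.fract (w (D.right h) - w D.outer) =
        Int.fract (w (D.left h) - w D.outer) := by
      intro h hh
      rw [hw' h hh, add_sub_right_comm, Int.fract_add_one]
    intro h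
    by_cases hh : IsOutgoing D.positive h
    · exact ho h hh
    · have := ho _ ((D.oriented h).2 hh)
      rw [D.left_glue, D.right_glue] at this
      exact this.symm
  have hc := D.const_of_invariant (fun h => Int.fract (w (D.left h) - w D.outer))
    (fun h => by rw [D.left_glue, hr]) (D.opposite_of_clockwise
      (fun h => Int.fract (w (D.left h) - w D.outer)) (fun h => hr h))
  obtain ⟨h0, hh0⟩ := Quotient.exists_rep D.outer
  have hz : ∀ f, ((⌊w f - w D.outer⌋ : ℤ) : ℚ) = w f - w D.outer := by
    intro f
    obtain ⟨h, rfl⟩ := Quotient.exists_rep f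
    have h1 : Int.fract (w (D.left h) - w D.outer) = Int.fract (w (D.left h0) - w D.outer) :=
      hc h h0
    have h2 : D.left h0 = D.outer := hh0
    rw [h2, sub_self, Int.fract_zero] at h1
    have h3 := Int.floor_add_fract (w (D.left h) - w D.outer)
    rw [h1, add_zero] at h3
    exact h3
  refine ⟨fun f => ⌊w f - w D.outer⌋, by simp, fun h hh => ?_⟩
  have : (((⌊w (D.right h) - w D.outer⌋ - ⌊w (D.left h) - w D.outer⌋ : ℤ)) : ℚ) = 1 := by
    push_cast
    rw [hz, hz, hw' h hh]
    ring
  exact_mod_cast this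

theorem exists_abelianization : ∃ ψ : D.KnotGroup →* Multiplicative ℤ,
    ∀ h, IsOutgoing D.positive h → ψ (D.meridian h) = Multiplicative.ofAdd 1 := by
  obtain ⟨w, h0, hw⟩ := D.exists_numbering
  let F : D.Free →* Multiplicative ℤ := FreeGroup.lift (fun f => Multiplicative.ofAdd (w f.1))
  have hF : ∀ f, F (D.gen f) = Multiplicative.ofAdd (w f) := by
    intro f
    by_cases hf : f = D.outer
    · simp [gen, hf, h0]
    · simp [gen, hf, F]
  have hrel : ∀ r ∈ Set.range D.relator, F r = 1 := by
    rintro _ ⟨c, rfl⟩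
    have h1 : w (D.face (c, 3)) - w (D.face (c, 0)) = 1 := hw (c, 0) (Or.inl rfl)
    have h2 : w (D.face (c, 2)) - w (D.face (c, 1)) = 1 := by
      have := hw (D.glue (c, 2)) ((D.oriented _).2 (by
        simp only [IsOutgoing]; cases D.positive c <;> decide))
      rw [D.left_glue, D.right_glue] at this
      exact this
    simp only [relator, map_mul, map_inv, hF, ← ofAdd_neg, ← ofAdd_add]
    rw [← ofAdd_zero]
    congr 1
    linarith
  refine ⟨PresentedGroup.toGroup hrel, fun h hh => ?_⟩
  have : PresentedGroup.toGroup hrel (D.meridian h) =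
      F (D.gen (D.right h) * (D.gen (D.left h))⁻¹) := rfl
  rw [this, map_mul, map_inv, hF, hF, ← ofAdd_neg, ← ofAdd_add]
  congr 1
  have := hw h hh
  linarith

/-- The abelianization map `ψ` of the knot group: it takes every meridian that links the knot
positively to `t` (written here as the element `1` of `ℤ`). Since any two faces are joined by a
sequence of adjacent faces, this determines it. -/
noncomputable def abelianization : D.KnotGroup →* Multiplicative ℤ :=
  Classical.choose D.exists_abelianization

/-! ### The twisted Alexander polynomial -/

variable {D} {R : Type u} [CommRing R] {n : ℕ}

/-- `ρ ⊗ ψ` on the knot group: `g ↦ ψ(g) ρ(g)`, a matrix over `R[t, t⁻¹]`. -/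
noncomputable def tensorRep (ρ : D.KnotGroup →* Matrix.GeneralLinearGroup (Fin n) R) :
    D.KnotGroup →* Matrix (Fin n) (Fin n) R[T;T⁻¹] where
  toFun g := (LaurentPolynomial.T (Multiplicative.toAdd (D.abelianization g)) : R[T;T⁻¹]) •
    (ρ g : Matrix (Fin n) (Fin n) R).map LaurentPolynomial.C
  map_one' := by
    simp [Matrix.map_one]
  map_mul' g h := by
    simp only [map_mul, toAdd_mul, LaurentPolynomial.T_add, Units.val_mul, Matrix.map_mul,
      Matrix.smul_mul, Matrix.mul_smul, smul_smul]
    rw [mul_comm (LaurentPolynomial.T _)]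

/-- `Φ = (ρ ⊗ ψ) ∘ φ : ℤ[F] → M_n(R[t, t⁻¹])`. -/
noncomputable def Phi (ρ : D.KnotGroup →* Matrix.GeneralLinearGroup (Fin n) R) :
    MonoidAlgebra ℤ D.Free →ₐ[ℤ] Matrix (Fin n) (Fin n) R[T;T⁻¹] :=
  MonoidAlgebra.lift ℤ (Matrix (Fin n) (Fin n) R[T;T⁻¹]) D.Free
    ((tensorRep ρ).comp D.toKnotGroup)

/-- The Alexander matrix associated to `ρ`: the block at a crossing `c` and a face `f` is
`Φ(∂r_c/∂A_f)`. -/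
noncomputable def alexanderMatrix (ρ : D.KnotGroup →* Matrix.GeneralLinearGroup (Fin n) R) :
    Matrix (D.Crossing × Fin n) ({f : D.Face // f ≠ D.outer} × Fin n) R[T;T⁻¹] :=
  fun p q => Phi ρ (fox q.1 (D.relator p.1)) p.2 q.2

variable (D)

/-- The faces that remain when the unbounded face and `f₁` are disregarded. -/
abbrev Kept (f₁ : D.Face) : Type := {f : D.Face // f ≠ D.outer ∧ f ≠ f₁}

theorem card_kept {f₁ : D.Face} (h : D.outer ≠ f₁) :
    Fintype.card D.Crossing = Fintype.card (D.Kept f₁) := by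
  have h1 : Fintype.card (D.Kept f₁) = (({D.outer, f₁} : Finset D.Face)ᶜ).card := by
    rw [Fintype.card_subtype]
    congr 1
    ext f
    simp
  rw [h1, Finset.card_compl, Finset.card_pair h, D.card_face]
  simp

/-- An ordering of the remaining faces by the crossings, so that the reduced Alexander matrix has a
determinant; another ordering changes only the sign of the determinant. -/
noncomputable def ordering {f₁ : D.Face} (h : D.outer ≠ f₁) : D.Crossing ≃ D.Kept f₁ :=
  Fintype.equivOfCardEq (D.card_kept h)

/-- The twisted Alexander polynomial of the diagram and `ρ`: the determinant of the Alexander matrix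
without the block column of the face `f₁`. -/
noncomputable def twistedAlexander {f₁ : D.Face} (h : D.outer ≠ f₁)
    (ρ : D.KnotGroup →* Matrix.GeneralLinearGroup (Fin n) R) : R[T;T⁻¹] :=
  ((alexanderMatrix ρ).submatrix id
    (fun q : D.Crossing × Fin n =>
      ((⟨(D.ordering h q.1).1, (D.ordering h q.1).2.1⟩ : {f : D.Face // f ≠ D.outer}),
        q.2))).det

/-! ### The twisted Alexander graph -/

/-- The matrix at a corner of the diagram: `t X` to the left of the over-strand and `Id` to its
right, where `X` is the image of the Wirtinger generator of the over-strand. -/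
noncomputable def cornerMatrix (ρ : D.KnotGroup →* Matrix.GeneralLinearGroup (Fin n) R)
    (h : D.HalfEdge) : Matrix (Fin n) (Fin n) R[T;T⁻¹] :=
  if h.2 = 0 ∨ h.2 = 1 then
    (LaurentPolynomial.T 1 : R[T;T⁻¹]) •
      (ρ (D.overMeridian h.1) : Matrix (Fin n) (Fin n) R).map LaurentPolynomial.C
  else 1

open Classical in
/-- The twisted Alexander graph, without the unbounded face and `f₁`. It has `n` vertices for each
crossing and for each remaining face; at every corner there is a copy of `K_{n,n}` between the
vertices of the crossing and of the face, weighted by the entries of the matrix of the corner. Only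
the edges in `S` are drawn, so that edges of weight zero may be kept or left out. -/
noncomputable def alexanderGraph (f₁ : D.Face)
    (ρ : D.KnotGroup →* Matrix.GeneralLinearGroup (Fin n) R)
    (S : Set (D.HalfEdge × Fin n × Fin n)) : BipGraph R[T;T⁻¹] where
  V₁ := D.Crossing × Fin n
  V₂ := D.Kept f₁ × Fin n
  E := {e : D.HalfEdge × Fin n × Fin n // (D.face e.1 ≠ D.outer ∧ D.face e.1 ≠ f₁) ∧ e ∈ S}
  src e := (e.1.1.1, e.1.2.1)
  tgt e := (⟨D.face e.1.1, e.2.1⟩, e.1.2.2)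
  wt e := D.cornerMatrix ρ e.1.1 e.1.2.1 e.1.2.2

end KnotDiagram

/-- Equality of Laurent polynomials up to a factor `± t ^ k`. -/
def DotEq {R : Type u} [CommRing R] (f g : R[T;T⁻¹]) : Prop :=
  ∃ k : ℤ, f = LaurentPolynomial.T k * g ∨ f = -(LaurentPolynomial.T k * g)

end TwistedDimer

/-! Up to sign, both sides are the determinant of one matrix. For a bipartite graph write
`biadjacency` for the matrix of total edge weights; its determinant is the sum over dimer coverings,
each counted with the sign of the bijection that it induces between the vertex classes
(`det_biadjacency`). Four facts then suffice.

Kasteleyn's theorem (`partitionFunction_withSigns`): on a plane graph, Kasteleyn signs turn the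
partition function into this determinant, up to one global sign. For two coverings `m`, `m'` the
relative sign must be the product of `ε` over their symmetric difference. Modulo 2 this difference
is a cycle. On a union of spheres it bounds a region of faces (`IsSpherical.exists_primitive`),
which can be normalized to avoid the unbounded faces. Multiply the Kasteleyn condition over the
faces of the region: interior edges cancel and boundary edges remain. A face with `2k` edges
contributes `(-1) ^ (k + 1)`, the sign of a `k`-cycle, so the result is the sign of the face
rotation `ρ₂ * ρ₁` on the region. That this is the relative sign of the coverings is an identity
between permutations (`sign_restr_region`): correcting the rotations around the vertices by the
involutions that exchange `m` and `m'` splits `ρ₂ * ρ₁` into two vertex factors of equal sign and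
the alternating walk along the difference. Neither the Jordan curve theorem nor a count of the
vertices inside a cycle is needed.

Local moves (`det_triple`, `det_butterfly`): the new vertices form a block `-1` of the biadjacency
matrix, and its Schur complement is the old matrix. So each move changes only the sign of the
determinant.

Planarity (`isPlaneEmbedding_butterfly`): Euler's formula for the planarized drawing becomes Euler's
formula for the graph with butterflies, crossing by crossing.

Fox calculus (`Phi_fox_relator`, `twistedAlexander_eq`): a block of the Alexander matrix is the sum
of the corner matrices at the given crossing and face, with signs that alternate around the
crossing. The checkerboard colouring of the faces writes such a sign as a row sign times a column
sign, so these signs change the determinant only by a sign. -/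

namespace TwistedDimer

open Equiv Equiv.Perm

/-! ### Signs of permutations restricted to invariant sets -/

section Signs

variable {α : Type*}

theorem mem_of_sameCycle {f : Perm α} {s : Finset α} (h : ∀ x, f x ∈ s ↔ x ∈ s) {x y : α}
    (hxy : f.SameCycle x y) : x ∈ s ↔ y ∈ s := by
  obtain ⟨k, rfl⟩ := hxy
  have key : ∀ (k : ℤ) z, z ∈ s → (f ^ k) z ∈ s := fun k z hz => by
    have h2 := ((subtypePerm f h ^ k) ⟨z, hz⟩).2
    rw [subtypePerm_zpow] at h2
    exact h2
  refine ⟨key k x, fun hx => ?_⟩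
  simpa using key (-k) _ hx

variable [DecidableEq α]

/-- The permutation that agrees with `f` on an invariant set and is the identity elsewhere. -/
def restr (f : Perm α) (s : Finset α) (h : ∀ x, f x ∈ s ↔ x ∈ s) : Perm α :=
  ofSubtype (subtypePerm f h)

theorem restr_of_mem {f : Perm α} {s : Finset α} (h : ∀ x, f x ∈ s ↔ x ∈ s) {x : α} (hx : x ∈ s) :
    restr f s h x = f x :=
  ofSubtype_apply_of_mem _ hx

theorem restr_of_notMem {f : Perm α} {s : Finset α} (h : ∀ x, f x ∈ s ↔ x ∈ s) {x : α}
    (hx : x ∉ s) : restr f s h x = x :=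
  ofSubtype_apply_of_not_mem _ hx

theorem restr_apply {f : Perm α} {s : Finset α} (h : ∀ x, f x ∈ s ↔ x ∈ s) (x : α) :
    restr f s h x = if x ∈ s then f x else x := by
  split_ifs with hx
  exacts [restr_of_mem h hx, restr_of_notMem h hx]

theorem sameCycle_restr {f : Perm α} {s : Finset α} (h : ∀ x, f x ∈ s ↔ x ∈ s) {x y : α}
    (hx : x ∈ s) : (restr f s h).SameCycle x y ↔ f.SameCycle x y := by
  refine exists_congr fun k => ?_
  rw [restr, ← map_zpow, subtypePerm_zpow, ofSubtype_apply_of_mem _ hx]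
  rfl

variable [Fintype α]

/-- The sign of a permutation is determined by the number of its cycles. -/
theorem sign_eq_of_transversal (f : Perm α) (T : Finset α)
    (hT : ∀ x, ∃! t, t ∈ T ∧ f.SameCycle x t) :
    sign f = (-1) ^ (Fintype.card α + T.card) := by
  have huniq : ∀ t ∈ T, ∀ t' ∈ T, f.SameCycle t t' → t = t' := fun t ht t' ht' hc =>
    (hT t).unique ⟨ht, SameCycle.refl _ _⟩ ⟨ht', hc⟩
  have hfix : T.filter (fun t => f t = t) = f.supportᶜ := by
    ext x
    simp only [Finset.mem_filter, Finset.mem_compl, mem_support, not_not]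
    refine ⟨fun h => h.2, fun h => ⟨?_, h⟩⟩
    obtain ⟨t, ⟨ht, k, hk⟩, -⟩ := hT x
    have : (f ^ k) x = x := zpow_apply_eq_self_of_apply_eq_self h k
    rw [this] at hk
    exact hk ▸ ht
  have hmov : (T.filter (fun t => ¬ f t = t)).card = f.cycleFactorsFinset.card := by
    refine Finset.card_bij (fun t _ => f.cycleOf t) ?_ ?_ ?_
    · intro t ht
      exact cycleOf_mem_cycleFactorsFinset_iff.2 (mem_support.2 (Finset.mem_filter.1 ht).2)
    · intro t ht t' ht' h
      simp only [Finset.mem_filter] at ht ht'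
      refine huniq t ht.1 t' ht'.1 ?_
      have h1 : t ∈ (f.cycleOf t').support := by
        rw [← h, mem_support_cycleOf_iff]
        exact ⟨SameCycle.refl _ _, mem_support.2 ht.2⟩
      exact (mem_support_cycleOf_iff.1 h1).1.symm
    · intro c hc
      obtain ⟨x, hx⟩ := (mem_cycleFactorsFinset_iff.1 hc).1.nonempty_support
      obtain ⟨t, ⟨ht, hxt⟩, -⟩ := hT x
      have hcx : c = f.cycleOf x := (cycle_is_cycleOf hx hc)
      refine ⟨t, ?_, ?_⟩
      · rw [Finset.mem_filter]
        refine ⟨ht, ?_⟩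
        have : x ∈ f.support := mem_cycleFactorsFinset_support_le hc hx
        exact fun h => mem_support.1 this (hxt.apply_eq_self_iff.2 h)
      · rw [hcx]; exact hxt.symm.cycleOf_eq
  have hcard : T.card = f.supportᶜ.card + f.cycleFactorsFinset.card := by
    rw [← hmov, ← hfix, Finset.card_filter_add_card_filter_not]
  have hc2 := Finset.card_add_card_compl f.support
  rw [sign_of_cycleType, sum_cycleType, cycleType_def, Multiset.card_map, hcard, ← hc2]
  -- A fixed point counts once as a point and once as a cycle, so fixed points drop out modulo 2.
  rw [show f.support.card + f.supportᶜ.card + (f.supportᶜ.card + f.cycleFactorsFinset.card) =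
    f.support.card + f.cycleFactorsFinset.card + 2 * f.supportᶜ.card by ring,
    pow_add _ _ (2 * _), pow_mul]
  simp

/-- Outside `s` every point is a cycle of its own, so `T ∪ sᶜ` is a transversal of the restriction;
the complement then enters the exponent twice. -/
theorem sign_restr {f : Perm α} {s : Finset α} (h : ∀ x, f x ∈ s ↔ x ∈ s) {T : Finset α}
    (hTs : T ⊆ s) (hT : ∀ x ∈ s, ∃! t, t ∈ T ∧ f.SameCycle x t) :
    sign (restr f s h) = (-1) ^ (s.card + T.card) := by
  have hmem : ∀ x t, (restr f s h).SameCycle x t → (x ∈ s ↔ t ∈ s) := fun x t =>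
    mem_of_sameCycle fun x => by
      rw [restr_apply]
      split_ifs with hx
      exacts [h x, Iff.rfl]
  have hd : Disjoint T sᶜ := Finset.disjoint_left.2 fun x hx hx' => (Finset.mem_compl.1 hx') (hTs hx)
  rw [sign_eq_of_transversal _ (T ∪ sᶜ), Finset.card_union_of_disjoint hd,
    ← Finset.card_add_card_compl s]
  · rw [show s.card + sᶜ.card + (T.card + sᶜ.card) = s.card + T.card + 2 * sᶜ.card by ring, pow_add,
      pow_mul]
    simp
  · intro x
    by_cases hx : x ∈ s
    · obtain ⟨t, ⟨ht, hxt⟩, hu⟩ := hT x hx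
      refine ⟨t, ⟨Finset.mem_union_left _ ht, (sameCycle_restr h hx).2 hxt⟩, ?_⟩
      rintro t' ⟨ht', hxt'⟩
      refine hu t' ⟨?_, (sameCycle_restr h hx).1 hxt'⟩
      rcases Finset.mem_union.1 ht' with h1 | h1
      · exact h1
      · exact absurd ((hmem _ _ hxt').1 hx) (Finset.mem_compl.1 h1)
    · refine ⟨x, ⟨Finset.mem_union_right _ (Finset.mem_compl.2 hx), SameCycle.refl _ _⟩, ?_⟩
      rintro t' ⟨-, k, hk⟩
      rw [zpow_apply_eq_self_of_apply_eq_self (restr_of_notMem h hx)] at hk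
      exact hk.symm

/-- If the product of `g` over every cycle of `f` in `s` is the sign of that cycle, then the product of
`g` over `s` is the sign of the restriction of `f`. -/
theorem prod_eq_sign_restr {f : Perm α} {s : Finset α} (h : ∀ x, f x ∈ s ↔ x ∈ s) (g : α → ℤˣ)
    (hg : ∀ x ∈ s, ∀ c : Finset α, (∀ y, y ∈ c ↔ f.SameCycle x y) →
      ∏ y ∈ c, g y = (-1) ^ (c.card + 1)) :
    ∏ x ∈ s, g x = sign (restr f s h) := by
  classical
  let r : α → α := fun x => Quotient.out (Quotient.mk (SameCycle.setoid f) x)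
  have hr : ∀ x, f.SameCycle x (r x) := fun x =>
    SameCycle.symm (Quotient.exact (Quotient.out_eq (Quotient.mk (SameCycle.setoid f) x)))
  have hr' : ∀ x y, f.SameCycle x y → r x = r y := fun x y hxy =>
    congrArg Quotient.out (Quotient.sound hxy)
  have hT : ∀ x ∈ s, ∃! t, t ∈ s.image r ∧ f.SameCycle x t := by
    intro x hx
    refine ⟨r x, ⟨Finset.mem_image_of_mem _ hx, hr x⟩, ?_⟩
    rintro t ⟨ht, hxt⟩
    obtain ⟨y, hy, rfl⟩ := Finset.mem_image.1 ht
    exact hr' _ _ ((hr y).trans hxt.symm)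
  have hTs : s.image r ⊆ s := by
    intro t ht
    obtain ⟨y, hy, rfl⟩ := Finset.mem_image.1 ht
    exact (mem_of_sameCycle h (hr y)).1 hy
  have hfib : ∀ t ∈ s.image r, ∀ y, y ∈ s.filter (fun x => r x = t) ↔ f.SameCycle t y := by
    intro t ht y
    rw [Finset.mem_filter]
    obtain ⟨z, hz, rfl⟩ := Finset.mem_image.1 ht
    exact ⟨fun hy => hy.2 ▸ (hr y).symm,
      fun hy => ⟨(mem_of_sameCycle h hy).1 (hTs ht), hr' _ _ (((hr z).trans hy).symm)⟩⟩
  rw [sign_restr h hTs hT, ← Finset.prod_fiberwise_of_maps_to (t := s.image r) (g := r)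
    (fun x hx => Finset.mem_image_of_mem _ hx),
    Finset.prod_congr rfl (fun t ht => hg t (hTs ht) _ (hfib t ht)), Finset.prod_pow_eq_pow_sum,
    Finset.sum_add_distrib, ← Finset.card_eq_sum_card_fiberwise
    (fun x hx => Finset.mem_coe.2 (Finset.mem_image_of_mem _ hx))]
  simp

theorem sign_restr_mul_restr_compl {f : Perm α} {s t u : Finset α} (hd : Disjoint s t)
    (hu : s ∪ t = u) (hs : ∀ x, f x ∈ s ↔ x ∈ s) (ht : ∀ x, f x ∈ t ↔ x ∈ t)
    (h : ∀ x, f x ∈ u ↔ x ∈ u) :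
    sign (restr f u h) = sign (restr f s hs) * sign (restr f t ht) := by
  rw [← Perm.sign_mul]
  congr 1
  ext x
  rw [Perm.mul_apply, restr_apply ht]
  subst hu
  have h1 : x ∈ s → x ∉ t := fun hx => Finset.disjoint_left.1 hd hx
  by_cases hx : x ∈ t
  · have h2 : x ∉ s := fun h2 => h1 h2 hx
    simp only [restr_apply, Finset.mem_union, hx, or_true, if_true, hs, h2, if_false]
  · simp only [restr_apply, Finset.mem_union, hx, or_false, if_false]

end Signs

/-! ### Comparison of cycles and components of different permutations -/

section Cycles

variable {α β : Type} {γ : Type*}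

theorem eq_of_sameCycle {f : Perm α} {v : α → γ} (h : ∀ x, v (f x) = v x) {x y : α}
    (hxy : f.SameCycle x y) : v x = v y := by
  have hi : ∀ x, v (f⁻¹ x) = v x := fun x => by
    rw [← h (f⁻¹ x), Perm.coe_inv, Equiv.apply_symm_apply]
  obtain ⟨k, rfl⟩ := hxy
  induction k with
  | zero => rfl
  | succ k ih => rw [add_comm, zpow_add, Perm.mul_apply, zpow_one, h, ih]
  | pred k ih => rw [sub_eq_add_neg, add_comm, zpow_add, Perm.mul_apply, zpow_neg_one, hi, ih]

theorem eq_of_component {s a : Perm α} {v : α → γ} (hs : ∀ x, v (s x) = v x)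
    (ha : ∀ x, v (a x) = v x) {x y : α}
    (hxy : (Quotient.mk _ x : Component s a) = Quotient.mk _ y) : v x = v y := by
  obtain ⟨⟨g, hg⟩, rfl⟩ := Quotient.exact hxy
  change v (g y) = v y
  clear hxy
  induction hg using Subgroup.closure_induction generalizing y with
  | mem g hg => rcases hg with rfl | rfl; exacts [hs y, ha y]
  | one => rfl
  | mul g h _ _ ihg ihh => rw [Perm.mul_apply, ihg, ihh]
  | inv g _ ih => rw [← ih (y := g⁻¹ y), Perm.coe_inv, Equiv.apply_symm_apply]

theorem component_mk_left (s a : Perm α) (x : α) :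
    (Quotient.mk _ (s x) : Component s a) = Quotient.mk _ x :=
  Quotient.sound ⟨⟨s, Subgroup.subset_closure (by simp)⟩, rfl⟩

theorem component_mk_right (s a : Perm α) (x : α) :
    (Quotient.mk _ (a x) : Component s a) = Quotient.mk _ x :=
  Quotient.sound ⟨⟨a, Subgroup.subset_closure (by simp)⟩, rfl⟩

/-- Two maps that respect the steps of two permutations, and that are inverse to each other up to
these steps, identify the cycles. -/
def cycleEquiv {f : Perm α} {g : Perm β} (j : α → β) (k : β → α)
    (hj : ∀ x, g.SameCycle (j (f x)) (j x)) (hk : ∀ y, f.SameCycle (k (g y)) (k y))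
    (hkj : ∀ x, f.SameCycle (k (j x)) x) (hjk : ∀ y, g.SameCycle (j (k y)) y) :
    Quotient (SameCycle.setoid f) ≃ Quotient (SameCycle.setoid g) where
  toFun := Quotient.lift (fun x => Quotient.mk _ (j x)) fun _ _ h =>
    eq_of_sameCycle (f := f) (v := fun x => Quotient.mk (SameCycle.setoid g) (j x))
      (fun x => Quotient.sound (hj x)) h
  invFun := Quotient.lift (fun y => Quotient.mk _ (k y)) fun _ _ h =>
    eq_of_sameCycle (f := g) (v := fun y => Quotient.mk (SameCycle.setoid f) (k y))
      (fun y => Quotient.sound (hk y)) h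
  left_inv := by rintro ⟨x⟩; exact Quotient.sound (hkj x)
  right_inv := by rintro ⟨y⟩; exact Quotient.sound (hjk y)

theorem cycleCount_congr {f : Perm α} {g : Perm β} (j : α → β) (k : β → α)
    (hj : ∀ x, g.SameCycle (j (f x)) (j x)) (hk : ∀ y, f.SameCycle (k (g y)) (k y))
    (hkj : ∀ x, f.SameCycle (k (j x)) x) (hjk : ∀ y, g.SameCycle (j (k y)) y) :
    cycleCount f = cycleCount g :=
  Nat.card_congr (cycleEquiv j k hj hk hkj hjk)

theorem sameCycle_congr {f : Perm α} {g : Perm β} (j : α → β) (k : β → α)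
    (hj : ∀ x, g.SameCycle (j (f x)) (j x)) (hk : ∀ y, f.SameCycle (k (g y)) (k y))
    (hkj : ∀ x, f.SameCycle (k (j x)) x) (hjk : ∀ y, g.SameCycle (j (k y)) y) (x y : α) :
    f.SameCycle x y ↔ g.SameCycle (j x) (j y) := by
  have h : Quotient.mk (SameCycle.setoid g) (j x) = Quotient.mk (SameCycle.setoid g) (j y) ↔
      Quotient.mk (SameCycle.setoid f) x = Quotient.mk (SameCycle.setoid f) y :=
    (cycleEquiv j k hj hk hkj hjk).injective.eq_iff (a := Quotient.mk _ x) (b := Quotient.mk _ y)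
  rw [Quotient.eq, Quotient.eq] at h
  exact h.symm

theorem sameCycle_apply_self (f : Perm α) (x : α) : f.SameCycle (f x) x :=
  sameCycle_apply_left.2 (SameCycle.refl _ _)

/-- The two products are conjugate: `g` and `f` themselves serve as the maps, and each composite is
a single step. This reconciles `IsSpherical`, which counts the cycles of `ρ₁ * ρ₂`, with `Face`,
which uses `ρ₂ * ρ₁`. -/
theorem cycleCount_mul_comm (f g : Perm α) : cycleCount (f * g) = cycleCount (g * f) := by
  refine cycleCount_congr g f (fun x => ?_) (fun y => ?_) (fun x => ?_) (fun y => ?_)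
  exacts [sameCycle_apply_self _ _, sameCycle_apply_self _ _, sameCycle_apply_self _ _,
    sameCycle_apply_self _ _]

theorem card_component_congr {s a : Perm α} {s' a' : Perm β} (j : α → β) (k : β → α)
    (hs : ∀ x, (Quotient.mk _ (j (s x)) : Component s' a') = Quotient.mk _ (j x))
    (ha : ∀ x, (Quotient.mk _ (j (a x)) : Component s' a') = Quotient.mk _ (j x))
    (hs' : ∀ y, (Quotient.mk _ (k (s' y)) : Component s a) = Quotient.mk _ (k y))
    (ha' : ∀ y, (Quotient.mk _ (k (a' y)) : Component s a) = Quotient.mk _ (k y))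
    (hkj : ∀ x, (Quotient.mk _ (k (j x)) : Component s a) = Quotient.mk _ x)
    (hjk : ∀ y, (Quotient.mk _ (j (k y)) : Component s' a') = Quotient.mk _ y) :
    Nat.card (Component s a) = Nat.card (Component s' a') := by
  refine Nat.card_congr ⟨Quotient.lift (fun x => Quotient.mk _ (j x)) fun _ _ h =>
      eq_of_component (v := fun x => (Quotient.mk _ (j x) : Component s' a')) hs ha
        (Quotient.sound h),
    Quotient.lift (fun y => Quotient.mk _ (k y)) fun _ _ h =>
      eq_of_component (v := fun y => (Quotient.mk _ (k y) : Component s a)) hs' ha'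
        (Quotient.sound h), ?_, ?_⟩
  · rintro ⟨x⟩; exact hkj x
  · rintro ⟨y⟩; exact hjk y

end Cycles

/-! ### Homology of a combinatorial map over a field -/

section ClassFunctions

variable (K : Type*) [Field K] {E : Type}

/-- The functions that are constant on the classes of an equivalence relation. -/
def classFun (r : Setoid E) : Submodule K (E → K) where
  carrier := {x | ∀ a b, r a b → x a = x b}
  add_mem' hx hy a b h := by simp [hx a b h, hy a b h]
  zero_mem' _ _ _ := rfl
  smul_mem' c x hx a b h := by simp [hx a b h]

variable {K}

theorem mem_classFun_sameCycle {f : Perm E} {x : E → K} :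
    x ∈ classFun K (SameCycle.setoid f) ↔ ∀ e, x (f e) = x e :=
  ⟨fun h e => h _ _ (sameCycle_apply_self f e), fun h _ _ hab => eq_of_sameCycle (v := x) h hab⟩

theorem mem_classFun_component {s a : Perm E} {x : E → K} :
    x ∈ classFun K (MulAction.orbitRel (Subgroup.closure {s, a}) E) ↔
      (∀ e, x (s e) = x e) ∧ ∀ e, x (a e) = x e :=
  ⟨fun h => ⟨fun e => h _ _ (Quotient.exact (component_mk_left s a e)),
    fun e => h _ _ (Quotient.exact (component_mk_right s a e))⟩,
    fun h _ _ hab => eq_of_component (v := x) h.1 h.2 (Quotient.sound hab)⟩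

variable (K) in
theorem finrank_classFun [Fintype E] (r : Setoid E) :
    Module.finrank K (classFun K r) = Nat.card (Quotient r) := by
  classical
  let e : (Quotient r → K) ≃ₗ[K] classFun K r :=
    { toFun := fun y => ⟨fun a => y (Quotient.mk _ a), fun a b h => congrArg y (Quotient.sound h)⟩
      map_add' := fun _ _ => rfl
      map_smul' := fun _ _ => rfl
      invFun := fun x => Quotient.lift x.1 x.2
      left_inv := fun y => by ext ⟨a⟩; rfl
      right_inv := fun x => rfl }
  rw [← e.finrank_eq, Module.finrank_fintype_fun_eq_card, Nat.card_eq_fintype_card]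

/-- The difference across the edges of a function on faces. -/
def acrossEdges (K : Type*) [Field K] (ρ₁ ρ₂ : Perm E) :
    classFun K (SameCycle.setoid (ρ₂ * ρ₁)) →ₗ[K] (E → K) where
  toFun x e := x.1 e - x.1 (ρ₁.symm e)
  map_add' x y := by ext e; simp; ring
  map_smul' c x := by ext e; simp; ring

/-- A face function is invariant under `ρ₂ * ρ₁`, so invariance under `ρ₁` forces invariance under
`ρ₂`. The kernel therefore consists of the functions constant on components, and the rank is the
number of faces minus the number of components. -/
theorem ker_acrossEdges (ρ₁ ρ₂ : Perm E) (x : classFun K (SameCycle.setoid (ρ₂ * ρ₁))) :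
    acrossEdges K ρ₁ ρ₂ x = 0 ↔ (∀ e, x.1 (ρ₁ e) = x.1 e) ∧ ∀ e, x.1 (ρ₂ e) = x.1 e := by
  have hx := mem_classFun_sameCycle.1 x.2
  have h : acrossEdges K ρ₁ ρ₂ x = 0 ↔ ∀ e, x.1 (ρ₁ e) = x.1 e := by
    rw [funext_iff]
    refine ⟨fun h e => ?_, fun h e => ?_⟩
    · simpa [acrossEdges, sub_eq_zero] using h (ρ₁ e)
    · have := h (ρ₁.symm e)
      simpa [acrossEdges, sub_eq_zero] using this
  rw [h]
  refine ⟨fun h => ⟨h, fun e => ?_⟩, And.left⟩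
  have h1 := hx (ρ₁.symm e)
  have h2 := h (ρ₁.symm e)
  simp only [Perm.mul_apply, Equiv.apply_symm_apply] at h1 h2
  rw [h1, h2]

variable [Fintype E]

/-- On a union of spheres a cycle is a boundary. -/
theorem IsSpherical.exists_primitive {ρ₁ ρ₂ : Perm E} (h : IsSpherical ρ₁ ρ₂) (c : E → K)
    (h₁ : ∀ w : E → K, (∀ e, w (ρ₁ e) = w e) → ∑ e, c e * w e = 0)
    (h₂ : ∀ w : E → K, (∀ e, w (ρ₂ e) = w e) → ∑ e, c e * w e = 0) :
    ∃ χ : E → K, (∀ e, χ (ρ₂ (ρ₁ e)) = χ e) ∧ ∀ e, χ e - χ (ρ₁.symm e) = c e := by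
  classical
  set W₁ := classFun K (SameCycle.setoid ρ₁)
  set W₂ := classFun K (SameCycle.setoid ρ₂)
  -- Over `ZMod 2` the standard form has isotropic vectors, so orthogonal complements need not be
  -- complements; only nondegeneracy and the dimension of the orthogonal space are used.
  let B : LinearMap.BilinForm K (E → K) := Matrix.toBilin' 1
  have hBapp : ∀ x y, B x y = ∑ e, x e * y e := fun x y => by
    simp [B, Matrix.toBilin'_apply', dotProduct]
  have hB : B.Nondegenerate := by
    refine LinearMap.BilinForm.nondegenerate_toBilin'_iff_det_ne_zero.2 ?_
    simp
  have hmem : ∀ x, x ∈ B.orthogonal (W₁ ⊔ W₂) ↔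
      (∀ w : E → K, (∀ e, w (ρ₁ e) = w e) → ∑ e, x e * w e = 0) ∧
      (∀ w : E → K, (∀ e, w (ρ₂ e) = w e) → ∑ e, x e * w e = 0) := by
    intro x
    rw [LinearMap.BilinForm.mem_orthogonal_iff]
    simp only [hBapp, mul_comm _ (x _)]
    refine ⟨fun h => ⟨fun w hw => h w (Submodule.mem_sup_left (mem_classFun_sameCycle.2 hw)),
      fun w hw => h w (Submodule.mem_sup_right (mem_classFun_sameCycle.2 hw))⟩, ?_⟩
    rintro ⟨h1, h2⟩ w hw
    obtain ⟨w₁, hw₁, w₂, hw₂, rfl⟩ := Submodule.mem_sup.1 hw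
    simp only [Pi.add_apply, mul_add, Finset.sum_add_distrib,
      h1 w₁ (mem_classFun_sameCycle.1 hw₁), h2 w₂ (mem_classFun_sameCycle.1 hw₂), add_zero]
  -- Boundaries are cycles: paired with a function of the vertices of one colour, the two terms of
  -- the difference cancel after reindexing by the rotation of that colour.
  have hle : LinearMap.range (acrossEdges K ρ₁ ρ₂) ≤ B.orthogonal (W₁ ⊔ W₂) := by
    rintro _ ⟨x, rfl⟩
    have hx := mem_classFun_sameCycle.1 x.2
    rw [hmem]
    refine ⟨fun w hw => ?_, fun w hw => ?_⟩
    · simp only [acrossEdges, LinearMap.coe_mk, AddHom.coe_mk, sub_mul, Finset.sum_sub_distrib,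
        sub_eq_zero]
      refine Fintype.sum_equiv ρ₁ _ _ fun e => ?_
      simp [hw]
    · simp only [acrossEdges, LinearMap.coe_mk, AddHom.coe_mk, sub_mul, Finset.sum_sub_distrib,
        sub_eq_zero]
      refine (Fintype.sum_equiv ρ₂ _ _ fun e => ?_).symm
      have := hx (ρ₁.symm e)
      simp only [Perm.mul_apply, Equiv.apply_symm_apply] at this
      rw [this, hw]
  have hker : Module.finrank K (LinearMap.ker (acrossEdges K ρ₁ ρ₂)) =
      Nat.card (Component ρ₁ ρ₂) := by
    rw [← finrank_classFun K (MulAction.orbitRel (Subgroup.closure {ρ₁, ρ₂}) E)]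
    refine LinearEquiv.finrank_eq
      { toFun := fun x => ⟨x.1.1, mem_classFun_component.2 ((ker_acrossEdges ρ₁ ρ₂ x.1).1 x.2)⟩
        map_add' := fun _ _ => rfl
        map_smul' := fun _ _ => rfl
        invFun := fun x => ⟨⟨x.1, mem_classFun_sameCycle.2 fun e => by
            rw [Perm.mul_apply, (mem_classFun_component.1 x.2).2, (mem_classFun_component.1 x.2).1]⟩,
          (ker_acrossEdges ρ₁ ρ₂ _).2 (mem_classFun_component.1 x.2)⟩
        left_inv := fun _ => rfl
        right_inv := fun _ => rfl }
  have hinf : W₁ ⊓ W₂ = classFun K (MulAction.orbitRel (Subgroup.closure {ρ₁, ρ₂}) E) := by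
    ext x
    rw [Submodule.mem_inf, mem_classFun_sameCycle, mem_classFun_sameCycle, mem_classFun_component]
  have hr := (acrossEdges K ρ₁ ρ₂).finrank_range_add_finrank_ker
  have hs := Submodule.finrank_sup_add_finrank_inf_eq W₁ W₂
  have ho := LinearMap.BilinForm.finrank_orthogonal hB (W₁ ⊔ W₂)
  rw [hinf, finrank_classFun, finrank_classFun, finrank_classFun] at hs
  rw [hker, finrank_classFun] at hr
  have hE : Module.finrank K (E → K) = Nat.card E := by
    rw [Module.finrank_fintype_fun_eq_card, Nat.card_eq_fintype_card]
  have hup := Submodule.finrank_le (W₁ ⊔ W₂)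
  rw [hE] at ho hup
  have hc := cycleCount_mul_comm ρ₁ ρ₂
  unfold IsSpherical at h
  simp only [cycleCount, Component, MulAction.orbitRel.Quotient] at h hc hr hs ho ⊢
  -- Faces minus components equals edges minus (vertices minus components): this is Euler's formula,
  -- so the boundaries fill the space of cycles.
  have heq : LinearMap.range (acrossEdges K ρ₁ ρ₂) = B.orthogonal (W₁ ⊔ W₂) := by
    refine Submodule.eq_of_le_of_finrank_eq hle ?_
    rw [ho]
    omega
  obtain ⟨x, hx⟩ := heq.ge ((hmem c).2 ⟨h₁, h₂⟩)
  exact ⟨x.1, mem_classFun_sameCycle.1 x.2, fun e => congrFun hx e⟩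

end ClassFunctions

/-! ### Exchange of two transversals of the cycles of a permutation -/

section Transversals

variable {E : Type}

/-- The set `m` contains exactly one element of every cycle of `f`. -/
def IsTransversal (f : Perm E) (m : Finset E) : Prop :=
  ∀ e, ∃! g, g ∈ m ∧ f.SameCycle e g

namespace IsTransversal

variable {f : Perm E} {m m' : Finset E}

/-- The element of the transversal in the cycle of `e`. -/
noncomputable def rep (h : IsTransversal f m) (e : E) : E := (h e).choose

theorem rep_mem (h : IsTransversal f m) (e : E) : h.rep e ∈ m := (h e).choose_spec.1.1

theorem sameCycle_rep (h : IsTransversal f m) (e : E) : f.SameCycle e (h.rep e) :=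
  (h e).choose_spec.1.2

theorem rep_eq (h : IsTransversal f m) {e g : E} (hg : g ∈ m) (heg : f.SameCycle e g) :
    h.rep e = g :=
  (h e).unique ⟨h.rep_mem e, h.sameCycle_rep e⟩ ⟨hg, heg⟩

variable [DecidableEq E]

/-- Exchange the elements of two transversals that lie in the same cycle. -/
noncomputable def exchangeFun (h : IsTransversal f m) (h' : IsTransversal f m') (e : E) : E :=
  if e ∈ m then h'.rep e else if e ∈ m' then h.rep e else e

theorem exchangeFun_involutive (h : IsTransversal f m) (h' : IsTransversal f m') :
    Function.Involutive (h.exchangeFun h') := by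
  intro e
  by_cases he : e ∈ m
  · have h1 : h.exchangeFun h' e = h'.rep e := if_pos he
    rw [h1]
    have hs := h'.sameCycle_rep e
    by_cases h2 : h'.rep e ∈ m
    · have h3 : h'.rep e = e := (h.rep_eq h2 hs).symm.trans (h.rep_eq he (SameCycle.refl _ _))
      rw [h3, h1, h3]
    · rw [exchangeFun, if_neg h2, if_pos (h'.rep_mem e), h.rep_eq he hs.symm]
  · by_cases he' : e ∈ m'
    · have h1 : h.exchangeFun h' e = h.rep e := by rw [exchangeFun, if_neg he, if_pos he']
      rw [h1, exchangeFun, if_pos (h.rep_mem e), h'.rep_eq he' (h.sameCycle_rep e).symm]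
    · have h1 : h.exchangeFun h' e = e := by rw [exchangeFun, if_neg he, if_neg he']
      rw [h1, h1]

/-- The permutation that exchanges two transversals. -/
noncomputable def exchange (h : IsTransversal f m) (h' : IsTransversal f m') : Perm E :=
  (exchangeFun_involutive h h').toPerm

variable (h : IsTransversal f m) (h' : IsTransversal f m')

theorem exchange_exchange (e : E) : h.exchange h' (h.exchange h' e) = e :=
  exchangeFun_involutive h h' e

theorem exchange_of_mem {e : E} (he : e ∈ m) : h.exchange h' e = h'.rep e := if_pos he

theorem exchange_of_mem' {e : E} (he : e ∈ m') : h.exchange h' e = h.rep e := by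
  by_cases h1 : e ∈ m
  · rw [exchange_of_mem h h' h1, h.rep_eq h1 (SameCycle.refl _ _),
      h'.rep_eq he (SameCycle.refl _ _)]
  · change h.exchangeFun h' e = _
    rw [exchangeFun, if_neg h1, if_pos he]

theorem exchange_eq_self {e : E} (he : e ∈ m ↔ e ∈ m') : h.exchange h' e = e := by
  by_cases h1 : e ∈ m
  · rw [exchange_of_mem h h' h1, h'.rep_eq (he.1 h1) (SameCycle.refl _ _)]
  · change h.exchangeFun h' e = _
    rw [exchangeFun, if_neg h1, if_neg (he.not.1 h1)]

theorem exchange_mem_right (e : E) : h.exchange h' e ∈ m' ↔ e ∈ m := by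
  refine ⟨fun he => ?_, fun he => ?_⟩
  · rw [← exchange_exchange h h' e, exchange_of_mem' h h' he]
    exact h.rep_mem _
  · rw [exchange_of_mem h h' he]
    exact h'.rep_mem _

theorem exchange_mem_left (e : E) : h.exchange h' e ∈ m ↔ e ∈ m' := by
  rw [← exchange_mem_right h h', exchange_exchange]

theorem sameCycle_exchange (e : E) : f.SameCycle e (h.exchange h' e) := by
  by_cases h1 : e ∈ m
  · rw [exchange_of_mem h h' h1]; exact h'.sameCycle_rep e
  by_cases h2 : e ∈ m'
  · rw [exchange_of_mem' h h' h2]; exact h.sameCycle_rep e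
  · rw [exchange_eq_self h h' (iff_of_false h1 h2)]

theorem eq_or_eq_exchange {e g : E} (he : e ∈ m ∨ e ∈ m') (hg : g ∈ m ∨ g ∈ m')
    (heg : f.SameCycle e g) : g = e ∨ g = h.exchange h' e := by
  rcases he with he | he <;> rcases hg with hg | hg
  · left; rw [← h.rep_eq he (SameCycle.refl _ _), h.rep_eq hg heg]
  · right; rw [exchange_of_mem h h' he, h'.rep_eq hg heg]
  · right; rw [exchange_of_mem' h h' he, h.rep_eq hg heg]
  · left; rw [← h'.rep_eq he (SameCycle.refl _ _), h'.rep_eq hg heg]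

theorem exchange_ne_self {e : E} (he : ¬ (e ∈ m ↔ e ∈ m')) : h.exchange h' e ≠ e := by
  intro heq
  have := exchange_mem_left h h' e
  rw [heq] at this
  exact he this

variable {J : Finset E} [Finite E]

/-- If a set of corners changes exactly at the elements of one transversal only, then exactly one of
the two exchanged elements belongs to it. -/
theorem exchange_mem_iff_notMem (hJ : ∀ e, (f e ∈ J ↔ e ∈ J) ↔ (f e ∈ m ↔ f e ∈ m')) {e : E}
    (he : ¬ (e ∈ m ↔ e ∈ m')) : h.exchange h' e ∈ J ↔ e ∉ J := by
  classical
  have hex : ∃ k : ℕ, (f ^ k) e = h.exchange h' e := (sameCycle_exchange h h' e).exists_nat_pow_eq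
  -- Walk along the cycle from `e` to the first arrival at its partner. A cycle meets the symmetric
  -- difference of `m` and `m'` in at most these two points, so membership in `J` cannot change on
  -- the way.
  obtain ⟨k, hk, hmin⟩ : ∃ k : ℕ, (f ^ k) e = h.exchange h' e ∧
      ∀ i < k, (f ^ i) e ≠ h.exchange h' e :=
    ⟨Nat.find hex, Nat.find_spec hex, fun i hi => Nat.find_min hex hi⟩
  have hoff : ∀ i, 0 < i → i < k → ((f ^ i) e ∈ m ↔ (f ^ i) e ∈ m') := by
    intro i hi hik
    by_contra hC
    have h1 : e ∈ m ∨ e ∈ m' := by tauto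
    have h2 : (f ^ i) e ∈ m ∨ (f ^ i) e ∈ m' := by tauto
    rcases eq_or_eq_exchange h h' h1 h2 ⟨i, by simp⟩ with h3 | h3
    · refine hmin (k - i) (by omega) ?_
      rw [← hk, ← Nat.sub_add_cancel hik.le, pow_add, Perm.mul_apply, h3]
      simp
    · exact hmin i hik h3
  have hconst : ∀ i < k, ((f ^ i) e ∈ J ↔ e ∈ J) := by
    intro i
    induction i with
    | zero => simp
    | succ i ih =>
      intro hi
      rw [← ih (by omega), pow_succ', Perm.mul_apply, hJ, ← Perm.mul_apply, ← pow_succ']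
      exact hoff _ (by omega) hi
  obtain _ | k := k
  · exact absurd hk.symm (exchange_ne_self h h' he)
  -- The last step enters the partner, which lies in the symmetric difference; this is the only
  -- change of membership.
  · have h4 := hJ ((f ^ k) e)
    rw [← Perm.mul_apply, ← pow_succ', hk, hconst k (by omega), exchange_mem_left,
      exchange_mem_right] at h4
    tauto

theorem exchange_apply_mem_iff (hJ : ∀ e, (f e ∈ J ↔ e ∈ J) ↔ (f e ∈ m ↔ f e ∈ m')) (e : E) :
    (h.exchange h' * f) e ∈ J ↔ e ∈ J := by
  rw [Perm.mul_apply]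
  by_cases he : f e ∈ m ↔ f e ∈ m'
  · rw [exchange_eq_self h h' he, (hJ e).2 he]
  · rw [exchange_mem_iff_notMem h h' hJ he]
    have := hJ e
    tauto

/-- Where `m` and `m'` agree on a cycle of `f`, nothing is exchanged and the cycle contains one
element of `m ∪ m'`. Where they differ, the exchange cuts the cycle into two arcs, each with one of
the two exchanged elements, and `J` contains exactly one of the arcs. -/
theorem existsUnique_sameCycle_exchange
    (hJ : ∀ e, (f e ∈ J ↔ e ∈ J) ↔ (f e ∈ m ↔ f e ∈ m')) {x : E} (hx : x ∈ J) :
    ∃! t, t ∈ (m ∪ m') ∩ J ∧ (h.exchange h' * f).SameCycle x t := by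
  have hinv := exchange_apply_mem_iff h h' hJ
  have hsub : ∀ {y z}, (h.exchange h' * f).SameCycle y z → f.SameCycle y z := by
    intro y z hyz
    have := eq_of_sameCycle (f := h.exchange h' * f)
      (v := fun y => Quotient.mk (SameCycle.setoid f) y)
      (fun y => Quotient.sound ((sameCycle_exchange h h' (f y)).symm.trans
        (sameCycle_apply_self f y))) hyz
    exact Quotient.exact this
  refine existsUnique_of_exists_of_unique ?_ ?_
  -- If the orbit of `x` avoids `m ∪ m'`, the exchange never acts on it, so it is an orbit of `f`
  -- and must meet `m` after all.
  · by_contra! hno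
    have hpow : ∀ k : ℕ, ((h.exchange h' * f) ^ k) x = (f ^ k) x := by
      intro k
      induction k with
      | zero => rfl
      | succ k ih =>
        rw [pow_succ', Perm.mul_apply, ih, pow_succ', Perm.mul_apply, Perm.mul_apply]
        refine exchange_eq_self h h' ?_
        by_contra hC
        have hs : (h.exchange h' * f).SameCycle x (h.exchange h' (f ((f ^ k) x))) :=
          ⟨(k + 1 : ℕ), by
            rw [zpow_natCast, pow_succ', Perm.mul_apply, ih, Perm.mul_apply]⟩
        refine hno _ ?_ hs
        rw [Finset.mem_inter, Finset.mem_union, exchange_mem_left, exchange_mem_right]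
        exact ⟨by tauto, (mem_of_sameCycle hinv hs).1 hx⟩
    obtain ⟨k, hk⟩ := (h.sameCycle_rep x).exists_nat_pow_eq
    have hs : (h.exchange h' * f).SameCycle x (h.rep x) := ⟨k, by rw [zpow_natCast, hpow, hk]⟩
    exact hno _ (Finset.mem_inter.2 ⟨Finset.mem_union_left _ (h.rep_mem x),
      (mem_of_sameCycle hinv hs).1 hx⟩) hs
  · rintro t t' ⟨ht, hxt⟩ ⟨ht', hxt'⟩
    rw [Finset.mem_inter, Finset.mem_union] at ht ht'
    rcases eq_or_eq_exchange h h' ht.1 ht'.1 (hsub (hxt.symm.trans hxt')) with h1 | h1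
    · exact h1.symm
    · by_cases hC : t ∈ m ↔ t ∈ m'
      · rw [h1, exchange_eq_self h h' hC]
      · exact absurd ht.2 ((exchange_mem_iff_notMem h h' hJ hC).1 (h1 ▸ ht'.2))

theorem sign_restr_exchange [Fintype E]
    (hJ : ∀ e, (f e ∈ J ↔ e ∈ J) ↔ (f e ∈ m ↔ f e ∈ m')) :
    sign (restr (h.exchange h' * f) J (exchange_apply_mem_iff h h' hJ)) =
      (-1) ^ (J.card + ((m ∪ m') ∩ J).card) :=
  sign_restr _ Finset.inter_subset_right fun _ hx => existsUnique_sameCycle_exchange h h' hJ hx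

end IsTransversal

end Transversals

/-! ### The sign of the face rotation on a region bounded by two dimer coverings -/

section SignOfRegion

variable {E : Type} [DecidableEq E] {ρ₁ ρ₂ : Perm E} {m m' I : Finset E}
  (h₁ : IsTransversal ρ₁ m) (h₁' : IsTransversal ρ₁ m') (h₂ : IsTransversal ρ₂ m)
  (h₂' : IsTransversal ρ₂ m')

/-- The product of the two exchanges moves two edges ahead on an alternating cycle of the two
coverings, hence stays within each covering. -/
theorem exchange_mul_exchange_mem (e : E) :
    (h₂.exchange h₂' * h₁.exchange h₁') e ∈ m ↔ e ∈ m := by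
  rw [Perm.mul_apply, h₂.exchange_mem_left, h₁.exchange_mem_right]

theorem exchange_mul_exchange_mem' (e : E) :
    (h₂.exchange h₂' * h₁.exchange h₁') e ∈ m' ↔ e ∈ m' := by
  rw [Perm.mul_apply, h₂.exchange_mem_right, h₁.exchange_mem_left]

variable [Fintype E]

/-- The sign of the rotation of the faces in a region of the surface that is bounded by the
difference of two dimer coverings is the relative sign of the two coverings. -/
theorem sign_restr_region (hφ : ∀ e, (ρ₂ * ρ₁) e ∈ I ↔ e ∈ I)
    (hI : ∀ e, (ρ₁ e ∈ I ↔ e ∈ I) ↔ (ρ₁ e ∈ m ↔ ρ₁ e ∈ m')) :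
    sign (restr (ρ₂ * ρ₁) I hφ) =
      sign (restr (h₂.exchange h₂' * h₁.exchange h₁') m
        (exchange_mul_exchange_mem h₁ h₁' h₂ h₂')) := by
  set τ₁ := h₁.exchange h₁' with hτ₁
  set τ₂ := h₂.exchange h₂' with hτ₂
  have inv₁ : ∀ e, τ₁ (τ₁ e) = e := h₁.exchange_exchange h₁'
  have inv₂ : ∀ e, τ₂ (τ₂ e) = e := h₂.exchange_exchange h₂'
  -- Membership of an edge in `I` and in `I₂` tells whether the faces on its two sides belong to the
  -- region. They differ exactly on the boundary edges, and both exchanges interchange `I` and `I₂`.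
  let I₂ : Finset E := I.map ρ₁.toEmbedding
  have hI₂ : ∀ e, ρ₁ e ∈ I₂ ↔ e ∈ I := fun e => by simp [I₂]
  have hI₂' : ∀ e, e ∈ I₂ ↔ ρ₁.symm e ∈ I := fun e => by rw [← hI₂, Equiv.apply_symm_apply]
  have hx : ∀ e, (e ∈ I ↔ e ∈ I₂) ↔ (e ∈ m ↔ e ∈ m') := fun e => by
    have := hI (ρ₁.symm e)
    rwa [Equiv.apply_symm_apply, ← hI₂'] at this
  have hJ₂ : ∀ e, (ρ₂ e ∈ I₂ ↔ e ∈ I₂) ↔ (ρ₂ e ∈ m ↔ ρ₂ e ∈ m') := fun e => by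
    rw [← hx (ρ₂ e), hI₂' e, ← hφ, Perm.mul_apply, Equiv.apply_symm_apply]
    exact iff_comm
  have t₁ : ∀ e, τ₁ e ∈ I ↔ e ∈ I₂ := fun e => by
    have := hx e
    by_cases he : e ∈ m ↔ e ∈ m'
    · rw [hτ₁, h₁.exchange_eq_self h₁' he]; tauto
    · rw [hτ₁, h₁.exchange_mem_iff_notMem h₁' hI he]; tauto
  have t₂ : ∀ e, τ₂ e ∈ I₂ ↔ e ∈ I := fun e => by
    have := hx e
    by_cases he : e ∈ m ↔ e ∈ m'
    · rw [hτ₂, h₂.exchange_eq_self h₂' he]; tauto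
    · rw [hτ₂, h₂.exchange_mem_iff_notMem h₂' hJ₂ he]; tauto
  have t₁' : ∀ e, τ₁ e ∈ I₂ ↔ e ∈ I := fun e => by rw [← t₁, inv₁]
  have t₂' : ∀ e, τ₂ e ∈ I ↔ e ∈ I₂ := fun e => by rw [← t₂, inv₂]
  have hτI : ∀ e, (τ₂ * τ₁) e ∈ I ↔ e ∈ I := fun e => by rw [Perm.mul_apply, t₂', t₁']
  have hτm := exchange_mul_exchange_mem h₁ h₁' h₂ h₂'
  have hτm' := exchange_mul_exchange_mem' h₁ h₁' h₂ h₂'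
  -- the rotations around the vertices contribute equal signs
  have hA := h₁.exchange_apply_mem_iff h₁' hI
  have hB := h₂.exchange_apply_mem_iff h₂' hJ₂
  -- Inserting squares of the involutions gives `ρ₂ρ₁ = (τ₂τ₁) · τ₁(τ₂ρ₂)τ₁ · (τ₁ρ₁)`; since `τ₁`
  -- interchanges `I` and `I₂`, every factor can be restricted.
  have hfac : restr (ρ₂ * ρ₁) I hφ = restr (τ₂ * τ₁) I hτI *
      (τ₁ * restr (τ₂ * ρ₂) I₂ hB * τ₁⁻¹) * restr (τ₁ * ρ₁) I hA := by
    have hinv : τ₁⁻¹ = τ₁ := by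
      ext e
      rw [Perm.coe_inv, Equiv.symm_apply_eq, inv₁]
    ext e
    rw [hinv]
    simp only [Perm.mul_apply]
    by_cases he : e ∈ I
    · rw [restr_of_mem hφ he, restr_of_mem hA he]
      have h3 : τ₁ ((τ₁ * ρ₁) e) ∈ I₂ := by rw [t₁', hA]; exact he
      rw [restr_of_mem hB h3]
      have h4 : τ₁ ((τ₂ * ρ₂) (τ₁ ((τ₁ * ρ₁) e))) ∈ I := by rw [t₁, hB]; exact h3
      rw [restr_of_mem hτI h4]
      simp only [Perm.mul_apply, inv₁, inv₂]
    · rw [restr_of_notMem hφ he, restr_of_notMem hA he]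
      have h3 : τ₁ e ∉ I₂ := by rwa [t₁']
      rw [restr_of_notMem hB h3, inv₁, restr_of_notMem hτI he]
  -- Both signs count the elements of `m ∪ m'` in the respective set; `I` and `I₂` have the same
  -- size, and `τ₁` matches the elements counted.
  have hAB : sign (restr (τ₂ * ρ₂) I₂ hB) = sign (restr (τ₁ * ρ₁) I hA) := by
    rw [h₂.sign_restr_exchange h₂' hJ₂, h₁.sign_restr_exchange h₁' hI, Finset.card_map]
    congr 2
    refine Finset.card_bij (fun e _ => τ₁ e) ?_ (fun _ _ _ _ h => τ₁.injective h) ?_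
    · intro e he
      rw [Finset.mem_inter, Finset.mem_union] at he ⊢
      rw [t₁, hτ₁, h₁.exchange_mem_left, h₁.exchange_mem_right]
      tauto
    · intro e he
      refine ⟨τ₁ e, ?_, inv₁ e⟩
      rw [Finset.mem_inter, Finset.mem_union] at he ⊢
      rw [t₁', hτ₁, h₁.exchange_mem_left, h₁.exchange_mem_right]
      tauto
  have hφτ : sign (restr (ρ₂ * ρ₁) I hφ) = sign (restr (τ₂ * τ₁) I hτI) := by
    rw [hfac, Perm.sign_mul, Perm.sign_mul, Perm.sign_mul, Perm.sign_mul, hAB, Perm.sign_inv]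
    rw [mul_comm (sign τ₁), mul_assoc (sign (restr (τ₁ * ρ₁) I hA)), Int.units_mul_self, mul_one,
      mul_assoc, Int.units_mul_self, mul_one]
  -- the cycles on which the region contains the edges of `m'` are traversed backwards
  have i₁ : ∀ e, (τ₂ * τ₁) e ∈ I ∩ m ↔ e ∈ I ∩ m := fun e => by
    rw [Finset.mem_inter, Finset.mem_inter, hτI, hτm]
  have i₂ : ∀ e, (τ₂ * τ₁) e ∈ I \ m ↔ e ∈ I \ m := fun e => by
    rw [Finset.mem_sdiff, Finset.mem_sdiff, hτI, hτm]
  have i₃ : ∀ e, (τ₂ * τ₁) e ∈ m \ I ↔ e ∈ m \ I := fun e => by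
    rw [Finset.mem_sdiff, Finset.mem_sdiff, hτI, hτm]
  -- Conjugation by `τ₁` inverts `τ₂τ₁` and, apart from points fixed by both exchanges, carries `m \
  -- I` to `I \ m`.
  have hback : restr (τ₂ * τ₁) (I \ m) i₂ * (τ₁ * restr (τ₂ * τ₁) (m \ I) i₃ * τ₁⁻¹) = 1 := by
    have hinv : τ₁⁻¹ = τ₁ := by
      ext e
      rw [Perm.coe_inv, Equiv.symm_apply_eq, inv₁]
    ext e
    rw [hinv]
    simp only [Perm.mul_apply, Perm.one_apply]
    have hxe := hx e
    have he₁ := t₁ e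
    have he₂ := h₁.exchange_mem_left h₁' e
    have he₃ := h₁.exchange_mem_right h₁' e
    rw [← hτ₁] at he₂ he₃
    by_cases hC : e ∈ m ↔ e ∈ m'
    · have h5 : τ₁ e = e := h₁.exchange_eq_self h₁' hC
      have h6 : τ₂ e = e := h₂.exchange_eq_self h₂' hC
      simp [restr_apply, h5, h6]
    · by_cases h7 : τ₁ e ∈ m \ I
      · have h8 : e ∈ I \ m := by
          rw [Finset.mem_sdiff] at h7 ⊢
          tauto
        have h9 : τ₁ (τ₂ e) ∈ I \ m := by
          rw [← i₂, Perm.mul_apply, inv₁, inv₂]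
          exact h8
        rw [restr_of_mem i₃ h7, Perm.mul_apply, inv₁, restr_of_mem i₂ h9, Perm.mul_apply, inv₁,
          inv₂]
      · rw [restr_of_notMem i₃ h7, inv₁]
        refine restr_of_notMem i₂ ?_
        rw [Finset.mem_sdiff] at h7 ⊢
        tauto
  have hback' : sign (restr (τ₂ * τ₁) (I \ m) i₂) = sign (restr (τ₂ * τ₁) (m \ I) i₃) := by
    have := congrArg sign hback
    rw [Perm.sign_mul, Perm.sign_mul, Perm.sign_mul, Perm.sign_inv, mul_comm (sign τ₁),
      mul_assoc (sign (restr (τ₂ * τ₁) (m \ I) i₃)), Int.units_mul_self, mul_one, Perm.sign_one] at this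
    rw [← mul_one (sign (restr (τ₂ * τ₁) (m \ I) i₃)), ← this, mul_left_comm, Int.units_mul_self,
      mul_one]
  rw [hφτ, sign_restr_mul_restr_compl (s := I ∩ m) (t := I \ m) (Finset.disjoint_sdiff_inter _ _).symm
    (by rw [Finset.union_comm]; exact Finset.sdiff_union_inter _ _) i₁ i₂, hback',
    sign_restr_mul_restr_compl (u := m) (s := I ∩ m) (t := m \ I)
    (by rw [Finset.inter_comm]; exact (Finset.disjoint_sdiff_inter _ _).symm)
    (by rw [Finset.union_comm, Finset.inter_comm]; exact Finset.sdiff_union_inter _ _) i₁ i₃]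

end SignOfRegion

/-! ### Kasteleyn weightings: existence and the relative sign of two coverings -/

section Kasteleyn

variable {E : Type} {ρ₁ ρ₂ : Perm E} {U : Set (Face ρ₁ ρ₂)}

theorem faceOf_eq_iff {e e' : E} :
    faceOf ρ₁ ρ₂ e = faceOf ρ₁ ρ₂ e' ↔ (ρ₂ * ρ₁).SameCycle e e' := Quotient.eq

theorem faceOf_apply (e : E) : faceOf ρ₁ ρ₂ (ρ₂ (ρ₁ e)) = faceOf ρ₁ ρ₂ e :=
  faceOf_eq_iff.2 (sameCycle_apply_self _ _)

/-- A choice of one edge at the unbounded face of each component. -/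
theorem IsUnbounded.exists_base (hU : IsUnbounded ρ₁ ρ₂ U) :
    ∃ b : Component ρ₁ ρ₂ → E, (∀ c, (Quotient.mk _ (b c) : Component ρ₁ ρ₂) = c) ∧
      (∀ c, faceOf ρ₁ ρ₂ (b c) ∈ U) ∧
      ∀ e, faceOf ρ₁ ρ₂ e ∈ U → faceOf ρ₁ ρ₂ e = faceOf ρ₁ ρ₂ (b (Quotient.mk _ e)) := by
  have h : ∀ c : Component ρ₁ ρ₂, ∃ e : E, (Quotient.mk _ e : Component ρ₁ ρ₂) = c ∧
      faceOf ρ₁ ρ₂ e ∈ U := by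
    intro c
    obtain ⟨f, ⟨hf, e, rfl, hc⟩, -⟩ := hU c
    exact ⟨e, hc, hf⟩
  choose b hb hbU using h
  exact ⟨b, hb, hbU, fun e he =>
    (hU (Quotient.mk _ e)).unique ⟨he, e, rfl, rfl⟩ ⟨hbU _, _, rfl, hb _⟩⟩

variable [Fintype E]

theorem prod_units_eq_neg_one_pow {α : Type*} (s : Finset α) (u : α → ℤˣ) [DecidableEq ℤˣ] :
    ∏ e ∈ s, u e = (-1) ^ (s.filter (fun e => u e = -1)).card := by
  rw [← Finset.prod_const, Finset.prod_filter]
  refine Finset.prod_congr rfl fun e _ => ?_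
  rcases Int.units_eq_one_or (u e) with h | h <;> simp [h]

open Classical in
/-- The Kasteleyn condition at a face as a formula for the product of the signs. -/
theorem kasteleyn_face_iff (ε : E → ℤˣ) (f : Face ρ₁ ρ₂) :
    ((faceLength ρ₁ ρ₂ f % 4 = 0 → Odd (negCount ρ₁ ρ₂ ε f)) ∧
      (faceLength ρ₁ ρ₂ f % 4 = 2 → Even (negCount ρ₁ ρ₂ ε f))) ↔
    ∏ e with faceOf ρ₁ ρ₂ e = f, ε e * ε (ρ₁ e) =
      (-1) ^ ((Finset.univ.filter (fun e => faceOf ρ₁ ρ₂ e = f)).card + 1) := by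
  rw [Finset.prod_mul_distrib, prod_units_eq_neg_one_pow, prod_units_eq_neg_one_pow, ← pow_add,
    Finset.filter_filter, Finset.filter_filter]
  change _ ↔ (-1) ^ (negCount ρ₁ ρ₂ ε f) = _
  unfold faceLength
  generalize (Finset.univ.filter (fun e => faceOf ρ₁ ρ₂ e = f)).card = k
  generalize negCount ρ₁ ρ₂ ε f = l
  have hne : (-1 : ℤˣ) ≠ 1 := by decide
  -- The length of the face is `2 * k`, so its residue modulo 4 is the parity of `k`: the condition
  -- asks for the sign `(-1) ^ (k + 1)` of a `k`-cycle.
  rcases Nat.even_or_odd k with hk | hk <;> rcases Nat.even_or_odd l with hl | hl <;>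
    simp only [pow_succ, hk.neg_one_pow, hl.neg_one_pow] <;>
    simp only [Nat.even_iff, Nat.odd_iff] at hk hl ⊢ <;>
    simp [hne, hne.symm] <;> omega

/-- Every plane bipartite graph has a Kasteleyn weighting. -/
theorem exists_isKasteleyn (hU : IsUnbounded ρ₁ ρ₂ U) : ∃ ε, IsKasteleyn ρ₁ ρ₂ U ε := by
  classical
  obtain ⟨b, hb, hbU, -⟩ := hU.exists_base
  let K := ZMod 2
  let B := {f : Face ρ₁ ρ₂ // f ∉ U}
  let ext : (B → K) → E → K := fun x e =>
    if h : faceOf ρ₁ ρ₂ e ∉ U then x ⟨faceOf ρ₁ ρ₂ e, h⟩ else 0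
  let bd : (B → K) →ₗ[K] (E → K) :=
    { toFun := fun x e => ext x e + ext x (ρ₁.symm e)
      map_add' := fun x y => by
        funext e; simp only [ext, Pi.add_apply]; split_ifs <;> ring
      map_smul' := fun c x => by
        funext e; simp only [ext, Pi.smul_apply, smul_eq_mul, RingHom.id_apply]; split_ifs <;> ring }
  -- The boundaries of the bounded faces are independent: a function in the kernel, extended by
  -- zero, is constant on each component and vanishes at its unbounded face.
  have hker : LinearMap.ker bd = ⊥ := by
    rw [LinearMap.ker_eq_bot']
    intro x hx
    have h₁ : ∀ e, ext x (ρ₁ e) = ext x e := fun e => by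
      have := congrFun hx (ρ₁ e)
      simp only [bd, LinearMap.coe_mk, AddHom.coe_mk, Equiv.symm_apply_apply, Pi.zero_apply] at this
      exact CharTwo.add_eq_zero.1 this
    have hφ : ∀ e, ext x (ρ₂ (ρ₁ e)) = ext x e := fun e => by
      simp only [ext, faceOf_apply]
    have h₂ : ∀ e, ext x (ρ₂ e) = ext x e := fun e => by
      have := hφ (ρ₁.symm e)
      rw [Equiv.apply_symm_apply] at this
      rw [this, ← h₁ (ρ₁.symm e), Equiv.apply_symm_apply]
    ext ⟨f, hf⟩
    obtain ⟨e, rfl⟩ := Quotient.exists_rep f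
    have h3 : ext x e = x ⟨_, hf⟩ := dif_pos hf
    have h4 : ext x e = ext x (b (Quotient.mk _ e)) := eq_of_component h₁ h₂ (hb _).symm
    have h5 : ext x (b (Quotient.mk _ e)) = 0 := dif_neg (not_not.2 (hbU _))
    rw [← h3, h4, h5]
    rfl
  obtain ⟨g, hg⟩ := bd.exists_leftInverse_of_injective hker
  let len : Face ρ₁ ρ₂ → ℕ := fun f => (Finset.univ.filter (fun e => faceOf ρ₁ ρ₂ e = f)).card
  -- By independence some linear functional takes prescribed values on the boundaries of the bounded
  -- faces; its coordinates `s` are the exponents of the required signs.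
  let t : (E → K) →ₗ[K] K :=
    Fintype.linearCombination K (fun f : B => ((len f.1 + 1 : ℕ) : K)) ∘ₗ g
  let s : E → K := fun e => t (fun e' => if e = e' then 1 else 0)
  have ht : ∀ y, t y = ∑ e, y e * s e := t.pi_apply_eq_sum_univ
  refine ⟨fun e => (-1) ^ (s e).val, fun f hf => ?_⟩
  rw [kasteleyn_face_iff]
  have h1 : t (bd (Pi.single ⟨f, hf⟩ 1)) = ((len f + 1 : ℕ) : K) := by
    have : g (bd (Pi.single ⟨f, hf⟩ 1)) = Pi.single ⟨f, hf⟩ 1 := LinearMap.congr_fun hg _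
    rw [LinearMap.comp_apply, this, Fintype.linearCombination_apply_single, one_smul]
  have hext : ∀ e, ext (Pi.single ⟨f, hf⟩ 1) e = if faceOf ρ₁ ρ₂ e = f then 1 else 0 := by
    intro e
    by_cases h2 : faceOf ρ₁ ρ₂ e = f
    · subst h2
      simp [ext, hf]
    · have h3 : ∀ h, (⟨faceOf ρ₁ ρ₂ e, h⟩ : B) ≠ ⟨f, hf⟩ := fun h h3 => h2 (congrArg Subtype.val h3)
      simp [ext, h2, h3]
  have h2 : t (bd (Pi.single ⟨f, hf⟩ 1)) =
      ((∑ e with faceOf ρ₁ ρ₂ e = f, ((s e).val + (s (ρ₁ e)).val) : ℕ) : K) := by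
    rw [ht]
    simp only [bd, LinearMap.coe_mk, AddHom.coe_mk, hext, add_mul, Finset.sum_add_distrib]
    have : ∑ e, (if faceOf ρ₁ ρ₂ (ρ₁.symm e) = f then 1 else 0) * s e =
        ∑ e, (if faceOf ρ₁ ρ₂ e = f then 1 else 0) * s (ρ₁ e) :=
      (Fintype.sum_equiv ρ₁ _ _ fun e => by simp).symm
    rw [this]
    simp [Finset.sum_filter, K]
  rw [h1] at h2
  simp only [← pow_add]
  rw [Finset.prod_pow_eq_pow_sum]
  have h3 := (ZMod.natCast_eq_natCast_iff _ _ _).1 h2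
  have h4 : (-1 : ℤˣ) ^ (len f + 1) =
    (-1) ^ (∑ e with faceOf ρ₁ ρ₂ e = f, ((s e).val + (s (ρ₁ e)).val)) := by
    rw [Int.units_pow_eq_pow_mod_two, h3, ← Int.units_pow_eq_pow_mod_two]
  exact h4.symm

/-- Kasteleyn's theorem for two dimer coverings: the product of the signs along their difference is
their relative sign. -/
theorem IsKasteleyn.sign_eq [DecidableEq E] {ε : E → ℤˣ} (hε : IsKasteleyn ρ₁ ρ₂ U ε)
    (hU : IsUnbounded ρ₁ ρ₂ U) (hS : IsSpherical ρ₁ ρ₂) {m m' : Finset E}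
    (h₁ : IsTransversal ρ₁ m) (h₁' : IsTransversal ρ₁ m') (h₂ : IsTransversal ρ₂ m)
    (h₂' : IsTransversal ρ₂ m') :
    sign (restr (h₂.exchange h₂' * h₁.exchange h₁') m (exchange_mul_exchange_mem h₁ h₁' h₂ h₂')) =
      (∏ e ∈ m, ε e) * ∏ e ∈ m', ε e := by
  classical
  let K := ZMod 2
  let c : E → K := fun e => (if e ∈ m then 1 else 0) + if e ∈ m' then 1 else 0
  have hc : ∀ (f : Perm E) (h : IsTransversal f m) (h' : IsTransversal f m') (w : E → K),
      (∀ e, w (f e) = w e) → ∑ e, c e * w e = 0 := by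
    intro f h h' w hw
    have h3 : ∑ e ∈ m, w e = ∑ e ∈ m', w e := by
      refine Finset.sum_bij (fun e _ => h.exchange h' e)
        (fun e he => (h.exchange_mem_right h' e).2 he)
        (fun _ _ _ _ hab => (h.exchange h').injective hab)
        (fun e he => ⟨h.exchange h' e, (h.exchange_mem_left h' e).2 he, h.exchange_exchange h' e⟩)
        (fun e _ => eq_of_sameCycle hw (h.sameCycle_exchange h' e))
    simp only [c, add_mul, Finset.sum_add_distrib, ite_mul, one_mul, zero_mul]
    simp only [Finset.sum_ite_mem, Finset.univ_inter, h3]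
    exact CharTwo.add_self_eq_zero _
  obtain ⟨χ₀, hφ₀, hχ₀⟩ := hS.exists_primitive c (hc ρ₁ h₁ h₁') (hc ρ₂ h₂ h₂')
  obtain ⟨b, hb, hbU, hbu⟩ := hU.exists_base
  -- A primitive is determined up to a constant on each component; this choice makes it vanish on
  -- the unbounded faces, where no Kasteleyn condition is available.
  let χ : E → K := fun e => χ₀ e - χ₀ (b (Quotient.mk _ e))
  have hφ : ∀ e, χ (ρ₂ (ρ₁ e)) = χ e := fun e => by
    simp only [χ, hφ₀, component_mk_right, component_mk_left]
  have hχ : ∀ e, χ (ρ₁ e) - χ e = c (ρ₁ e) := fun e => by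
    rw [← hχ₀, Equiv.symm_apply_apply]
    simp only [χ, component_mk_left]
    ring
  have hχU : ∀ e, faceOf ρ₁ ρ₂ e ∈ U → χ e = 0 := fun e he => by
    rw [sub_eq_zero]
    exact eq_of_sameCycle (f := ρ₂ * ρ₁) hφ₀ (faceOf_eq_iff.1 (hbu e he))
  let I : Finset E := Finset.univ.filter (fun e => χ e = 1)
  have hIφ : ∀ e, (ρ₂ * ρ₁) e ∈ I ↔ e ∈ I := fun e => by simp [I, hφ]
  have h01 : ∀ x : ZMod 2, x = 0 ∨ x = 1 := by decide
  have hI : ∀ e, (ρ₁ e ∈ I ↔ e ∈ I) ↔ (ρ₁ e ∈ m ↔ ρ₁ e ∈ m') := fun e => by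
    have h4 := hχ e
    simp only [I, Finset.mem_filter_univ]
    simp only [c] at h4
    rcases h01 (χ (ρ₁ e)) with h5 | h5 <;> rcases h01 (χ e) with h6 | h6 <;>
      by_cases h7 : ρ₁ e ∈ m <;> by_cases h8 : ρ₁ e ∈ m' <;> rw [h5, h6] at h4 <;>
      simp only [h5, h6, h7, h8, if_true, if_false] at h4 ⊢ <;> revert h4 <;> decide
  -- In the product over the region an edge occurs once for each side that lies in it, so only the
  -- symmetric difference of `m` and `m'` survives.
  rw [← sign_restr_region h₁ h₁' h₂ h₂' hIφ hI,
    ← prod_eq_sign_restr hIφ (fun e => ε e * ε (ρ₁ e))]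
  · rw [Finset.prod_mul_distrib]
    have h5 : ∏ e ∈ I, ε (ρ₁ e) = ∏ e with ρ₁.symm e ∈ I, ε e := by
      refine Finset.prod_bij (fun e _ => ρ₁ e) ?_ (fun _ _ _ _ h => ρ₁.injective h) ?_
        (fun _ _ => rfl)
      · intro e he; simpa using he
      · intro e he; exact ⟨ρ₁.symm e, by simpa using he, by simp⟩
    have h6 : ∀ s : Finset E, ∏ e ∈ s, ε e = ∏ e, if e ∈ s then ε e else 1 := fun s => by
      rw [Finset.prod_ite_mem, Finset.univ_inter]
    rw [h5, h6, h6, h6 m, h6 m', ← Finset.prod_mul_distrib, ← Finset.prod_mul_distrib]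
    refine Finset.prod_congr rfl fun e _ => ?_
    have h7 := hI (ρ₁.symm e)
    have h8 := Int.units_mul_self (ε e)
    rw [Equiv.apply_symm_apply] at h7
    simp only [Finset.mem_filter_univ]
    by_cases a₁ : e ∈ I <;> by_cases a₂ : ρ₁.symm e ∈ I <;> by_cases a₃ : e ∈ m <;>
      by_cases a₄ : e ∈ m' <;> simp only [a₁, a₂, a₃, a₄, iff_true, iff_false,
        not_true_eq_false] at h7 <;>
      simp [a₁, a₂, a₃, a₄, h8]
  · intro x hx s hs
    have hsf : s = Finset.univ.filter (fun e => faceOf ρ₁ ρ₂ e = faceOf ρ₁ ρ₂ x) := by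
      ext y
      rw [hs, Finset.mem_filter_univ, faceOf_eq_iff, sameCycle_comm]
    have hxU : faceOf ρ₁ ρ₂ x ∉ U := fun hxU => by
      have := hχU x hxU
      rw [(Finset.mem_filter.1 hx).2] at this
      exact one_ne_zero this
    rw [hsf]
    exact (kasteleyn_face_iff ε _).1 (hε _ hxU)

end Kasteleyn

/-! ### Dimer coverings, determinants and Kasteleyn's theorem -/

namespace BipGraph

universe u

variable {A : Type u}

/-- The matrix of the total weights of the edges between two vertices. -/
def biadjacency [CommRing A] (G : BipGraph A) : Matrix G.V₁ G.V₂ A :=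
  fun v w => ∑ e with G.src e = v ∧ G.tgt e = w, G.wt e

namespace IsDimerCovering

variable {G : BipGraph A} {m m' : Finset G.E}

/-- The edge of a dimer covering at a vertex in `V₁`. -/
noncomputable def edgeAt (hm : G.IsDimerCovering m) (v : G.V₁) : G.E := (hm.1 v).choose

theorem edgeAt_mem (hm : G.IsDimerCovering m) (v : G.V₁) : hm.edgeAt v ∈ m :=
  (hm.1 v).choose_spec.1.1

theorem src_edgeAt (hm : G.IsDimerCovering m) (v : G.V₁) : G.src (hm.edgeAt v) = v :=
  (hm.1 v).choose_spec.1.2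

theorem edgeAt_eq (hm : G.IsDimerCovering m) {e : G.E} (he : e ∈ m) {v : G.V₁}
    (hv : G.src e = v) : hm.edgeAt v = e :=
  (hm.1 v).unique ⟨hm.edgeAt_mem v, hm.src_edgeAt v⟩ ⟨he, hv⟩

theorem edgeAt_injective (hm : G.IsDimerCovering m) : Function.Injective hm.edgeAt :=
  Function.LeftInverse.injective (g := G.src) hm.src_edgeAt

theorem image_edgeAt (hm : G.IsDimerCovering m) : Finset.univ.image hm.edgeAt = m := by
  ext e
  simp only [Finset.mem_image, Finset.mem_univ, true_and]
  exact ⟨fun ⟨v, hv⟩ => hv ▸ hm.edgeAt_mem v, fun he => ⟨_, hm.edgeAt_eq he rfl⟩⟩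

theorem prod_eq (hm : G.IsDimerCovering m) {M : Type*} [CommMonoid M] (g : G.E → M) :
    ∏ e ∈ m, g e = ∏ v, g (hm.edgeAt v) := by
  conv_lhs => rw [← hm.image_edgeAt]
  exact Finset.prod_image fun _ _ _ _ h => hm.edgeAt_injective h

/-- The bijection between the colour classes given by a dimer covering, relative to a reference
bijection. -/
noncomputable def perm (hm : G.IsDimerCovering m) (θ : G.V₁ ≃ G.V₂) : Perm G.V₁ :=
  Equiv.ofBijective (fun v => θ.symm (G.tgt (hm.edgeAt v))) <| by
    refine Finite.injective_iff_bijective.1 fun v w h => hm.edgeAt_injective ?_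
    exact (hm.2 _).unique ⟨hm.edgeAt_mem v, θ.symm.injective h⟩ ⟨hm.edgeAt_mem w, rfl⟩

theorem apply_perm (hm : G.IsDimerCovering m) (θ : G.V₁ ≃ G.V₂) (v : G.V₁) :
    θ (hm.perm θ v) = G.tgt (hm.edgeAt v) := θ.apply_symm_apply _

variable {ρ₁ ρ₂ : Perm G.E}

theorem isTransversal₁ (hm : G.IsDimerCovering m) (hG : IsPlaneEmbedding G ρ₁ ρ₂) :
    IsTransversal ρ₁ m := fun e => by
  simp only [hG.star₁, eq_comm (a := G.src e)]
  exact hm.1 (G.src e)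

theorem isTransversal₂ (hm : G.IsDimerCovering m) (hG : IsPlaneEmbedding G ρ₁ ρ₂) :
    IsTransversal ρ₂ m := fun e => by
  simp only [hG.star₂, eq_comm (a := G.tgt e)]
  exact hm.2 (G.tgt e)

/-- The first exchange takes the edge of `m` at `v` to the edge of `m'` at `v`, and the second takes
that to the edge of `m` with the same `V₂`-end. On `m`, identified with `V₁`, this is the quotient
of the two bijections, in which the reference `θ` enters only by its labelling of the vertices. -/
theorem sign_perm_mul (hm : G.IsDimerCovering m) (hm' : G.IsDimerCovering m')
    (hG : IsPlaneEmbedding G ρ₁ ρ₂) (θ : G.V₁ ≃ G.V₂) :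
    sign (hm.perm θ) * sign (hm'.perm θ) =
      sign (restr ((hm.isTransversal₂ hG).exchange (hm'.isTransversal₂ hG) *
        (hm.isTransversal₁ hG).exchange (hm'.isTransversal₁ hG)) m
        (exchange_mul_exchange_mem _ _ _ _)) := by
  have hf : ∀ v, hm.edgeAt v ∈ m := hm.edgeAt_mem
  let f : G.V₁ ≃ {e // e ∈ m} :=
    ⟨fun v => ⟨hm.edgeAt v, hf v⟩, fun e => G.src e.1, fun v => hm.src_edgeAt v,
      fun e => Subtype.ext (hm.edgeAt_eq e.2 rfl)⟩
  have h : restr ((hm.isTransversal₂ hG).exchange (hm'.isTransversal₂ hG) *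
        (hm.isTransversal₁ hG).exchange (hm'.isTransversal₁ hG)) m
        (exchange_mul_exchange_mem _ _ _ _) =
      ((hm.perm θ)⁻¹ * hm'.perm θ).extendDomain f := by
    ext e
    by_cases he : e ∈ m
    · obtain ⟨v, rfl⟩ : ∃ v, hm.edgeAt v = e := ⟨_, hm.edgeAt_eq he rfl⟩
      have h3 : hm.edgeAt v = f v := rfl
      rw [restr_of_mem _ he, h3, extendDomain_apply_image, ← h3, Perm.mul_apply,
        IsTransversal.exchange_of_mem _ _ he,
        IsTransversal.rep_eq (g := hm'.edgeAt v) _ (hm'.edgeAt_mem v)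
          ((hG.star₁ _ _).2 (by rw [hm.src_edgeAt, hm'.src_edgeAt])),
        IsTransversal.exchange_of_mem' _ _ (hm'.edgeAt_mem v)]
      refine IsTransversal.rep_eq _ (hf _) ((hG.star₂ _ _).2 ?_)
      change _ = G.tgt (hm.edgeAt _)
      rw [← hm.apply_perm θ, ← hm'.apply_perm θ, ← Perm.mul_apply (hm.perm θ), mul_inv_cancel_left]
    · rw [restr_of_notMem _ he, extendDomain_apply_not_subtype _ _ he]
  rw [h, sign_extendDomain, Perm.sign_mul, Perm.sign_inv]

end IsDimerCovering

variable [CommRing A] {G : BipGraph A}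

/-- The determinant of the biadjacency matrix is the signed sum over the dimer coverings. -/
theorem det_biadjacency (G : BipGraph A) (θ : G.V₁ ≃ G.V₂) (sgn : Finset G.E → ℤˣ)
    (hsgn : ∀ m (hm : G.IsDimerCovering m), sgn m = sign (hm.perm θ)) [DecidablePred G.IsDimerCovering] :
    (G.biadjacency.submatrix id θ).det =
      ∑ m : Finset G.E with G.IsDimerCovering m, ((sgn m : ℤ) : A) * ∏ e ∈ m, G.wt e := by
  rw [← Matrix.det_transpose, Matrix.det_apply']
  simp only [Matrix.transpose_apply, Matrix.submatrix_apply, id_eq, biadjacency,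
    Finset.prod_univ_sum, Finset.mul_sum]
  rw [Finset.sum_sigma']
  symm
  have hcov : ∀ m ∈ Finset.univ.filter (fun m : Finset G.E => G.IsDimerCovering m),
      G.IsDimerCovering m := fun m hm => (Finset.mem_filter.1 hm).2
  -- The expanded determinant runs over a permutation together with a choice of one edge for each of
  -- its matrix entries. Such a pair is the same as a dimer covering; parallel edges account for the
  -- choice.
  refine Finset.sum_bij (fun m hm => ⟨(hcov m hm).perm θ, (hcov m hm).edgeAt⟩) ?_ ?_ ?_ ?_
  · intro m hm
    simp only [Finset.mem_sigma, Finset.mem_univ, true_and, Fintype.mem_piFinset, Finset.mem_filter]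
    exact fun v => ⟨(hcov m hm).src_edgeAt v, ((hcov m hm).apply_perm θ v).symm⟩
  · intro m hm m' hm' h
    simp only [Sigma.mk.injEq, heq_eq_eq] at h
    rw [← (hcov m hm).image_edgeAt, h.2, (hcov m' hm').image_edgeAt]
  · rintro ⟨σ, d⟩ hd
    simp only [Finset.mem_sigma, Finset.mem_univ, true_and, Fintype.mem_piFinset,
      Finset.mem_filter] at hd
    have hm : G.IsDimerCovering (Finset.univ.image d) := by
      refine ⟨fun v => ⟨d v, ⟨by simp, (hd v).1⟩, ?_⟩,
        fun w => ⟨d (σ.symm (θ.symm w)), ⟨by simp, by rw [(hd _).2]; simp⟩, ?_⟩⟩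
      · rintro e ⟨he, hev⟩
        obtain ⟨v', -, rfl⟩ := Finset.mem_image.1 he
        rw [(hd v').1] at hev
        rw [hev]
      · rintro e ⟨he, hew⟩
        obtain ⟨v', -, rfl⟩ := Finset.mem_image.1 he
        rw [(hd v').2] at hew
        rw [← hew]
        simp
    have hed : hm.edgeAt = d := by
      funext v
      exact hm.edgeAt_eq (Finset.mem_image_of_mem _ (Finset.mem_univ v)) (hd v).1
    refine ⟨Finset.univ.image d, Finset.mem_filter.2 ⟨Finset.mem_univ _, hm⟩, ?_⟩
    simp only [Sigma.mk.injEq, heq_eq_eq]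
    refine ⟨?_, hed⟩
    ext v
    apply θ.injective
    rw [hm.apply_perm, hed, (hd v).2]
  · intro m hm
    simp only
    rw [hsgn m (hcov m hm), (hcov m hm).prod_eq]

/-- Kasteleyn's theorem. -/
theorem partitionFunction_withSigns {ρ₁ ρ₂ : Perm G.E} (hG : IsPlaneEmbedding G ρ₁ ρ₂)
    {U : Set (Face ρ₁ ρ₂)} (hU : IsUnbounded ρ₁ ρ₂ U) {ε : G.E → ℤˣ}
    (hε : IsKasteleyn ρ₁ ρ₂ U ε) (θ : G.V₁ ≃ G.V₂) :
    ∃ κ : ℤˣ, (G.withSigns ε).partitionFunction =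
      ((κ : ℤ) : A) * (G.biadjacency.submatrix id θ).det := by
  classical
  let sgn : Finset G.E → ℤˣ := fun m => if hm : G.IsDimerCovering m then sign (hm.perm θ) else 1
  have hsgn : ∀ m (hm : G.IsDimerCovering m), sgn m = sign (hm.perm θ) := fun m hm => dif_pos hm
  -- The sign of a covering times the product of its Kasteleyn signs does not depend on the
  -- covering.
  have hrel : ∀ m m', G.IsDimerCovering m → G.IsDimerCovering m' →
      sgn m * ∏ e ∈ m, ε e = sgn m' * ∏ e ∈ m', ε e := by
    intro m m' hm hm'
    have h := hm.sign_perm_mul hm' hG θ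
    rw [hε.sign_eq hU hG.spherical, ← hsgn, ← hsgn] at h
    have h1 := Int.units_mul_self (sgn m')
    have h2 := Int.units_mul_self (∏ e ∈ m, ε e)
    calc sgn m * ∏ e ∈ m, ε e
        = (sgn m * sgn m') * (sgn m' * ∏ e ∈ m, ε e) := by
          rw [mul_assoc, ← mul_assoc (sgn m'), h1, one_mul]
      _ = sgn m' * ∏ e ∈ m', ε e := by
          rw [h, mul_comm (∏ e ∈ m, ε e), mul_mul_mul_comm, mul_comm (∏ e ∈ m', ε e), mul_assoc,
            h2, mul_one]
  -- Without dimer coverings both sums are empty and any global sign will do.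
  obtain ⟨κ, hκ⟩ : ∃ κ : ℤˣ, ∀ m, G.IsDimerCovering m → ∏ e ∈ m, ε e = κ * sgn m := by
    by_cases hex : ∃ m, G.IsDimerCovering m
    · obtain ⟨m₀, hm₀⟩ := hex
      refine ⟨sgn m₀ * ∏ e ∈ m₀, ε e, fun m hm => ?_⟩
      rw [← hrel m m₀ hm hm₀, mul_right_comm, Int.units_mul_self, one_mul]
    · exact ⟨1, fun m hm => absurd ⟨m, hm⟩ hex⟩
  refine ⟨κ, ?_⟩
  have hZ : (G.withSigns ε).partitionFunction =
      ∑ m : Finset G.E with G.IsDimerCovering m, ∏ e ∈ m, ((ε e : ℤ) : A) * G.wt e := rfl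
  rw [hZ, G.det_biadjacency θ sgn hsgn, Finset.mul_sum]
  refine Finset.sum_congr rfl fun m hm => ?_
  rw [Finset.prod_mul_distrib, ← mul_assoc]
  congr 1
  have := congrArg (fun x : ℤˣ => ((x : ℤ) : A)) (hκ m (Finset.mem_filter.1 hm).2)
  simpa [Units.coe_prod] using this

end BipGraph

-- Schur complements for tripling and butterflies

universe u

/-- The lower right block is `-1`, its own inverse, so its Schur complement is `M₁₁ + M₁₂ M₂₁`:
every path through a new pair of vertices adds the product of its two outer weights to the old
block. -/
theorem det_submatrix_sumCongr_of_schur {A : Type*} [CommRing A] {V₁ V₂ X : Type*} [Fintype V₁]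
    [DecidableEq V₁] [Fintype X] [DecidableEq X] (M : Matrix (V₁ ⊕ X) (V₂ ⊕ X) A)
    (N : Matrix V₁ V₂ A) (h₂₂ : ∀ x y, M (.inr x) (.inr y) = if x = y then -1 else 0)
    (h : ∀ v w, M (.inl v) (.inl w) + ∑ x, M (.inl v) (.inr x) * M (.inr x) (.inl w) = N v w)
    (θ : V₁ ≃ V₂) :
    (M.submatrix id (θ.sumCongr (Equiv.refl X))).det =
      (-1) ^ Fintype.card X * (N.submatrix id θ).det := by
  have hM : M.submatrix id (θ.sumCongr (Equiv.refl X)) =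
      Matrix.fromBlocks (M.toBlocks₁₁.submatrix id θ) M.toBlocks₁₂ (M.toBlocks₂₁.submatrix id θ)
        (-1) := by
    ext (v | x) (w | y)
    · rfl
    · rfl
    · rfl
    · simp only [Matrix.submatrix_apply, id_eq, Equiv.sumCongr_apply, Sum.map_inr, Equiv.refl_apply,
        h₂₂, Matrix.fromBlocks_apply₂₂, Matrix.neg_apply, Matrix.one_apply]
      split_ifs <;> simp
  let _ : Invertible (-1 : Matrix X X A) := ⟨-1, by simp, by simp⟩
  have hinv : (⅟(-1 : Matrix X X A)) = -1 := rfl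
  rw [hM, Matrix.det_fromBlocks₂₂, hinv, Matrix.det_neg, Matrix.det_one, mul_one]
  congr 2
  ext v w
  simp [← h, Matrix.mul_apply, Matrix.toBlocks₁₁, Matrix.toBlocks₁₂, Matrix.toBlocks₂₁]

namespace BipGraph

variable {A : Type u} [CommRing A]

theorem biadjacency_apply (G : BipGraph A) (v : G.V₁) (w : G.V₂) :
    G.biadjacency v w = ∑ e, if G.src e = v ∧ G.tgt e = w then G.wt e else 0 :=
  Finset.sum_filter _ _

theorem biadjacency_triple (G : BipGraph A) (e : G.E) (v : G.V₁ ⊕ Unit) (w : G.V₂ ⊕ Unit) :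
    (G.triple e).biadjacency v w =
      (∑ g, if Sum.inl (G.src g) = v ∧ (if g = e then Sum.inr () else Sum.inl (G.tgt g)) = w then
        (if g = e then 1 else G.wt g) else 0) +
      ((if Sum.inr () = v ∧ Sum.inr () = w then -1 else 0) +
        if Sum.inr () = v ∧ Sum.inl (G.tgt e) = w then G.wt e else 0) :=
  ((G.triple e).biadjacency_apply v w).trans <| (Fintype.sum_sum_type _).trans <|
    congrArg _ (Fin.sum_univ_two _)

/-- The direct edge `e` is removed from the old block, and the path through the new vertices
restores its weight as `1 * G.wt e`. -/
theorem det_triple (G : BipGraph A) (e : G.E) (θ : G.V₁ ≃ G.V₂) :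
    ((G.triple e).biadjacency.submatrix id (θ.sumCongr (Equiv.refl Unit))).det =
      -(G.biadjacency.submatrix id θ).det := by
  refine (det_submatrix_sumCongr_of_schur (G.triple e).biadjacency G.biadjacency ?_ ?_ θ).trans
    (by simp)
  · rintro ⟨⟩ ⟨⟩
    rw [biadjacency_triple]
    simp
  · intro v w
    have h₁₂ : ∀ g, (if Sum.inl (G.src g) = (Sum.inl v : G.V₁ ⊕ Unit) ∧
        (if g = e then Sum.inr () else Sum.inl (G.tgt g)) = (Sum.inr () : G.V₂ ⊕ Unit) then
          (if g = e then 1 else G.wt g) else 0) =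
        if g = e then (if G.src e = v then 1 else 0) else 0 := fun g => by
      by_cases hg : g = e <;> simp [hg]
    have h₁₁ : ∀ g, (if G.src g = v ∧ G.tgt g = w then G.wt g else 0) =
        (if Sum.inl (G.src g) = (Sum.inl v : G.V₁ ⊕ Unit) ∧
          (if g = e then Sum.inr () else Sum.inl (G.tgt g)) = (Sum.inl w : G.V₂ ⊕ Unit) then
          (if g = e then 1 else G.wt g) else 0) +
        if g = e then (if G.src e = v ∧ G.tgt e = w then G.wt e else 0) else 0 := fun g => by
      by_cases hg : g = e <;> simp [hg]
    rw [Fintype.sum_unique, biadjacency_triple, biadjacency_triple, biadjacency_triple,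
      biadjacency_apply, Finset.sum_congr rfl fun g _ => h₁₁ g]
    simp only [PUnit.default_eq_unit, h₁₂, Finset.sum_add_distrib, Finset.sum_ite_eq',
      Finset.mem_univ, if_true]
    simp only [ite_and]
    split_ifs <;> simp_all

end BipGraph

theorem IsTripling.exists_det_eq {A : Type u} [CommRing A] {G H : BipGraph A}
    (h : IsTripling G H) (θ : G.V₁ ≃ G.V₂) : ∃ (θ' : H.V₁ ≃ H.V₂) (κ : ℤˣ),
      (H.biadjacency.submatrix id θ').det = ((κ : ℤ) : A) * (G.biadjacency.submatrix id θ).det := by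
  induction h with
  | refl => exact ⟨θ, 1, by simp⟩
  | step e _ ih =>
    obtain ⟨θ', κ, h⟩ := ih
    exact ⟨θ'.sumCongr (Equiv.refl Unit), -κ, (BipGraph.det_triple _ _ _).trans (by rw [h]; simp)⟩

theorem sum_wing {A : Type*} [AddCommMonoid A] (g : Wing → A) :
    ∑ w, g w = g .top + (g .mid + (g .bot + (g .pc₀ + (g .pc₁ + (g .qr₀ + g .qr₁))))) := by
  have : (Finset.univ : Finset Wing) = {.top, .mid, .bot, .pc₀, .pc₁, .qr₀, .qr₁} := rfl
  rw [this]
  simp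

theorem Drawing.biadjacency_butterfly {A : Type u} [CommRing A] {G : BipGraph A} (P : Drawing G)
    (v : G.V₁ ⊕ P.X) (w : G.V₂ ⊕ P.X) :
    P.butterfly.biadjacency v w =
      (∑ u, if Sum.inl (G.src (P.edge (.inl u))) = v ∧ Sum.inl (G.tgt (P.edge (.inl u))) = w then
        G.wt (P.edge (.inl u)) else 0) +
      ∑ x, ((if Sum.inl (G.src (P.edge (.inr (x, 1)))) = v ∧
          Sum.inl (G.tgt (P.edge (.inr (x, 0)))) = w then 1 else 0) +
        ((if Sum.inr x = v ∧ Sum.inr x = w then -1 else 0) +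
        ((if Sum.inl (G.src (P.edge (.inr (x, 0)))) = v ∧
          Sum.inl (G.tgt (P.edge (.inr (x, 1)))) = w then
          G.wt (P.edge (.inr (x, 1))) * G.wt (P.edge (.inr (x, 0))) else 0) +
        ((if Sum.inr x = v ∧ Sum.inl (G.tgt (P.edge (.inr (x, 0)))) = w then -1 else 0) +
        ((if Sum.inr x = v ∧ Sum.inl (G.tgt (P.edge (.inr (x, 1)))) = w then
          G.wt (P.edge (.inr (x, 1))) else 0) +
        ((if Sum.inl (G.src (P.edge (.inr (x, 0)))) = v ∧ Sum.inr x = w then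
          -G.wt (P.edge (.inr (x, 0))) else 0) +
        if Sum.inl (G.src (P.edge (.inr (x, 1)))) = v ∧ Sum.inr x = w then 1 else 0)))))) :=
  (P.butterfly.biadjacency_apply v w).trans <| (Fintype.sum_sum_type _).trans <|
    congrArg _ <| (Fintype.sum_prod_type _).trans <|
      Finset.sum_congr rfl fun _ _ => sum_wing _

/-- At a crossing the column of `q` is `-b` at `r₀` and `1` at `r₁`, the row of `p` is `-1` at `c₀`
and `a` at `c₁`. Their product has the entries `b` at `r₀c₀`, `a` at `r₁c₁`, `-ab` at `r₀c₁` and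
`-1` at `r₁c₀`; the edges `bot` and `top` cancel the last two, so the two crossing edges remain. -/
theorem Drawing.det_butterfly {A : Type u} [CommRing A] {G : BipGraph A} (P : Drawing G)
    (θ : G.V₁ ≃ G.V₂) :
    (P.butterfly.biadjacency.submatrix id (θ.sumCongr (Equiv.refl P.X))).det =
      (-1) ^ Fintype.card P.X * (G.biadjacency.submatrix id θ).det := by
  refine det_submatrix_sumCongr_of_schur P.butterfly.biadjacency G.biadjacency ?_ ?_ θ
  · intro x y
    rw [P.biadjacency_butterfly]
    simp only [reduceCtorEq, false_and, and_false, if_false, Finset.sum_const_zero, add_zero,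
      zero_add, Sum.inr.injEq]
    simp [ite_and]
  · intro v w
    have h₁₂ : ∀ x, P.butterfly.biadjacency (Sum.inl v : G.V₁ ⊕ P.X) (Sum.inr x : G.V₂ ⊕ P.X) =
        (if G.src (P.edge (.inr (x, 0))) = v then -G.wt (P.edge (.inr (x, 0))) else 0) +
          if G.src (P.edge (.inr (x, 1))) = v then 1 else 0 := by
      intro x
      rw [P.biadjacency_butterfly]
      simp only [reduceCtorEq, false_and, and_false, if_false, Finset.sum_const_zero,
        zero_add, Sum.inr.injEq, Sum.inl.injEq, Finset.sum_add_distrib]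
      simp [and_comm, ite_and]
    have h₂₁ : ∀ x, P.butterfly.biadjacency (Sum.inr x : G.V₁ ⊕ P.X) (Sum.inl w : G.V₂ ⊕ P.X) =
        (if G.tgt (P.edge (.inr (x, 0))) = w then -1 else 0) +
          if G.tgt (P.edge (.inr (x, 1))) = w then G.wt (P.edge (.inr (x, 1))) else 0 := by
      intro x
      rw [P.biadjacency_butterfly]
      simp only [reduceCtorEq, false_and, and_false, if_false, Finset.sum_const_zero, zero_add,
        Sum.inr.injEq, Sum.inl.injEq, Finset.sum_add_distrib]
      simp [ite_and]
    simp only [h₁₂, h₂₁]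
    rw [P.biadjacency_butterfly, BipGraph.biadjacency_apply, ← P.edge.sum_comp]
    simp only [Fintype.sum_sum_type, Fintype.sum_prod_type, Fin.sum_univ_two]
    simp only [reduceCtorEq, false_and, and_false, if_false, add_zero, zero_add, Sum.inl.injEq]
    rw [add_assoc, ← Finset.sum_add_distrib]
    congr 1
    refine Finset.sum_congr rfl fun x _ => ?_
    simp only [ite_and]
    split_ifs <;> ring

/-! ### Vertices and segments of a drawing, and vertex stars after inserting butterflies -/

section ButterflyEmbedding

theorem sameCycle_of_apply_eq {α : Type} {f : Perm α} {x y : α} (h : f x = y) :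
    f.SameCycle y x := h ▸ sameCycle_apply_self f x

theorem cycleCount_sumCongr {α β : Type} [Finite α] [Finite β] (f : Perm α) (g : Perm β) :
    cycleCount (Perm.sumCongr f g) = cycleCount f + cycleCount g := by
  have hl : ∀ {x y}, f.SameCycle x y → (Perm.sumCongr f g).SameCycle (.inl x) (.inl y) := by
    intro x y h
    have := eq_of_sameCycle (f := f)
      (v := fun x => Quotient.mk (SameCycle.setoid (Perm.sumCongr f g)) (.inl x))
      (fun x => Quotient.sound (sameCycle_apply_self (Perm.sumCongr f g) (.inl x))) h
    exact Quotient.exact this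
  have hr : ∀ {x y}, g.SameCycle x y → (Perm.sumCongr f g).SameCycle (.inr x) (.inr y) := by
    intro x y h
    have := eq_of_sameCycle (f := g)
      (v := fun x => Quotient.mk (SameCycle.setoid (Perm.sumCongr f g)) (.inr x))
      (fun x => Quotient.sound (sameCycle_apply_self (Perm.sumCongr f g) (.inr x))) h
    exact Quotient.exact this
  rw [cycleCount, cycleCount, cycleCount, ← Nat.card_sum]
  let v : α ⊕ β → Quotient (SameCycle.setoid f) ⊕ Quotient (SameCycle.setoid g) :=
    Sum.map (Quotient.mk _) (Quotient.mk _)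
  have hv : ∀ x, v (Perm.sumCongr f g x) = v x := by
    rintro (x | x)
    · exact congrArg Sum.inl (Quotient.sound (sameCycle_apply_self f x))
    · exact congrArg Sum.inr (Quotient.sound (sameCycle_apply_self g x))
  refine Nat.card_congr ⟨Quotient.lift v fun _ _ h => eq_of_sameCycle hv h,
    Sum.elim (Quotient.map Sum.inl fun _ _ => hl) (Quotient.map Sum.inr fun _ _ => hr), ?_, ?_⟩
  · rintro ⟨x | x⟩ <;> rfl
  · rintro (x | x) <;> induction x using Quotient.inductionOn <;> rfl

theorem cycleCount_one (α : Type) : cycleCount (1 : Perm α) = Nat.card α := by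
  refine Nat.card_congr ⟨Quotient.lift id fun x y h => ?_, Quotient.mk _, ?_, fun _ => rfl⟩
  · obtain ⟨k, hk⟩ := h
    simpa using hk
  · rintro ⟨x⟩; rfl

/-- The cycles of the rotation at a crossing point. -/
theorem cycleCount_rotate (X : Type) :
    cycleCount (Equiv.prodCongr (Equiv.refl X) (Equiv.addRight (1 : Fin 4))) = Nat.card X := by
  rw [← cycleCount_one X]
  set f : Perm (X × Fin 4) := Equiv.prodCongr (Equiv.refl X) (Equiv.addRight (1 : Fin 4))
  refine cycleCount_congr (f := f) Prod.fst (fun x => (x, 0)) (fun _ => SameCycle.refl _ _)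
    (fun _ => SameCycle.refl _ _) ?_ (fun _ => SameCycle.refl _ _)
  rintro ⟨x, i⟩
  refine ⟨i.1, ?_⟩
  rw [zpow_natCast]
  fin_cases i <;> rfl

/-- A crossed segment has exactly one half-edge at a crossing point, which represents it; hence four
segments for each crossing. -/
theorem cycleCount_segments (U X : Type) [Finite U] [Finite X] :
    cycleCount (segments U X) = Nat.card U + 4 * Nat.card X := by
  have h : cycleCount (segments U X) = cycleCount (1 : Perm (U ⊕ X × Fin 4)) := by
    refine cycleCount_congr
      (fun | .inl (.inl (.inl u)) => .inl u
           | .inl (.inr (.inl u)) => .inl u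
           | .inl (.inl (.inr (x, 0))) => .inr (x, 0)
           | .inl (.inl (.inr (x, 1))) => .inr (x, 1)
           | .inl (.inr (.inr (x, 0))) => .inr (x, 2)
           | .inl (.inr (.inr (x, 1))) => .inr (x, 3)
           | .inr y => .inr y)
      (fun | .inl u => .inl (.inl (.inl u))
           | .inr y => .inr y) ?_ (fun _ => SameCycle.refl _ _) ?_ ?_
    · rintro (((u | ⟨x, i⟩) | (u | ⟨x, i⟩)) | ⟨x, i⟩) <;>
        first | exact SameCycle.refl _ _ | (fin_cases i <;> exact SameCycle.refl _ _)
    · rintro (((u | ⟨x, i⟩) | (u | ⟨x, i⟩)) | ⟨x, i⟩) <;>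
        first
        | exact SameCycle.refl _ _
        | exact sameCycle_of_apply_eq (f := segments U X) rfl
        | (fin_cases i <;> exact sameCycle_of_apply_eq (f := segments U X) rfl)
    · rintro (u | ⟨x, i⟩) <;> exact SameCycle.refl _ _
  rw [h, cycleCount_one, Nat.card_sum, Nat.card_prod, Nat.card_fin]
  ring

variable {U X : Type}

/-- The old edge, or the new vertex `p`, at the `V₁`-end of an edge of a butterfly. -/
def source₁ : U ⊕ X × Wing → (U ⊕ X × Fin 2) ⊕ X
  | .inl u => .inl (.inl u)
  | .inr (x, .top) => .inl (.inr (x, 1))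
  | .inr (x, .mid) => .inr x
  | .inr (x, .bot) => .inl (.inr (x, 0))
  | .inr (x, .pc₀) => .inr x
  | .inr (x, .pc₁) => .inr x
  | .inr (x, .qr₀) => .inl (.inr (x, 0))
  | .inr (x, .qr₁) => .inl (.inr (x, 1))

/-- The old edge, or the new vertex `q`, at the `V₂`-end of an edge of a butterfly. -/
def source₂ : U ⊕ X × Wing → (U ⊕ X × Fin 2) ⊕ X
  | .inl u => .inl (.inl u)
  | .inr (x, .top) => .inl (.inr (x, 0))
  | .inr (x, .mid) => .inr x
  | .inr (x, .bot) => .inl (.inr (x, 1))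
  | .inr (x, .pc₀) => .inl (.inr (x, 0))
  | .inr (x, .pc₁) => .inl (.inr (x, 1))
  | .inr (x, .qr₀) => .inr x
  | .inr (x, .qr₁) => .inr x

theorem source₁_first₁ (e : U ⊕ X × Fin 2) : source₁ (first₁ e) = .inl e := by
  rcases e with u | ⟨x, i⟩ <;> first | rfl | (fin_cases i <;> rfl)

theorem source₂_first₂ (e : U ⊕ X × Fin 2) : source₂ (first₂ e) = .inl e := by
  rcases e with u | ⟨x, i⟩ <;> first | rfl | (fin_cases i <;> rfl)

variable {A : Type*} [CommRing A] {G : BipGraph A} (P : Drawing G)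

theorem Drawing.sameCycle_next₁ {e e' : P.U ⊕ P.X × Wing} (h : next₁ P.rot₁ e = e') :
    P.butterflyRot₁.SameCycle e' e := sameCycle_of_apply_eq h

theorem Drawing.sameCycle_next₂ {e e' : P.U ⊕ P.X × Wing} (h : next₂ P.rot₂ e = e') :
    P.butterflyRot₂.SameCycle e' e := sameCycle_of_apply_eq h

theorem Drawing.sameCycle_first₁_last₁ (e : P.U ⊕ P.X × Fin 2) :
    P.butterflyRot₁.SameCycle (last₁ e) (first₁ e) := by
  rcases e with u | ⟨x, i⟩
  · exact SameCycle.refl _ _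
  · fin_cases i <;> exact P.sameCycle_next₁ rfl

theorem Drawing.sameCycle_first₂_last₂ (e : P.U ⊕ P.X × Fin 2) :
    P.butterflyRot₂.SameCycle (last₂ e) (first₂ e) := by
  rcases e with u | ⟨x, i⟩
  · exact SameCycle.refl _ _
  · fin_cases i <;> exact P.sameCycle_next₂ rfl

theorem Drawing.sameCycle_source₁_next₁ (e : P.U ⊕ P.X × Wing) :
    (Perm.sumCongr P.rot₁ (1 : Perm P.X)).SameCycle (source₁ (next₁ P.rot₁ e)) (source₁ e) := by
  have h : ∀ e, (Perm.sumCongr P.rot₁ (1 : Perm P.X)).SameCycle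
      (source₁ (first₁ (P.rot₁ e))) (.inl e) := fun e => by
    rw [source₁_first₁]
    exact sameCycle_apply_self (Perm.sumCongr P.rot₁ (1 : Perm P.X)) (.inl e)
  rcases e with u | ⟨x, _ | _⟩ <;> first | exact SameCycle.refl _ _ | exact h _

theorem Drawing.sameCycle_source₂_next₂ (e : P.U ⊕ P.X × Wing) :
    (Perm.sumCongr P.rot₂ (1 : Perm P.X)).SameCycle (source₂ (next₂ P.rot₂ e)) (source₂ e) := by
  have h : ∀ e, (Perm.sumCongr P.rot₂ (1 : Perm P.X)).SameCycle
      (source₂ (first₂ (P.rot₂ e))) (.inl e) := fun e => by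
    rw [source₂_first₂]
    exact sameCycle_apply_self (Perm.sumCongr P.rot₂ (1 : Perm P.X)) (.inl e)
  rcases e with u | ⟨x, _ | _⟩ <;> first | exact SameCycle.refl _ _ | exact h _

/-- The cycles of the new rotation around `V₁` are those of the old one and the stars of the new
vertices. -/
theorem Drawing.cycles_butterflyRot₁ :
    cycleCount P.butterflyRot₁ = cycleCount P.rot₁ + Nat.card P.X ∧
    ∀ e e', P.butterflyRot₁.SameCycle e e' ↔
      (Perm.sumCongr P.rot₁ (1 : Perm P.X)).SameCycle (source₁ e) (source₁ e') := by
  let k : (P.U ⊕ P.X × Fin 2) ⊕ P.X → P.U ⊕ P.X × Wing :=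
    Sum.elim first₁ (fun x => .inr (x, .mid))
  have hk : ∀ y, P.butterflyRot₁.SameCycle
      (k (Perm.sumCongr P.rot₁ (1 : Perm P.X) y)) (k y) := by
    rintro (e | x)
    · exact (P.sameCycle_next₁ (next₁_last₁ _ e)).trans (P.sameCycle_first₁_last₁ e)
    · exact SameCycle.refl _ _
  have hkj : ∀ e, P.butterflyRot₁.SameCycle (k (source₁ e)) e := by
    rintro (u | ⟨x, _ | _⟩)
    · exact SameCycle.refl _ _
    · exact SameCycle.refl _ _
    · exact SameCycle.refl _ _
    · exact (P.sameCycle_next₁ rfl).symm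
    · exact (P.sameCycle_next₁ rfl).symm
    · exact P.sameCycle_next₁ rfl
    · exact SameCycle.refl _ _
    · exact (P.sameCycle_next₁ rfl).symm
  have hjk : ∀ y, (Perm.sumCongr P.rot₁ (1 : Perm P.X)).SameCycle (source₁ (k y)) y := by
    rintro (e | x)
    · exact (source₁_first₁ e).symm ▸ SameCycle.refl _ _
    · exact SameCycle.refl _ _
  refine ⟨?_, sameCycle_congr _ _ P.sameCycle_source₁_next₁ hk hkj hjk⟩
  rw [← cycleCount_one P.X, ← cycleCount_sumCongr]
  exact cycleCount_congr _ _ P.sameCycle_source₁_next₁ hk hkj hjk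

/-- The cycles of the new rotation around `V₂` are those of the old one and the stars of the new
vertices. -/
theorem Drawing.cycles_butterflyRot₂ :
    cycleCount P.butterflyRot₂ = cycleCount P.rot₂ + Nat.card P.X ∧
    ∀ e e', P.butterflyRot₂.SameCycle e e' ↔
      (Perm.sumCongr P.rot₂ (1 : Perm P.X)).SameCycle (source₂ e) (source₂ e') := by
  let k : (P.U ⊕ P.X × Fin 2) ⊕ P.X → P.U ⊕ P.X × Wing :=
    Sum.elim first₂ (fun x => .inr (x, .mid))
  have hk : ∀ y, P.butterflyRot₂.SameCycle
      (k (Perm.sumCongr P.rot₂ (1 : Perm P.X) y)) (k y) := by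
    rintro (e | x)
    · exact (P.sameCycle_next₂ (next₂_last₂ _ e)).trans (P.sameCycle_first₂_last₂ e)
    · exact SameCycle.refl _ _
  have hkj : ∀ e, P.butterflyRot₂.SameCycle (k (source₂ e)) e := by
    rintro (u | ⟨x, _ | _⟩)
    · exact SameCycle.refl _ _
    · exact (P.sameCycle_next₂ rfl).symm
    · exact SameCycle.refl _ _
    · exact SameCycle.refl _ _
    · exact SameCycle.refl _ _
    · exact (P.sameCycle_next₂ rfl).symm
    · exact (P.sameCycle_next₂ rfl).symm
    · exact P.sameCycle_next₂ rfl
  have hjk : ∀ y, (Perm.sumCongr P.rot₂ (1 : Perm P.X)).SameCycle (source₂ (k y)) y := by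
    rintro (e | x)
    · exact (source₂_first₂ e).symm ▸ SameCycle.refl _ _
    · exact SameCycle.refl _ _
  refine ⟨?_, sameCycle_congr _ _ P.sameCycle_source₂_next₂ hk hkj hjk⟩
  rw [← cycleCount_one P.X, ← cycleCount_sumCongr]
  exact cycleCount_congr _ _ P.sameCycle_source₂_next₂ hk hkj hjk

theorem sameCycle_sumCongr_one_iff {E V : Type} [Finite E] (f : Perm E) (s : E → V)
    (h : ∀ e e', f.SameCycle e e' ↔ s e = s e') (y y' : E ⊕ X) :
    (Perm.sumCongr f (1 : Perm X)).SameCycle y y' ↔ Sum.map s id y = Sum.map s id y' := by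
  have hs : ∀ y, Sum.map s (id : X → X) (Perm.sumCongr f (1 : Perm X) y) = Sum.map s id y := by
    rintro (e | x)
    · exact congrArg Sum.inl ((h _ _).1 (sameCycle_apply_self f e))
    · rfl
  refine ⟨fun hc => eq_of_sameCycle hs hc, fun heq => ?_⟩
  rcases y with e | x <;> rcases y' with e' | x' <;>
    simp only [Sum.map_inl, Sum.map_inr, Sum.inl.injEq, Sum.inr.injEq, reduceCtorEq, id_eq] at heq
  · have := eq_of_sameCycle (f := f)
      (v := fun e => Quotient.mk (SameCycle.setoid (Perm.sumCongr f (1 : Perm X))) (.inl e))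
      (fun e => Quotient.sound (sameCycle_apply_self (Perm.sumCongr f (1 : Perm X)) (.inl e)))
      ((h _ _).2 heq)
    exact Quotient.exact this
  · rw [heq]

theorem Drawing.star₁_butterfly (e e' : P.butterfly.E) :
    P.butterflyRot₁.SameCycle e e' ↔ P.butterfly.src e = P.butterfly.src e' := by
  have h : ∀ e : P.butterfly.E, P.butterfly.src e =
      Sum.map (fun e => G.src (P.edge e)) id (source₁ e) := by
    rintro (u | ⟨x, _ | _⟩) <;> rfl
  rw [P.cycles_butterflyRot₁.2, sameCycle_sumCongr_one_iff _ _ P.star₁, h, h]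
  rfl

theorem Drawing.star₂_butterfly (e e' : P.butterfly.E) :
    P.butterflyRot₂.SameCycle e e' ↔ P.butterfly.tgt e = P.butterfly.tgt e' := by
  have h : ∀ e : P.butterfly.E, P.butterfly.tgt e =
      Sum.map (fun e => G.tgt (P.edge e)) id (source₂ e) := by
    rintro (u | ⟨x, _ | _⟩) <;> rfl
  rw [P.cycles_butterflyRot₂.2, sameCycle_sumCongr_one_iff _ _ P.star₂, h, h]
  rfl

end ButterflyEmbedding

/-! ### Faces and components after inserting butterflies; Euler's formula -/

section ButterflySphere

/-- The corner of a drawing that lies in the same face as the corner that follows an edge of a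
butterfly at its `V₁`-end; the second summand stands for the two inner faces of a butterfly. -/
def outerCorner {U X : Type} :
    U ⊕ X × Wing → (((U ⊕ X × Fin 2) ⊕ (U ⊕ X × Fin 2)) ⊕ X × Fin 4) ⊕ X × Fin 2
  | .inl u => .inl (.inl (.inl (.inl u)))
  | .inr (x, .top) => .inr (x, 0)
  | .inr (x, .mid) => .inr (x, 0)
  | .inr (x, .bot) => .inl (.inl (.inl (.inr (x, 0))))
  | .inr (x, .pc₀) => .inl (.inr (x, 2))
  | .inr (x, .pc₁) => .inr (x, 1)
  | .inr (x, .qr₀) => .inr (x, 1)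
  | .inr (x, .qr₁) => .inl (.inl (.inl (.inr (x, 1))))

/-- An edge of a butterfly whose corner at its `V₁`-end lies in the face of a given corner of a
drawing. -/
def innerCorner {U X : Type} (ρ : U ⊕ X × Fin 2 → U ⊕ X × Fin 2) :
    (((U ⊕ X × Fin 2) ⊕ (U ⊕ X × Fin 2)) ⊕ X × Fin 4) ⊕ X × Fin 2 → U ⊕ X × Wing
  | .inl (.inl (.inl e)) => last₁ e
  | .inl (.inl (.inr e)) => first₂ (ρ e)
  | .inl (.inr (x, 0)) => .inr (x, .qr₁)
  | .inl (.inr (x, 1)) => first₂ (ρ (.inr (x, 0)))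
  | .inl (.inr (x, 2)) => .inr (x, .pc₀)
  | .inl (.inr (x, 3)) => .inr (x, .bot)
  | .inr (x, 0) => .inr (x, .mid)
  | .inr (x, 1) => .inr (x, .pc₁)

variable {A : Type*} [CommRing A] {G : BipGraph A} (P : Drawing G)

/-- The permutation of the corners of a drawing that moves along the faces, together with the inner
faces of the butterflies. -/
def Drawing.faceWalk :
    Perm ((((P.U ⊕ P.X × Fin 2) ⊕ (P.U ⊕ P.X × Fin 2)) ⊕ P.X × Fin 4) ⊕ P.X × Fin 2) :=
  Perm.sumCongr (segments P.U P.X * planarRotation P.X P.rot₁ P.rot₂) 1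

theorem Drawing.outerCorner_first₂ (e : P.U ⊕ P.X × Fin 2) :
    P.faceWalk.SameCycle (outerCorner (first₂ (P.rot₂ e))) (.inl (.inl (.inr e))) := by
  have h : ∀ g, P.rot₂ e = g → P.faceWalk (.inl (.inl (.inr e))) =
      .inl (segments P.U P.X (.inl (.inr g))) := by rintro _ rfl; rfl
  generalize P.rot₂ e = g at h
  have h := sameCycle_of_apply_eq (h g rfl)
  rcases g with u | ⟨x, i⟩
  · exact h
  · fin_cases i
    · exact h
    · exact (sameCycle_of_apply_eq (f := P.faceWalk) rfl).trans h

theorem Drawing.outerCorner_first₁ (e : P.U ⊕ P.X × Fin 2) :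
    P.faceWalk.SameCycle (outerCorner (P.butterflyRot₂ (first₁ (P.rot₁ e))))
      (.inl (.inl (.inl e))) := by
  have h : ∀ g, P.rot₁ e = g → P.faceWalk (.inl (.inl (.inl e))) =
      .inl (segments P.U P.X (.inl (.inl g))) := by rintro _ rfl; rfl
  generalize P.rot₁ e = g at h
  have h := sameCycle_of_apply_eq (h g rfl)
  rcases g with u | ⟨x, i⟩
  · exact (P.outerCorner_first₂ _).trans h
  · fin_cases i
    · exact (sameCycle_of_apply_eq (f := P.faceWalk) rfl).trans h
    · exact (P.outerCorner_first₂ _).trans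
        ((sameCycle_of_apply_eq (f := P.faceWalk) rfl).trans h)

/-- Outside a butterfly a face walk proceeds as it did around the crossing point, and the two
quadrilaterals inside are new. The butterfly graph records a face by its corners at `V₁` only, the
planarization by corners at all its vertices, so the two maps of corners are inverse to each other
only up to steps of the walks. The two new faces are the fixed points of the identity on the last
summand. -/
theorem Drawing.cycleCount_faces :
    cycleCount (P.butterflyRot₁ * P.butterflyRot₂) =
      cycleCount (planarRotation P.X P.rot₁ P.rot₂ * segments P.U P.X) + 2 * Nat.card P.X := by
  have h2 : 2 * Nat.card P.X = cycleCount (1 : Perm (P.X × Fin 2)) := by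
    rw [cycleCount_one, Nat.card_prod, Nat.card_fin, mul_comm]
  rw [cycleCount_mul_comm, cycleCount_mul_comm (planarRotation _ _ _), h2, ← cycleCount_sumCongr]
  have hlast : ∀ e, (P.butterflyRot₂ * P.butterflyRot₁) (last₁ e) =
      P.butterflyRot₂ (first₁ (P.rot₁ e)) := fun e =>
    congrArg P.butterflyRot₂ (next₁_last₁ P.rot₁ e)
  refine cycleCount_congr (g := P.faceWalk) outerCorner (innerCorner P.rot₂) ?_ ?_ ?_ ?_
  · rintro (u | ⟨x, _ | _⟩)
    · exact P.outerCorner_first₁ _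
    · exact SameCycle.refl _ _
    · exact SameCycle.refl _ _
    · exact P.outerCorner_first₁ _
    · exact (P.outerCorner_first₂ (.inr (x, 1))).trans
        (sameCycle_of_apply_eq (f := P.faceWalk) rfl)
    · exact SameCycle.refl _ _
    · exact SameCycle.refl _ _
    · exact P.outerCorner_first₁ _
  · rintro (((e | e) | ⟨x, i⟩) | ⟨x, i⟩)
    · refine sameCycle_of_apply_eq ((hlast e).trans ?_)
      change _ = innerCorner P.rot₂ (.inl (segments P.U P.X (.inl (.inl (P.rot₁ e)))))
      generalize P.rot₁ e = g
      rcases g with u | ⟨x, i⟩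
      · rfl
      · fin_cases i <;> rfl
    · change SameCycle _ (innerCorner P.rot₂ (.inl (segments P.U P.X (.inl (.inr (P.rot₂ e))))))
        (first₂ (P.rot₂ e))
      generalize P.rot₂ e = g
      rcases g with u | ⟨x, i⟩
      · exact SameCycle.refl _ _
      · fin_cases i <;> exact SameCycle.refl _ _
    · fin_cases i
      · exact SameCycle.refl _ _
      · exact SameCycle.refl _ _
      · exact sameCycle_of_apply_eq (f := P.butterflyRot₂ * P.butterflyRot₁) rfl
      · exact SameCycle.refl _ _
    · exact SameCycle.refl _ _
  · rintro (u | ⟨x, _ | _⟩)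
    · exact SameCycle.refl _ _
    · exact sameCycle_of_apply_eq (f := P.butterflyRot₂ * P.butterflyRot₁) rfl
    · exact SameCycle.refl _ _
    · exact SameCycle.refl _ _
    · exact SameCycle.refl _ _
    · exact SameCycle.refl _ _
    · exact sameCycle_of_apply_eq (f := P.butterflyRot₂ * P.butterflyRot₁) rfl
    · exact SameCycle.refl _ _
  · rintro (((e | e) | ⟨x, i⟩) | ⟨x, i⟩)
    · rcases e with u | ⟨x, i⟩
      · exact SameCycle.refl _ _
      · fin_cases i <;> exact SameCycle.refl _ _
    · exact P.outerCorner_first₂ e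
    · fin_cases i
      · exact sameCycle_of_apply_eq (f := P.faceWalk) rfl
      · exact (P.outerCorner_first₂ _).trans (sameCycle_of_apply_eq (f := P.faceWalk) rfl)
      · exact SameCycle.refl _ _
      · exact sameCycle_of_apply_eq (f := P.faceWalk) rfl
    · fin_cases i <;> exact SameCycle.refl _ _

theorem component_eq_left {α : Type} {s a : Perm α} {x y : α} (h : s x = y) :
    (Quotient.mk _ y : Component s a) = Quotient.mk _ x := h ▸ component_mk_left s a x

theorem component_eq_right {α : Type} {s a : Perm α} {x y : α} (h : a x = y) :
    (Quotient.mk _ y : Component s a) = Quotient.mk _ x := h ▸ component_mk_right s a x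

theorem Drawing.component_wing (x : P.X) (w : Wing) :
    (Quotient.mk _ (.inr (x, w)) : Component P.butterflyRot₁ P.butterflyRot₂) =
      Quotient.mk _ (.inr (x, .mid)) := by
  have hp : (Quotient.mk _ (.inr (x, .pc₀)) : Component P.butterflyRot₁ P.butterflyRot₂) =
      Quotient.mk _ (.inr (x, .mid)) := component_eq_left rfl
  have hq : (Quotient.mk _ (.inr (x, .qr₀)) : Component P.butterflyRot₁ P.butterflyRot₂) =
      Quotient.mk _ (.inr (x, .mid)) := component_eq_right rfl
  cases w
  · exact (component_eq_right rfl).trans hp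
  · rfl
  · exact (component_eq_left rfl).trans hq
  · exact hp
  · exact (component_eq_left rfl).trans hp
  · exact hq
  · exact (component_eq_right rfl).trans hq

theorem Drawing.component_crossing (x : P.X) (i : Fin 4) :
    (Quotient.mk _ (.inr (x, i)) : Component (planarRotation P.X P.rot₁ P.rot₂)
      (segments P.U P.X)) = Quotient.mk _ (.inr (x, 0)) := by
  have h1 : (Quotient.mk _ (.inr (x, 1)) : Component (planarRotation P.X P.rot₁ P.rot₂)
      (segments P.U P.X)) = Quotient.mk _ (.inr (x, 0)) := component_eq_left rfl
  have h2 : (Quotient.mk _ (.inr (x, 2)) : Component (planarRotation P.X P.rot₁ P.rot₂)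
      (segments P.U P.X)) = Quotient.mk _ (.inr (x, 1)) := component_eq_left rfl
  have h3 : (Quotient.mk _ (.inr (x, 3)) : Component (planarRotation P.X P.rot₁ P.rot₂)
      (segments P.U P.X)) = Quotient.mk _ (.inr (x, 2)) := component_eq_left rfl
  fin_cases i
  · rfl
  · exact h1
  · exact h2.trans h1
  · exact h3.trans (h2.trans h1)

/-- A half-edge of a drawing in the component of an edge of a butterfly. -/
def halfEdgeNear {U X : Type} :
    U ⊕ X × Wing → ((U ⊕ X × Fin 2) ⊕ (U ⊕ X × Fin 2)) ⊕ X × Fin 4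
  | .inl u => .inl (.inl (.inl u))
  | .inr (x, _) => .inr (x, 0)

/-- An edge of a butterfly in the component of a half-edge of a drawing. -/
def edgeNear {U X : Type} :
    ((U ⊕ X × Fin 2) ⊕ (U ⊕ X × Fin 2)) ⊕ X × Fin 4 → U ⊕ X × Wing
  | .inl (.inl e) => first₁ e
  | .inl (.inr e) => first₂ e
  | .inr (x, _) => .inr (x, .mid)

theorem Drawing.component_halfEdgeNear_first₁ (e : P.U ⊕ P.X × Fin 2) :
    (Quotient.mk _ (halfEdgeNear (first₁ e)) : Component (planarRotation P.X P.rot₁ P.rot₂)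
      (segments P.U P.X)) = Quotient.mk _ (.inl (.inl e)) := by
  rcases e with u | ⟨x, i⟩
  · rfl
  · fin_cases i
    · exact component_eq_right rfl
    · exact (P.component_crossing x 1).symm.trans (component_eq_right rfl)

theorem Drawing.component_halfEdgeNear_first₂ (e : P.U ⊕ P.X × Fin 2) :
    (Quotient.mk _ (halfEdgeNear (first₂ e)) : Component (planarRotation P.X P.rot₁ P.rot₂)
      (segments P.U P.X)) = Quotient.mk _ (.inl (.inr e)) := by
  rcases e with u | ⟨x, i⟩
  · exact component_eq_right rfl
  · fin_cases i
    · exact (P.component_crossing x 2).symm.trans (component_eq_right rfl)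
    · exact (P.component_crossing x 3).symm.trans (component_eq_right rfl)

/-- A butterfly is connected, as is the star of a crossing point, and both reach the same four ends.
Hence the replacement neither joins nor separates components. -/
theorem Drawing.card_component_butterfly :
    Nat.card (Component P.butterflyRot₁ P.butterflyRot₂) =
      Nat.card (Component (planarRotation P.X P.rot₁ P.rot₂) (segments P.U P.X)) := by
  have h₁ : ∀ e, (Quotient.mk _ (halfEdgeNear (first₁ (P.rot₁ e))) :
      Component (planarRotation P.X P.rot₁ P.rot₂) (segments P.U P.X)) =
      Quotient.mk _ (halfEdgeNear (first₁ e)) := fun e => by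
    rw [P.component_halfEdgeNear_first₁, P.component_halfEdgeNear_first₁]
    exact component_eq_left rfl
  have h₂ : ∀ e, (Quotient.mk _ (halfEdgeNear (first₂ (P.rot₂ e))) :
      Component (planarRotation P.X P.rot₁ P.rot₂) (segments P.U P.X)) =
      Quotient.mk _ (halfEdgeNear (first₂ e)) := fun e => by
    rw [P.component_halfEdgeNear_first₂, P.component_halfEdgeNear_first₂]
    exact component_eq_left rfl
  refine card_component_congr halfEdgeNear edgeNear ?_ ?_ ?_ ?_ ?_ ?_
  · rintro (u | ⟨x, _ | _⟩)
    · exact h₁ (.inl u)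
    · rfl
    · rfl
    · exact h₁ (.inr (x, 0))
    · rfl
    · rfl
    · rfl
    · exact h₁ (.inr (x, 1))
  · rintro (u | ⟨x, _ | _⟩)
    · exact h₂ (.inl u)
    · exact h₂ (.inr (x, 0))
    · rfl
    · rfl
    · rfl
    · exact h₂ (.inr (x, 1))
    · rfl
    · rfl
  · rintro ((e | e) | ⟨x, i⟩)
    · refine (component_eq_left (x := last₁ e) (next₁_last₁ P.rot₁ e)).trans ?_
      rcases e with u | ⟨x, i⟩
      · rfl
      · fin_cases i <;> exact component_eq_left rfl
    · refine (component_eq_right (x := last₂ e) (next₂_last₂ P.rot₂ e)).trans ?_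
      rcases e with u | ⟨x, i⟩
      · rfl
      · fin_cases i <;> exact component_eq_right rfl
    · rfl
  · rintro (((u | ⟨x, i⟩) | (u | ⟨x, i⟩)) | ⟨x, i⟩)
    · rfl
    · fin_cases i <;> exact (P.component_wing x _).symm
    · rfl
    · fin_cases i <;> exact (P.component_wing x _).symm
    · fin_cases i <;> exact P.component_wing x _
  · rintro (u | ⟨x, w⟩)
    · rfl
    · exact (P.component_wing x w).symm
  · rintro ((e | e) | ⟨x, i⟩)
    · exact P.component_halfEdgeNear_first₁ e
    · exact P.component_halfEdgeNear_first₂ e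
    · exact (P.component_crossing x i).symm

/-- The insertion of the butterflies produces a plane graph. -/
theorem Drawing.isPlaneEmbedding_butterfly :
    IsPlaneEmbedding P.butterfly P.butterflyRot₁ P.butterflyRot₂ := by
  refine ⟨P.star₁_butterfly, P.star₂_butterfly, ?_⟩
  have h := P.spherical
  unfold IsSpherical at h ⊢
  have hrot : cycleCount (planarRotation P.X P.rot₁ P.rot₂) =
      cycleCount P.rot₁ + cycleCount P.rot₂ + Nat.card P.X := by
    rw [← cycleCount_rotate, ← cycleCount_sumCongr, ← cycleCount_sumCongr]
    rfl
  have hE : Nat.card P.butterfly.E = Nat.card P.U + 7 * Nat.card P.X := by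
    have h7 : Nat.card Wing = 7 := by rw [Nat.card_eq_fintype_card]; rfl
    change Nat.card (P.U ⊕ P.X × Wing) = _
    rw [Nat.card_sum, Nat.card_prod, h7, mul_comm]
  -- At each crossing one vertex and four segments give way to two vertices, seven edges and two
  -- faces; the contribution to the Euler characteristic is `1 - 4 = 2 - 7 + 2`.
  rw [P.cycles_butterflyRot₁.1, P.cycles_butterflyRot₂.1, P.cycleCount_faces,
    P.card_component_butterfly, hE]
  rw [hrot, cycleCount_segments] at h
  simp only [Nat.card_sum, Nat.card_prod, Nat.card_fin] at h
  omega

end ButterflySphere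

/-! ### Fox calculus and the Alexander matrix -/

section FoxInv

variable {ι : Type} [DecidableEq ι]

theorem fox_inv (i : ι) (v : FreeGroup ι) :
    fox i v⁻¹ = -(MonoidAlgebra.of ℤ _ v⁻¹ * fox i v) := by
  have h := fox_mul i v⁻¹ v
  rw [inv_mul_cancel, fox_one] at h
  exact eq_neg_of_add_eq_zero_left h.symm

end FoxInv

namespace KnotDiagram

variable {D : KnotDiagram} {R : Type u} [CommRing R] {n : ℕ}

theorem fox_gen (q : {f : D.Face // f ≠ D.outer}) (f : D.Face) :
    fox q (D.gen f) = if f = q.1 then 1 else 0 := by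
  by_cases hf : f = D.outer
  · have h1 : D.gen f = 1 := dif_neg (not_not.2 hf)
    rw [h1, fox_one, if_neg]
    exact fun h => q.2 (h ▸ hf)
  · have h1 : D.gen f = FreeGroup.of ⟨f, hf⟩ := dif_pos hf
    rw [h1, fox_of]
    simp [Subtype.ext_iff]

variable (ρ : D.KnotGroup →* Matrix.GeneralLinearGroup (Fin n) R)

theorem Phi_of (v : D.Free) : Phi ρ (MonoidAlgebra.of ℤ _ v) = tensorRep ρ (D.toKnotGroup v) := by
  simp [Phi]

theorem toKnotGroup_relator (c : D.Crossing) : D.toKnotGroup (D.relator c) = 1 :=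
  PresentedGroup.one_of_mem ⟨c, rfl⟩

/-- This is the Dehn relation at the crossing. It transfers to the over-meridian the value of the
abelianization, which is prescribed on outgoing half-edges. -/
theorem meridian_eq_overMeridian (c : D.Crossing) : D.meridian (c, 0) = D.overMeridian c := by
  have h := toKnotGroup_relator c
  rw [relator, map_mul, map_inv, mul_inv_eq_one] at h
  exact h.symm

theorem tensorRep_overMeridian (c : D.Crossing) :
    tensorRep ρ (D.overMeridian c) = (LaurentPolynomial.T 1 : R[T;T⁻¹]) •
      (ρ (D.overMeridian c) : Matrix (Fin n) (Fin n) R).map LaurentPolynomial.C := by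
  have h : D.abelianization (D.overMeridian c) = Multiplicative.ofAdd 1 := by
    rw [← meridian_eq_overMeridian]
    exact Classical.choose_spec D.exists_abelianization (c, 0) (Or.inl rfl)
  change (LaurentPolynomial.T (Multiplicative.toAdd (D.abelianization (D.overMeridian c))) :
    R[T;T⁻¹]) • (ρ (D.overMeridian c) : Matrix (Fin n) (Fin n) R).map LaurentPolynomial.C = _
  rw [h]
  rfl

/-- The blocks of the Alexander matrix: the corner matrices, with alternating signs. -/
theorem Phi_fox_relator (c : D.Crossing) (q : {f : D.Face // f ≠ D.outer}) :
    Phi ρ (fox q (D.relator c)) = ∑ k : Fin 4,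
      if D.face (c, k) = q.1 then (-1) ^ (k : ℕ) * D.cornerMatrix ρ (c, k) else 0 := by
  have h1 : D.toKnotGroup (D.gen (D.face (c, 2)) * (D.gen (D.face (c, 1)))⁻¹) = D.overMeridian c :=
    rfl
  have h2 : D.toKnotGroup (D.gen (D.face (c, 3)) * (D.gen (D.face (c, 0)))⁻¹) = D.overMeridian c :=
    meridian_eq_overMeridian c
  set a := D.gen (D.face (c, 2)) with ha
  set b := D.gen (D.face (c, 1)) with hb
  set d := D.gen (D.face (c, 3)) with hd
  set t := D.gen (D.face (c, 0)) with ht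
  have hrel : D.relator c = a * b⁻¹ * (d * t⁻¹)⁻¹ := rfl
  have hof : ∀ v x, Phi ρ (MonoidAlgebra.of ℤ _ v * x) =
      tensorRep ρ (D.toKnotGroup v) * Phi ρ x := fun v x => by rw [map_mul, Phi_of]
  -- Product rule for `(a b⁻¹) (d t⁻¹)⁻¹`. In the knot group the relator becomes trivial and both `a
  -- b⁻¹` and `d t⁻¹` become the over-meridian, so the bottom and right corners carry `1` and `-1`,
  -- the left and top corners the matrix `t X` with signs `-` and `+`.
  have hexp : fox q (D.relator c) = fox q a - MonoidAlgebra.of ℤ _ (a * b⁻¹) * fox q b -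
      MonoidAlgebra.of ℤ _ (D.relator c) * fox q d +
      MonoidAlgebra.of ℤ _ (D.relator c) * (MonoidAlgebra.of ℤ _ (d * t⁻¹) * fox q t) := by
    rw [hrel, fox_mul, fox_mul, fox_inv, fox_inv, fox_mul, fox_inv]
    simp only [map_mul]
    noncomm_ring
  have hM := tensorRep_overMeridian ρ c
  have c0 : D.cornerMatrix ρ (c, 0) = tensorRep ρ (D.overMeridian c) := by
    rw [hM, cornerMatrix, if_pos (Or.inl rfl)]
  have c1 : D.cornerMatrix ρ (c, 1) = tensorRep ρ (D.overMeridian c) := by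
    rw [hM, cornerMatrix, if_pos (Or.inr rfl)]
  have c2 : D.cornerMatrix ρ (c, 2) = 1 :=
    if_neg (show ¬((2 : Fin 4) = 0 ∨ (2 : Fin 4) = 1) by decide)
  have c3 : D.cornerMatrix ρ (c, 3) = 1 :=
    if_neg (show ¬((3 : Fin 4) = 0 ∨ (3 : Fin 4) = 1) by decide)
  rw [hexp, map_add, map_sub, map_sub, hof, hof, hof, hof, h1, h2, toKnotGroup_relator, map_one,
    one_mul, one_mul, Fin.sum_univ_four, c0, c1, c2, c3]
  rw [ha, hb, hd, ht, fox_gen, fox_gen, fox_gen, fox_gen]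
  simp only [apply_ite (Phi ρ), map_one, map_zero]
  simp only [Fin.coe_ofNat_eq_mod, Nat.zero_mod, pow_zero, one_mul, mul_ite, mul_one, mul_zero,
    Nat.reduceMod, neg_mul, pow_succ, neg_neg]
  split_ifs <;> abel

/-- The checkerboard colouring: the parity of the Alexander numbering changes across every edge. -/
theorem exists_face_sign (D : KnotDiagram) :
    ∃ v : D.Face → ℤˣ, ∀ h, v (D.right h) = -v (D.left h) := by
  obtain ⟨w, -, hw⟩ := D.exists_numbering
  refine ⟨fun f => (-1) ^ w f, ?_⟩
  have ho : ∀ h, IsOutgoing D.positive h →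
      (-1 : ℤˣ) ^ w (D.right h) = -(-1) ^ w (D.left h) := fun h hh => by
    rw [eq_add_of_sub_eq' (hw h hh), zpow_add_one, mul_neg_one]
  intro h
  by_cases hh : IsOutgoing D.positive h
  · exact ho h hh
  · have := ho _ ((D.oriented h).2 hh)
    rw [D.left_glue, D.right_glue] at this
    simp only [this, neg_neg]

/-- Consecutive corners of a crossing are separated by one half-edge, so their colours alternate as
`(-1) ^ k` does; the colour of the top corner fixes the sign of the row. -/
theorem exists_corner_sign (D : KnotDiagram) :
    ∃ (s : D.Crossing → ℤˣ) (v : D.Face → ℤˣ), ∀ c (k : Fin 4),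
      (-1) ^ (k : ℕ) = s c * v (D.face (c, k)) := by
  obtain ⟨v, hv⟩ := D.exists_face_sign
  refine ⟨fun c => v (D.face (c, 0)), v, fun c k => ?_⟩
  have h0 : v (D.face (c, 3)) = -v (D.face (c, 0)) := hv (c, 0)
  have h1 : v (D.face (c, 0)) = -v (D.face (c, 1)) := hv (c, 1)
  have h2 : v (D.face (c, 1)) = -v (D.face (c, 2)) := hv (c, 2)
  have h3 := Int.units_mul_self (v (D.face (c, 2)))
  rw [h2] at h1
  rw [h1] at h0
  fin_cases k <;> simp [h0, h1, h2, h3, pow_succ]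

theorem biadjacency_alexanderGraph (f₁ : D.Face) (S : Set (D.HalfEdge × Fin n × Fin n))
    (hS : ∀ h i j, D.cornerMatrix ρ h i j ≠ 0 → (h, i, j) ∈ S)
    (p : D.Crossing × Fin n) (q : D.Kept f₁ × Fin n) :
    (D.alexanderGraph f₁ ρ S).biadjacency p q =
      ∑ k : Fin 4, if D.face (p.1, k) = q.1.1 then D.cornerMatrix ρ (p.1, k) p.2 q.2 else 0 := by
  classical
  let F : D.HalfEdge × Fin n × Fin n → R[T;T⁻¹] := fun e =>
    if e.1.1 = p.1 ∧ e.2.1 = p.2 ∧ D.face e.1 = q.1.1 ∧ e.2.2 = q.2 then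
      D.cornerMatrix ρ e.1 e.2.1 e.2.2 else 0
  have h1 : (D.alexanderGraph f₁ ρ S).biadjacency p q =
      ∑ e : {e : D.HalfEdge × Fin n × Fin n //
        (D.face e.1 ≠ D.outer ∧ D.face e.1 ≠ f₁) ∧ e ∈ S}, F e.1 := by
    refine ((D.alexanderGraph f₁ ρ S).biadjacency_apply p q).trans (Finset.sum_congr ?_ ?_)
    · exact Finset.ext fun e => iff_of_true (Finset.mem_univ _) (Finset.mem_univ _)
    · intro e _
      obtain ⟨p₁, p₂⟩ := p
      obtain ⟨q₁, q₂⟩ := q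
      simp only [F, alexanderGraph, Prod.mk.injEq, Subtype.ext_iff, and_assoc]
  -- Since `S` contains every corner entry of nonzero weight, the sum over the drawn edges may be
  -- extended over all corner entries.
  rw [h1, ← Finset.sum_subtype (Finset.univ.filter _) (fun e => Finset.mem_filter_univ e) F,
    Finset.sum_filter_of_ne]
  · rw [Fintype.sum_prod_type, Fintype.sum_prod_type, Finset.sum_eq_single p.1]
    · refine Finset.sum_congr rfl fun k _ => ?_
      rw [Finset.sum_eq_single (p.2, q.2)]
      · simp [F]
      · rintro ⟨i, j⟩ - hne
        refine if_neg fun h => hne ?_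
        rw [← h.2.1, ← h.2.2.2]
      · simp
    · intro c _ hc
      exact Finset.sum_eq_zero fun k _ => Finset.sum_eq_zero fun x _ => if_neg fun h => hc h.1
    · simp
  · rintro ⟨h, i, j⟩ - hne
    simp only [F] at hne
    split_ifs at hne with hc
    · exact ⟨hc.2.2.1 ▸ q.1.2, hS h i j hne⟩
    · exact absurd rfl hne

/-- Multiplying each row by the sign of its crossing and each column by the sign of its face turns
the biadjacency matrix into the reduced Alexander matrix. With faces ordered as in the definition of
the polynomial, no further sign arises. -/
theorem twistedAlexander_eq {f₁ : D.Face} (h : D.outer ≠ f₁)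
    (S : Set (D.HalfEdge × Fin n × Fin n))
    (hS : ∀ h i j, D.cornerMatrix ρ h i j ≠ 0 → (h, i, j) ∈ S) :
    ∃ (θ : (D.alexanderGraph f₁ ρ S).V₁ ≃ (D.alexanderGraph f₁ ρ S).V₂) (κ : ℤˣ),
      D.twistedAlexander h ρ = ((κ : ℤ) : R[T;T⁻¹]) *
        ((D.alexanderGraph f₁ ρ S).biadjacency.submatrix id θ).det := by
  obtain ⟨s, v, hsv⟩ := D.exists_corner_sign
  let θ : D.Crossing × Fin n ≃ D.Kept f₁ × Fin n := (D.ordering h).prodCongr (Equiv.refl _)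
  let N : Matrix (D.Crossing × Fin n) (D.Crossing × Fin n) R[T;T⁻¹] := fun p q =>
    (D.alexanderGraph f₁ ρ S).biadjacency p (θ q)
  refine ⟨θ, (∏ p : D.Crossing × Fin n, s p.1) *
    ∏ q : D.Crossing × Fin n, v (D.ordering h q.1).1, ?_⟩
  have hdet : D.twistedAlexander h ρ = (Matrix.of fun p q : D.Crossing × Fin n =>
      (((s p.1 : ℤˣ) : ℤ) : R[T;T⁻¹]) * Matrix.of (fun p q : D.Crossing × Fin n =>
        (((v (D.ordering h q.1).1 : ℤˣ) : ℤ) : R[T;T⁻¹]) * N p q) p q).det := by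
    unfold twistedAlexander
    congr 1
    refine Matrix.ext fun p q => ?_
    rw [Matrix.submatrix_apply, id_eq, alexanderMatrix, Phi_fox_relator, Matrix.sum_apply]
    simp only [Matrix.of_apply, N, biadjacency_alexanderGraph ρ f₁ S hS, Finset.mul_sum]
    refine Finset.sum_congr rfl fun k _ => ?_
    have hθ : (θ q).1.1 = (D.ordering h q.1).1 := rfl
    rw [hθ]
    split_ifs with hk
    · rw [← hk, ← mul_assoc, ← Int.cast_mul, ← Units.val_mul, ← hsv]
      have hθ₂ : (θ q).2 = q.2 := rfl
      rw [hθ₂]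
      rcases Nat.even_or_odd (k : ℕ) with hk' | hk' <;> simp [hk'.neg_one_pow]
    · simp
  rw [hdet, Matrix.det_mul_column, Matrix.det_mul_row, ← mul_assoc]
  congr 1
  simp [Units.coe_prod]

end KnotDiagram

end TwistedDimer

/-! ### The theorem -/

open scoped LaurentPolynomial in
open TwistedDimer in
theorem mainTheorem1 {R : Type*} [CommRing R] [IsDomain R] {n : ℕ}
    (D : KnotDiagram) (ρ : D.KnotGroup →* Matrix.GeneralLinearGroup (Fin n) R)
    (f₁ : D.Face) (hf₁ : D.Adjacent D.outer f₁)
    (S : Set (D.HalfEdge × Fin n × Fin n))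
    (hS : ∀ h i j, D.cornerMatrix ρ h i j ≠ 0 → (h, i, j) ∈ S)
    (Γ'' : BipGraph R[T;T⁻¹]) (hΓ'' : IsTripling (D.alexanderGraph f₁ ρ S) Γ'')
    (P : Drawing Γ'') :
    IsPlaneEmbedding P.butterfly P.butterflyRot₁ P.butterflyRot₂ ∧
    ∀ unbounded : Set (Face P.butterflyRot₁ P.butterflyRot₂),
      IsUnbounded P.butterflyRot₁ P.butterflyRot₂ unbounded →
      (∃ ε, IsKasteleyn P.butterflyRot₁ P.butterflyRot₂ unbounded ε) ∧
      ∀ ε : P.butterfly.E → ℤˣ,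
        IsKasteleyn P.butterflyRot₁ P.butterflyRot₂ unbounded ε →
        DotEq (P.butterfly.withSigns ε).partitionFunction (D.twistedAlexander hf₁.1 ρ) := by
  refine ⟨P.isPlaneEmbedding_butterfly, fun U hU => ⟨exists_isKasteleyn hU, fun ε hε => ?_⟩⟩
  obtain ⟨θ, κ, hκ⟩ := D.twistedAlexander_eq ρ hf₁.1 S hS
  obtain ⟨θ', κ', hκ'⟩ := hΓ''.exists_det_eq θ
  obtain ⟨κ'', hκ''⟩ := BipGraph.partitionFunction_withSigns P.isPlaneEmbedding_butterfly hU hε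
    (θ'.sumCongr (Equiv.refl P.X))
  have h := hκ''.trans (congrArg _ (P.det_butterfly θ'))
  rw [hκ'] at h
  -- No power of `t` is lost: the corner weights are exactly the Fox derivatives up to sign, and
  -- every other step preserves the determinant up to sign.
  refine ⟨0, ?_⟩
  rw [h, hκ, LaurentPolynomial.T_zero, one_mul]
  rcases neg_one_pow_eq_or R[T;T⁻¹] (Fintype.card P.X) with h₀ | h₀ <;>
    rcases Int.units_eq_one_or κ with rfl | rfl <;>
    rcases Int.units_eq_one_or κ' with rfl | rfl <;>
    rcases Int.units_eq_one_or κ'' with rfl | rfl <;> simp [h₀]
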